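/- Let $J=[0,1]$, let $\mathcal D$ be the family of dyadic subintervals of $J$ (including $J$), let $|I|$ be the length of $I$ and $\langle g\rangle_I=|I|^{-1}\int_I g$ (entrywise for matrix functions). Let $h_I=|I|^{-1/2}(\chi_{I_+}-\chi_{I_-})$ be the $L^2$-normalized Haar function, where $I_-,I_+$ are the left and right halves of $I$, and $(f,h_I)=\int_J f h_I\,dx$. A $d\times d$ matrix weight on $J$ is a function $W$ from $J$ to the complex $d\times d$ matrices with integrable entries and with $W(x)$ positive semidefinite for almost every $x$. Let $L^2_{\mathbb C^d}(W)$ be the space of measurable $f:J\to\mathbb C^d$ with $\|f\|_{L^2_{\mathbb C^d}(W)}^2=\int_J\|W(x)^{1/2}f(x)\|^2_{\mathbb C^d}\,dx<\infty$. Put $$[W]_{A_2}=\sup_{I\in\mathcal D}\big\|\langle W\rangle_I^{1/2}\langle W^{-1}\rangle_I^{1/2}\big\|^2 ,$$ understood as $\infty$ unless $W$ is invertible almost everywhere and $W^{-1}$ has integrable entries. For a scalar weight $w\ge 0$ let $[w]_{A_\infty}$ be the least $C$ such that $\langle M_Iw\rangle_I\le C\langle w\rangle_I$ for all $I\in\mathcal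 D$, where $M_Iw(x)=\sup\{\langle w\rangle_L: L\in\mathcal D,\ x\in L\subseteq I\}$; for a matrix weight $V$ let $[V]_{A_\infty}=\sup_{e\in\mathbb C^d}[V_e]_{A_\infty}$ with $V_e(x)=\langle V(x)e,e\rangle_{\mathbb C^d}$. For signs $\sigma=(\sigma_I)_{I\in\mathcal D}$ let $T_\sigma f=\sum_{I\in\mathcal D}\sigma_I(f,h_I)h_I$ (pointwise limit of the sums over $|I|>2^{-N}$ as $N\to\infty$), and define the matrix-weighted dyadic square function $$S_Wf(x)=\Big(\mathbb E\,\big\|W(x)^{1/2}T_\sigma f(x)\big\|_{\mathbb C^d}^2\Big)^{1/2},$$ where $\mathbb E$ is the expectation over independent, uniformly distributed random signs $\sigma_I=\pm1$. Its operator norm $\|S_W\|_{L^2_{\mathbb C^d}(W)\to L^2_{\mathbb R}}$ is the least $C$ with $\|S_Wf\|_{L^2(J)}\le C\|f\|_{L^2_{\mathbb C^d}(W)}$ for all $f\in L^2_{\mathbb C^d}(W)$. **Theorem.** (i) For every $d$ there is a constant $C_d<\infty$, depending only on $d$, such that for every $d\times d$ matrix weight $W$ on $J$ with $[W]_{A_2}<\infty$,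 $S_W$ is a well-defined map from $L^2_{\mathbb C^d}(W)$ to $L^2_{\mathbb R}$ (for every $f\in L^2_{\mathbb C^d}(W)$ the series for $T_\sigma f(x)$ converges for almost every $x$ and almost every choice of signs, and $S_Wf$ is measurable and square integrable), and $$\|S_W\|_{L^2_{\mathbb C^d}(W)\to L^2_{\mathbb R}}\le C_d\,[W]_{A_2}^{1/2}[W^{-1}]_{A_\infty}^{1/2},\qquad \|S_W\|_{L^2_{\mathbb C^d}(W)\to L^2_{\mathbb R}}\le C_d\,[W]_{A_2}.$$ (ii) There is an absolute constant $C<\infty$ such that $[W]_{A_2}^{1/2}[W^{-1}]_{A_\infty}^{1/2}\le C\,[W]_{A_2}$ for all $d$ and all such $W$. (iii) The linear dependence is optimal among all bounds of the form $\varphi([W]_{A_2})$, in every dimension $d\ge1$ and in particular in the scalar case $d=1$: there is an absolute constant $c>0$ such that, for every $d\ge 1$, if a function $\varphi:[0,\infty]\to[0,\infty]$ satisfies $\|S_W\|_{L^2_{\mathbb C^d}(W)\to L^2_{\mathbb R}}\le\varphi([W]_{A_2})$ for every $d\times d$ matrix weight $W$ with $[W]_{A_2}<\infty$, then $\varphi(t)\ge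 c\,t$ for all $t\in[1,\infty)$. -/

import Mathlib

open MeasureTheory Filter Topology
open scoped ENNReal NNReal ComplexOrder MatrixOrder

noncomputable section

namespace MatrixWeight

/-- The base interval `J = [0, 1]`. -/
def J : Set ℝ := Set.Icc 0 1

/-- The index `⟨n, j⟩`, `0 ≤ j < 2 ^ n`, stands for the dyadic interval `[j / 2 ^ n, (j + 1) / 2 ^ n)`
of `[0, 1]`, of length `2 ^ (-n)`. -/
abbrev DyadicIndex : Type := Σ n : ℕ, Fin (2 ^ n)

namespace DyadicIndex

/-- The dyadic interval itself. -/
def interval (I : DyadicIndex) : Set ℝ :=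
  Set.Ico ((I.2 : ℝ) / 2 ^ I.1) (((I.2 : ℝ) + 1) / 2 ^ I.1)

/-- The midpoint of the dyadic interval. -/
def midpoint (I : DyadicIndex) : ℝ := ((I.2 : ℝ) + 1 / 2) / 2 ^ I.1

/-- The left half `I₋`. -/
def left (I : DyadicIndex) : Set ℝ := Set.Ico ((I.2 : ℝ) / 2 ^ I.1) I.midpoint

/-- The right half `I₊`. -/
def right (I : DyadicIndex) : Set ℝ := Set.Ico I.midpoint (((I.2 : ℝ) + 1) / 2 ^ I.1)

/-- The Haar function `h_I = |I| ^ (-1/2) (χ_{I₊} - χ_{I₋})`, normalized in `L²`. -/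
def haar (I : DyadicIndex) (x : ℝ) : ℝ :=
  √(2 ^ I.1) * (I.right.indicator 1 x - I.left.indicator 1 x)

end DyadicIndex

/-! ### Scalar dyadic `A_∞` characteristic -/

/-- The average `⟨w⟩_I = |I|⁻¹ ∫_I w`. -/
def scalarAverage (I : DyadicIndex) (w : ℝ → ℝ≥0∞) : ℝ≥0∞ :=
  laverage (volume.restrict I.interval) w

/-- The dyadic maximal function of `w`, localized to `I`:
the supremum of the averages of `w` over the dyadic `L ⊆ I` that contain `x`. -/
def localMaximal (w : ℝ → ℝ≥0∞) (I : DyadicIndex) (x : ℝ) : ℝ≥0∞ :=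
  ⨆ (L : DyadicIndex) (_ : L.interval ⊆ I.interval) (_ : x ∈ L.interval), scalarAverage L w

/-- `[w]_{A_∞}`: the best constant `C` in `⟨M_I w⟩_I ≤ C ⟨w⟩_I` for all dyadic `I`. -/
def scalarAInfty (w : ℝ → ℝ≥0∞) : ℝ≥0∞ :=
  sInf {C : ℝ≥0∞ | ∀ I : DyadicIndex,
    scalarAverage I (localMaximal w I) ≤ C * scalarAverage I w}

variable {d : ℕ}

/-! ### Matrix weights -/

/-- The action of a matrix on `ℂ ^ d` with the Euclidean norm, as a bounded operator. -/
def op (A : Matrix (Fin d) (Fin d) ℂ) :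
    EuclideanSpace ℂ (Fin d) →L[ℂ] EuclideanSpace ℂ (Fin d) :=
  Matrix.toEuclideanCLM (n := Fin d) (𝕜 := ℂ) A

/-- All entries of `W` are integrable on `[0, 1]`. -/
def EntrywiseIntegrable (W : ℝ → Matrix (Fin d) (Fin d) ℂ) : Prop :=
  ∀ i j, IntegrableOn (fun x => W x i j) J

/-- A `d × d` matrix weight on `[0, 1]`: entrywise integrable and
positive semidefinite almost everywhere. -/
structure IsMatrixWeight (W : ℝ → Matrix (Fin d) (Fin d) ℂ) : Prop where
  integrable : EntrywiseIntegrable W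
  posSemidef : ∀ᵐ x ∂volume.restrict J, (W x).PosSemidef

/-- The average `⟨W⟩_I`, taken entrywise. -/
def matAverage (W : ℝ → Matrix (Fin d) (Fin d) ℂ) (I : DyadicIndex) :
    Matrix (Fin d) (Fin d) ℂ :=
  Matrix.of fun i j => ⨍ x in I.interval, W x i j

open Classical in
/-- The dyadic matrix characteristic
`[W]_{A_2} = sup_I ‖⟨W⟩_I ^ (1/2) ⟨W⁻¹⟩_I ^ (1/2)‖ ^ 2`; it is `∞` if `W` fails to be invertible
almost everywhere or if `W⁻¹` fails to be integrable. -/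
def matrixA2 (W : ℝ → Matrix (Fin d) (Fin d) ℂ) : ℝ≥0∞ :=
  if (∀ᵐ x ∂volume.restrict J, IsUnit (W x)) ∧ EntrywiseIntegrable (fun x => (W x)⁻¹) then
    ⨆ I : DyadicIndex,
      ‖op (CFC.sqrt (matAverage W I) * CFC.sqrt (matAverage (fun x => (W x)⁻¹) I))‖ₑ ^ 2
  else ∞

/-- The scalar weight `W_e(x) = ⟨W(x) e, e⟩`. -/
def scalarWeight (W : ℝ → Matrix (Fin d) (Fin d) ℂ) (e : EuclideanSpace ℂ (Fin d)) (x : ℝ) :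
    ℝ≥0∞ :=
  ENNReal.ofReal (RCLike.re (inner ℂ e (op (W x) e)))

/-- The dyadic matrix characteristic `[W]_{A_∞} = sup_e [W_e]_{A_∞}`. -/
def matrixAInfty (W : ℝ → Matrix (Fin d) (Fin d) ℂ) : ℝ≥0∞ :=
  ⨆ e : EuclideanSpace ℂ (Fin d), scalarAInfty (scalarWeight W e)

/-- The norm `‖f‖_{L²(W)} = (∫_J ‖W(x) ^ (1/2) f(x)‖ ^ 2 dx) ^ (1/2)`. -/
def weightedNorm (W : ℝ → Matrix (Fin d) (Fin d) ℂ) (f : ℝ → EuclideanSpace ℂ (Fin d)) : ℝ≥0∞ :=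
  (∫⁻ x in J, ‖op (CFC.sqrt (W x)) (f x)‖ₑ ^ 2) ^ (1 / 2 : ℝ)

/-- Membership in `L²_{ℂ^d}(W)`. -/
structure MemWeightedL2 (W : ℝ → Matrix (Fin d) (Fin d) ℂ) (f : ℝ → EuclideanSpace ℂ (Fin d)) :
    Prop where
  aestronglyMeasurable : AEStronglyMeasurable f (volume.restrict J)
  norm_lt_top : weightedNorm W f < ∞

/-! ### Random signs and the square function -/

/-- The law of a uniformly distributed random sign `±1`. -/
def signLaw : Measure ℝ :=
  (2⁻¹ : ℝ≥0∞) • Measure.dirac 1 + (2⁻¹ : ℝ≥0∞) • Measure.dirac (-1)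

instance : IsProbabilityMeasure signLaw :=
  ⟨by simp [signLaw, ENNReal.inv_two_add_inv_two]⟩

/-- The joint law of independent uniformly distributed random signs `σ_I = ±1`,
indexed by the dyadic intervals. -/
def signs : Measure (DyadicIndex → ℝ) := Measure.infinitePi fun _ => signLaw

/-- The Haar coefficient `(f, h_I) ∈ ℂ ^ d`. -/
def haarCoeff (f : ℝ → EuclideanSpace ℂ (Fin d)) (I : DyadicIndex) : EuclideanSpace ℂ (Fin d) :=
  ∫ x in J, I.haar x • f x

/-- The partial sum of `T_σ f(x) = ∑_I σ_I (f, h_I) h_I(x)` over the dyadic intervals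
of length greater than `2 ^ (-N)`. -/
def transformPartial (σ : DyadicIndex → ℝ) (f : ℝ → EuclideanSpace ℂ (Fin d)) (N : ℕ) (x : ℝ) :
    EuclideanSpace ℂ (Fin d) :=
  ∑ n ∈ Finset.range N, ∑ j : Fin (2 ^ n),
    (σ ⟨n, j⟩ * DyadicIndex.haar ⟨n, j⟩ x) • haarCoeff f ⟨n, j⟩

/-- `T_σ f(x) = ∑_I σ_I (f, h_I) h_I(x)`, summed by generations. -/
def transform (σ : DyadicIndex → ℝ) (f : ℝ → EuclideanSpace ℂ (Fin d)) (x : ℝ) :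
    EuclideanSpace ℂ (Fin d) :=
  limUnder atTop fun N => transformPartial σ f N x

/-- The matrix-weighted square function
`S_W f(x) = (𝔼 ‖W(x) ^ (1/2) T_σ f(x)‖ ^ 2) ^ (1/2)`. -/
def squareFunction (W : ℝ → Matrix (Fin d) (Fin d) ℂ) (f : ℝ → EuclideanSpace ℂ (Fin d))
    (x : ℝ) : ℝ≥0∞ :=
  (∫⁻ σ, ‖op (CFC.sqrt (W x)) (transform σ f x)‖ₑ ^ 2 ∂signs) ^ (1 / 2 : ℝ)

/-- The norm `‖g‖_{L²}` on `[0, 1]` of a nonnegative function. -/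
def l2Norm (g : ℝ → ℝ≥0∞) : ℝ≥0∞ := (∫⁻ x in J, g x ^ 2) ^ (1 / 2 : ℝ)

/-- The operator norm of `S_W : L²_{ℂ^d}(W) → L²_ℝ`: the least `C` with
`‖S_W f‖_{L²} ≤ C ‖f‖_{L²(W)}` for all `f`. -/
def squareFunctionNorm (W : ℝ → Matrix (Fin d) (Fin d) ℂ) : ℝ≥0∞ :=
  sInf {C : ℝ≥0∞ | ∀ f : ℝ → EuclideanSpace ℂ (Fin d), MemWeightedL2 W f →
    l2Norm (squareFunction W f) ≤ C * weightedNorm W f}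

/-- `S_W` is well defined as a map `L²_{ℂ^d}(W) → L²_ℝ`: for every `f` in `L²_{ℂ^d}(W)`, the series
that defines `T_σ f(x)` converges for almost every `x` and almost every choice of signs,
and `S_W f` is measurable and square integrable. -/
def MapsToL2 (W : ℝ → Matrix (Fin d) (Fin d) ℂ) : Prop :=
  ∀ f : ℝ → EuclideanSpace ℂ (Fin d), MemWeightedL2 W f →
    (∀ᵐ x ∂volume.restrict J, ∀ᵐ σ ∂signs,
      ∃ v, Tendsto (fun N => transformPartial σ f N x) atTop (𝓝 v)) ∧
    AEMeasurable (squareFunction W f) (volume.restrict J) ∧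
    l2Norm (squareFunction W f) < ∞

end MatrixWeight

end

/-! Independence of the signs makes the squared norm of `S_W f` equal to the sum over `I` of the
quadratic form of `⟨W⟩_I` at the Haar coefficient `(f, h_I)` (`IsRegular.l2Norm_squareFunction`).
Everything else concerns this sum. Write `V = W⁻¹`, `Q = [W]_{A_2}`, `A = [V]_{A_∞}`.

Upper bound. Fix a dyadic `L` and freeze the matrix `⟨W⟩_L`. As long as `p = tr(⟨W⟩_L⁻¹ ⟨W⟩_K) / d`
stays at most 4, the form of `⟨W⟩_K` is at most `4d` times that of `⟨W⟩_L`, and the Haar terms are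
controlled by the increments of the energy `‖⟨W⟩_L^{1/2} ⟨f⟩_K‖²`. Stopping also when the average
`u` of `‖⟨W⟩_L^{1/2} f‖` becomes large bounds this energy. Both `p` and `u` are nonnegative
martingales, so in relative length at most half of `L` is stopped, and the argument restarts there.
The result is domination of the sum by a maximal function (`descendantSum_le_maxAverage`), in the
manner of sparse domination but by induction on finite trees, with no sparse family.

To bound `u`, use `‖⟨W⟩_L^{1/2} f‖² ≤ tr(⟨W⟩_L V) ⟨W f, f⟩`. The scalar weight `X = tr(⟨W⟩_L V)` is
a sum of weights `V_e`, hence is `A_∞` with constant at most `A`, and its average over `L` is at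
most `d Q`. The sharp reverse Hölder inequality with `ε = 1/(8A)` (`leafAverage_rpow_le`) and
Hölder's inequality leave a power of the average of `⟨W f, f⟩^{1/ρ}`, with `ρ` above 1 by about
`1/A`. Doob's inequality (`maxAverage_rpow_le`) then costs a factor of order `A`. The total is `d² Q
A` (`descendantSum_le_of_weights`, `sum_norm_op_haarCoeff_sq_le`), and a square root gives the mixed
bound.

Comparison of characteristics. For fixed `e`, the averages of `V_e` lie between `z²` and `Q z²`,
where `z` is the martingale of averages of `V_e^{1/2}`; the upper estimate combines the `A_2`
condition with Jensen's inequality (`quadForm_average_inv_le`). Doob's inequality in `L²` gives `A ≤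
4Q` without dimensional loss.

Sharpness. Take the step weight equal to `ρ^{-k}` on `[2^{-k-1}, 2^{-k})`, times the identity, and
test on its inverse. All averages are geometric series; `ρ` can be chosen so that the `A_2`
characteristic is exactly a prescribed `t`, and the norm is at least `t/2`
(`exists_weight_lower_bound`). -/

noncomputable section

/-! ### Analysis on abstract binary trees

A binary tree is a type of nodes with two maps `l r`, the left and the right child. -/

namespace BinaryTree

variable {T : Type*} (l r : T → T)

/-- A function whose value at each node is the average of the values at the two children. -/
def IsMartingale (x : T → ℝ) : Prop := ∀ t, x t = (x (l t) + x (r t)) / 2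

/-- The average of `ψ` over the `2 ^ k` descendants of generation `k`. -/
def leafAverage (ψ : T → ℝ) : ℕ → T → ℝ
  | 0, t => ψ t
  | k + 1, t => (leafAverage ψ k (l t) + leafAverage ψ k (r t)) / 2

/-- The sum of `φ` over the descendants of the generations `< k`, weighted by relative length. -/
def descendantSum (φ : T → ℝ) : ℕ → T → ℝ
  | 0, _ => 0
  | k + 1, t => φ t + (descendantSum φ k (l t) + descendantSum φ k (r t)) / 2

/-- The average over the descendants of generation `k` of the running maximum of `m` and of `b`.
The function `b` may depend on the number of generations that are left. -/
def maxAverage (b : ℕ → T → ℝ) : ℕ → ℝ → T → ℝ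
  | 0, m, t => max m (b 0 t)
  | k + 1, m, t =>
      (maxAverage b k (max m (b (k + 1) t)) (l t) + maxAverage b k (max m (b (k + 1) t)) (r t)) / 2

variable {l r}

/-! ### Order and linearity properties of the tree averages -/

lemma leafAverage_mono {ψ χ : T → ℝ} (h : ∀ t, ψ t ≤ χ t) (k : ℕ) (t : T) :
    leafAverage l r ψ k t ≤ leafAverage l r χ k t := by
  induction k generalizing t with
  | zero => exact h t
  | succ k ih => simp only [leafAverage]; linarith [ih (l t), ih (r t)]

lemma leafAverage_nonneg {ψ : T → ℝ} (h : ∀ t, 0 ≤ ψ t) (k : ℕ) (t : T) :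
    0 ≤ leafAverage l r ψ k t := by
  induction k generalizing t with
  | zero => exact h t
  | succ k ih => simp only [leafAverage]; linarith [ih (l t), ih (r t)]

lemma leafAverage_pos {ψ : T → ℝ} (h : ∀ t, 0 < ψ t) (k : ℕ) (t : T) :
    0 < leafAverage l r ψ k t := by
  induction k generalizing t with
  | zero => exact h t
  | succ k ih => simp only [leafAverage]; linarith [ih (l t), ih (r t)]

lemma leafAverage_add_mul (ψ χ : T → ℝ) (a c : ℝ) (k : ℕ) (t : T) :
    leafAverage l r (fun s => a * ψ s + c * χ s) k t =
      a * leafAverage l r ψ k t + c * leafAverage l r χ k t := by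
  induction k generalizing t with
  | zero => rfl
  | succ k ih => simp only [leafAverage, ih]; ring

lemma IsMartingale.leafAverage_eq {x : T → ℝ} (h : IsMartingale l r x) (k : ℕ) (t : T) :
    leafAverage l r x k t = x t := by
  induction k generalizing t with
  | zero => rfl
  | succ k ih => simp only [leafAverage, ih]; exact (h t).symm

lemma maxAverage_mono {b : ℕ → T → ℝ} (k : ℕ) {m m' : ℝ} (h : m ≤ m') (t : T) :
    maxAverage l r b k m t ≤ maxAverage l r b k m' t := by
  induction k generalizing t m m' with
  | zero => exact max_le_max_right _ h
  | succ k ih =>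
    have := max_le_max_right (b (k + 1) t) h
    simp only [maxAverage]; linarith [ih this (l t), ih this (r t)]

lemma maxAverage_mono_right {b c : ℕ → T → ℝ} (hbc : ∀ k t, b k t ≤ c k t) (k : ℕ) (m : ℝ) (t : T) :
    maxAverage l r b k m t ≤ maxAverage l r c k m t := by
  induction k generalizing t m with
  | zero => exact max_le_max_left _ (hbc 0 t)
  | succ k ih =>
    have h := max_le_max_left m (hbc (k + 1) t)
    simp only [maxAverage]
    linarith [ih (max m (b (k + 1) t)) (l t), ih (max m (b (k + 1) t)) (r t),
      maxAverage_mono (b := c) (l := l) (r := r) k h (l t),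
      maxAverage_mono (b := c) (l := l) (r := r) k h (r t)]

lemma maxAverage_mul {b : ℕ → T → ℝ} {c : ℝ} (hc : 0 ≤ c) (k : ℕ) (m : ℝ) (t : T) :
    maxAverage l r (fun k s => c * b k s) k (c * m) t = c * maxAverage l r b k m t := by
  induction k generalizing t m with
  | zero => simp only [maxAverage]; rw [mul_max_of_nonneg _ _ hc]
  | succ k ih => simp only [maxAverage, ← mul_max_of_nonneg _ _ hc, ih]; ring

lemma le_maxAverage {b : ℕ → T → ℝ} (k : ℕ) (m : ℝ) (t : T) : m ≤ maxAverage l r b k m t := by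
  induction k generalizing t m with
  | zero => exact le_max_left _ _
  | succ k ih =>
    have := le_max_left m (b (k + 1) t)
    simp only [maxAverage]
    linarith [ih (max m (b (k + 1) t)) (l t), ih (max m (b (k + 1) t)) (r t)]

/-- Raising the threshold `m` to `b k t` does not change the running maximum. -/
lemma maxAverage_max {b : ℕ → T → ℝ} (k : ℕ) (m : ℝ) (t : T) :
    maxAverage l r b k (max m (b k t)) t = maxAverage l r b k m t := by
  cases k <;> simp [maxAverage]

/-- Subadditivity of the maximum. It lets an `A_∞` bound pass from scalar weights to their sums, in
particular to traces. -/
lemma maxAverage_add {x y : T → ℝ} (k : ℕ) (m m' : ℝ) (t : T) :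
    maxAverage l r (fun _ s => x s + y s) k (m + m') t ≤
      maxAverage l r (fun _ => x) k m t + maxAverage l r (fun _ => y) k m' t := by
  induction k generalizing t m m' with
  | zero => exact max_add_add_le_max_add_max
  | succ k ih =>
    have h : max (m + m') (x t + y t) ≤ max m (x t) + max m' (y t) := max_add_add_le_max_add_max
    simp only [maxAverage]
    have h1 := (maxAverage_mono (b := fun _ s => x s + y s) (l := l) (r := r) k h (l t)).trans
      (ih (max m (x t)) (max m' (y t)) (l t))
    have h2 := (maxAverage_mono (b := fun _ s => x s + y s) (l := l) (r := r) k h (r t)).trans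
      (ih (max m (x t)) (max m' (y t)) (r t))
    linarith

/-! #### Domination by a maximal function -/

/-- If `φ` is controlled below every node by the energy of a stopped martingale, then its sum over
the tree is controlled by a maximal function. -/
theorem descendantSum_le_maxAverage {φ : T → ℝ} {b : ℕ → T → ℝ} {C₁ C₂ : ℝ}
    (hC₁ : 0 ≤ C₁) (hC₂ : 0 ≤ C₂) (hb : ∀ k t, 0 ≤ b k t)
    (h : ∀ k t, ∃ v E : T → ℝ, (∀ s, 0 ≤ v s) ∧ IsMartingale l r v ∧ v t ≤ 2 ∧
      (∀ s, v s ≤ 4 → φ s + C₁ * E s ≤ C₁ * ((E (l s) + E (r s)) / 2)) ∧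
      (∀ s, 0 ≤ E s) ∧ ∀ s, v s ≤ 8 → E s ≤ C₂ * b k t) (k : ℕ) (t : T) :
    descendantSum l r φ k t ≤ 2 * (C₁ * C₂) * maxAverage l r b k 0 t := by
  have hC : 0 ≤ C₁ * C₂ := mul_nonneg hC₁ hC₂
  -- The outer induction restarts the estimate at the nodes where `v` first exceeds 4; the inner
  -- induction in `key` walks down from `t` to these nodes with `v`, `E` and `B` frozen.
  induction k using Nat.strong_induction_on generalizing t with
  | _ k IH =>
  obtain ⟨v, E, hv, hvm, hvt, hφ, hE, hEb⟩ := h k t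
  set B := b k t
  have hB : 0 ≤ B := hb k t
  -- The term with `1 - v s / 4` counts unstopped mass. It is a martingale, is negative at stopped
  -- nodes, and at `t`, where `v t ≤ 2`, it is worth at least the `C₁ * C₂ * B` on the right. The
  -- bound 8 holds because a nonnegative martingale at most doubles in one step, and the last
  -- hypothesis makes the outer induction available at stopped nodes.
  have key : ∀ k' s, k' ≤ k → v s ≤ 8 → (4 < v s → k' < k) →
      descendantSum l r φ k' s + C₁ * E s + 2 * (C₁ * C₂) * (1 - v s / 4) * B ≤
        C₁ * C₂ * B + 2 * (C₁ * C₂) * maxAverage l r b k' B s := by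
    intro k'
    induction k' with
    | zero =>
      intro s _ hs _
      have h1 := mul_le_mul_of_nonneg_left (hEb s hs) hC₁
      have h2 := mul_le_mul_of_nonneg_left (le_maxAverage (b := b) (l := l) (r := r) 0 B s) hC
      have h3 : 0 ≤ C₁ * C₂ * B * v s := mul_nonneg (mul_nonneg hC hB) (hv s)
      simp only [descendantSum]
      nlinarith
    | succ k' ih =>
      intro s hk hs hlt
      rcases lt_or_ge 4 (v s) with h4 | h4
      · have h1 := mul_le_mul_of_nonneg_left (hEb s hs) hC₁
        have h2 := IH (k' + 1) (hlt h4) s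
        have h3 := mul_le_mul_of_nonneg_left
          (maxAverage_mono (b := b) (l := l) (r := r) (k' + 1) hB s) hC
        have h4' : 0 ≤ C₁ * C₂ * B * (v s - 4) :=
          mul_nonneg (mul_nonneg hC hB) (by linarith)
        nlinarith
      · have hm := hvm s
        have hl : v (l s) ≤ 8 := by linarith [hv (r s)]
        have hr : v (r s) ≤ 8 := by linarith [hv (l s)]
        have h1 := ih (l s) (by omega) hl (fun _ => by omega)
        have h2 := ih (r s) (by omega) hr (fun _ => by omega)
        have h3 := hφ s h4
        have hmax := le_max_left B (b (k' + 1) s)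
        have h5 := mul_le_mul_of_nonneg_left
          (maxAverage_mono (b := b) (l := l) (r := r) k' hmax (l s)) hC
        have h6 := mul_le_mul_of_nonneg_left
          (maxAverage_mono (b := b) (l := l) (r := r) k' hmax (r s)) hC
        simp only [descendantSum, maxAverage]
        rw [hm]
        nlinarith
  have h1 := key k t le_rfl (by linarith) (fun h => by linarith)
  have h2 : maxAverage l r b k B t = maxAverage l r b k 0 t := by
    rw [← maxAverage_max k 0 t, max_eq_right hB]
  have h3 : 0 ≤ C₁ * C₂ * B * (2 - v t) := mul_nonneg (mul_nonneg hC hB) (by linarith)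
  rw [h2] at h1
  nlinarith [mul_nonneg hC₁ (hE t)]

/-! #### Doob's maximal inequality -/

/-- By convexity the power `p` lies above its tangent at `m`; this is Young's inequality for `x` and
`m ^ (p - 1)`. -/
lemma young_tangent {p x m : ℝ} (hp : 1 < p) (hm : 0 ≤ m) (hx : 0 ≤ x) :
    p * x * m ^ (p - 1) ≤ x ^ p + (p - 1) * m ^ p := by
  have hq : p.HolderConjugate (p / (p - 1)) := Real.HolderConjugate.conjExponent hp
  have h := Real.young_inequality_of_nonneg hx (Real.rpow_nonneg hm (p - 1)) hq
  have h1 : (m ^ (p - 1)) ^ (p / (p - 1)) = m ^ p := by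
    rw [← Real.rpow_mul hm]; congr 1; field_simp [(by linarith : p - 1 ≠ 0)]
  rw [h1] at h
  have hp0 : 0 < p := by linarith
  have hp1 : 0 < p - 1 := by linarith
  have := mul_le_mul_of_nonneg_left h hp0.le
  have e : p * (x ^ p / p + m ^ p / (p / (p - 1))) = x ^ p + (p - 1) * m ^ p := by
    field_simp
  rw [e] at this
  linarith

/-- Doob's inequality on a tree, in the exponent `p > 1`. -/
theorem maxAverage_rpow_le {h : T → ℝ} (hh : ∀ t, 0 ≤ h t) {p : ℝ} (hp : 1 < p) (k : ℕ) (t : T) :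
    maxAverage l r (fun k s => leafAverage l r h k s ^ p) k 0 t ≤
      (p / (p - 1)) ^ p * leafAverage l r (fun s => h s ^ p) k t := by
  have hp1 : 0 < p - 1 := by linarith
  have hp0 : 0 < p := by linarith
  set q := p / (p - 1) with hq
  have hq0 : 0 < q := div_pos hp0 hp1
  have hpq : p * q = p + q := by rw [hq]; field_simp; ring
  have hqp : (p - 1) * q = p := by rw [hq]; field_simp
  have hsplit : ∀ m : ℝ, 0 ≤ m → m ^ p = m * m ^ (p - 1) := fun m hm => by
    rcases hm.eq_or_lt with rfl | hm
    · rw [Real.zero_rpow hp0.ne', zero_mul]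
    · rw [← Real.rpow_one_add' hm.le (by linarith)]; congr 1; ring
  -- A Burkholder function: affine in `x`, so it averages exactly over children; not increased when
  -- `m` is raised to `max m x` (`hUmono`); a majorant of `m ^ p - q ^ p * x ^ p` when `x ≤ m`
  -- (`hleaf`); nonpositive at `m = x`.
  set U : ℝ → ℝ → ℝ := fun m x => p * m ^ p - p * q * x * m ^ (p - 1) with hU
  have hUmono : ∀ m x, 0 ≤ m → 0 ≤ x → U (max m x) x ≤ U m x := by
    intro m x hm hx
    rcases le_total x m with hxm | hxm
    · rw [max_eq_left hxm]
    · rw [max_eq_right hxm]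
      have h1 := young_tangent hp hm hx
      simp only [hU]
      have h2 := mul_le_mul_of_nonneg_left h1 hq0.le
      have e := hsplit x hx
      have h3 : p * q * x * x ^ (p - 1) = p * q * x ^ p := by rw [e]; ring
      rw [h3]
      have h4 : q * (x ^ p + (p - 1) * m ^ p) = q * x ^ p + p * m ^ p := by
        linear_combination (m ^ p) * hqp
      rw [h4] at h2
      have h5 : p * q * x ^ p = p * x ^ p + q * x ^ p := by rw [hpq]; ring
      rw [h5]
      nlinarith
  have hleaf : ∀ m x, 0 ≤ x → x ≤ m → m ^ p ≤ U m x + q ^ p * x ^ p := by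
    intro m x hx hxm
    have h1 := young_tangent hp (hx.trans hxm) (mul_nonneg hq0.le hx)
    rw [Real.mul_rpow hq0.le hx] at h1
    simp only [hU]
    nlinarith
  have key : ∀ k (m : ℝ) t, 0 ≤ m →
      maxAverage l r (fun k s => leafAverage l r h k s ^ p) k (m ^ p) t ≤
        U (max m (leafAverage l r h k t)) (leafAverage l r h k t) +
          q ^ p * leafAverage l r (fun s => h s ^ p) k t := by
    intro k
    induction k with
    | zero =>
      intro m t hm
      simp only [maxAverage, leafAverage]
      have := hleaf (max m (h t)) (h t) (hh t) (le_max_right _ _)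
      refine le_trans (le_of_eq ?_) this
      rcases le_total m (h t) with h1 | h1
      · rw [max_eq_right h1, max_eq_right (Real.rpow_le_rpow hm h1 hp0.le)]
      · rw [max_eq_left h1, max_eq_left (Real.rpow_le_rpow (hh t) h1 hp0.le)]
    | succ k ih =>
      intro m t hm
      set x := leafAverage l r h (k + 1) t with hx
      have hx0 : 0 ≤ x := leafAverage_nonneg hh _ _
      set M := max m x with hM
      have hM0 : 0 ≤ M := hm.trans (le_max_left _ _)
      have hmax : max (m ^ p) (x ^ p) = M ^ p := by
        rcases le_total m x with h1 | h1
        · rw [hM, max_eq_right h1, max_eq_right (Real.rpow_le_rpow hm h1 hp0.le)]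
        · rw [hM, max_eq_left h1, max_eq_left (Real.rpow_le_rpow hx0 h1 hp0.le)]
      have h1 := ih M (l t) hM0
      have h2 := ih M (r t) hM0
      have h3 := hUmono M _ hM0 (leafAverage_nonneg (l := l) (r := r) hh k (l t))
      have h4 := hUmono M _ hM0 (leafAverage_nonneg (l := l) (r := r) hh k (r t))
      have h5 : U M x = (U M (leafAverage l r h k (l t)) + U M (leafAverage l r h k (r t))) / 2 := by
        simp only [hU, hx, leafAverage]; ring
      simp only [maxAverage]
      rw [← hx, hmax, h5]
      simp only [leafAverage] at *
      linarith
  have h0 := key k 0 t le_rfl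
  rw [Real.zero_rpow hp0.ne'] at h0
  set x := leafAverage l r h k t
  have hx0 : 0 ≤ x := leafAverage_nonneg hh _ _
  rw [max_eq_right hx0] at h0
  have : U x x ≤ 0 := by
    simp only [hU]
    have e : p * q * x * x ^ (p - 1) = p * q * x ^ p := by rw [hsplit x hx0]; ring
    rw [e, hpq]
    nlinarith [Real.rpow_nonneg hx0 p]
  linarith

/-! #### The reverse Hölder inequality -/

variable (l r) in
/-- The average over the descendants `s` of generation `k` of `x s * M s ^ ε`, where `M` is the
running maximum of `m` and `x`. -/
def weightedMaxAverage (x : T → ℝ) (ε : ℝ) : ℕ → ℝ → T → ℝ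
  | 0, m, t => x t * max m (x t) ^ ε
  | k + 1, m, t => (weightedMaxAverage x ε k (max m (x t)) (l t) +
      weightedMaxAverage x ε k (max m (x t)) (r t)) / 2

lemma weightedMaxAverage_max {x : T → ℝ} {ε : ℝ} (k : ℕ) (m : ℝ) (t : T) :
    weightedMaxAverage l r x ε k (max m (x t)) t = weightedMaxAverage l r x ε k m t := by
  cases k <;> simp [weightedMaxAverage]

lemma leafAverage_rpow_le_weightedMaxAverage {x : T → ℝ} (hx : ∀ t, 0 ≤ x t) {ε : ℝ} (hε : 0 ≤ ε)
    (k : ℕ) (m : ℝ) (t : T) :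
    leafAverage l r (fun s => x s ^ (1 + ε)) k t ≤ weightedMaxAverage l r x ε k m t := by
  induction k generalizing t m with
  | zero =>
    simp only [leafAverage, weightedMaxAverage]
    rw [Real.rpow_one_add' (hx t) (by linarith)]
    exact mul_le_mul_of_nonneg_left (Real.rpow_le_rpow (hx t) (le_max_right _ _) hε) (hx t)
  | succ k ih =>
    simp only [leafAverage, weightedMaxAverage]
    linarith [ih (max m (x t)) (l t), ih (max m (x t)) (r t)]

/-- By concavity the power `ε` lies below its tangent at `m`, which is Bernoulli's inequality for `M
/ m`. -/
lemma rpow_sub_rpow_le {m M ε : ℝ} (hm : 0 < m) (hM : m ≤ M) (h0 : 0 ≤ ε) (h1 : ε ≤ 1) :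
    m * (M ^ ε - m ^ ε) ≤ ε * m ^ ε * (M - m) := by
  have h := rpow_one_add_le_one_add_mul_self (s := M / m - 1) (p := ε)
    (by linarith [div_nonneg (hm.le.trans hM) hm.le]) h0 h1
  have e : 1 + (M / m - 1) = M / m := by ring
  rw [e, Real.div_rpow (hm.le.trans hM) hm.le] at h
  have hme := Real.rpow_pos_of_pos hm ε
  rw [div_le_iff₀ hme] at h
  have := mul_le_mul_of_nonneg_left h hm.le
  have e2 : m * ((1 + ε * (M / m - 1)) * m ^ ε) = m * m ^ ε + ε * m ^ ε * (M - m) := by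
    field_simp
  linarith

/-- The sharp reverse Hölder inequality for dyadic `A_∞` weights. -/
theorem leafAverage_rpow_le {x : T → ℝ} (hx : ∀ t, 0 < x t) (hmart : IsMartingale l r x)
    {A : ℝ} (hA1 : 1 ≤ A) (hA : ∀ k t, maxAverage l r (fun _ => x) k 0 t ≤ A * x t)
    {ε : ℝ} (hε : 0 ≤ ε) (hεA : 8 * ε * A ≤ 1) (k : ℕ) (t : T) :
    leafAverage l r (fun s => x s ^ (1 + ε)) k t ≤ 2 * x t ^ (1 + ε) := by
  have hε1 : ε ≤ 1 := by nlinarith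
  -- crossing the threshold `m` at a child
  have jump : ∀ (m y u : ℝ), 0 < m → m ≤ y → y ≤ 2 * m → 0 ≤ u → u ≤ (A - 1) * y →
      y ^ ε * y + 3 * ε * y ^ ε * u ≤ m ^ ε * y + 3 * ε * m ^ ε * (u + (y - m)) := by
    intro m y u hm hmy hy2 hu huA
    have hme := Real.rpow_pos_of_pos hm ε
    have h1 := rpow_sub_rpow_le hm hmy hε hε1
    have hmono : m ^ ε ≤ y ^ ε := Real.rpow_le_rpow hm.le hmy hε
    -- Here `y ≤ 2m`, and `8εA ≤ 1` keeps `3εu` below `m`. This closes the recursion with the factor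
    -- 3.
    have hc : y + 3 * ε * u ≤ m * 3 := by
      have : 3 * ε * u ≤ 3 * ε * ((A - 1) * (2 * m)) := by
        apply mul_le_mul_of_nonneg_left _ (by positivity)
        exact huA.trans (mul_le_mul_of_nonneg_left hy2 (by linarith))
      nlinarith [mul_nonneg hε hm.le]
    have h2 : (y ^ ε - m ^ ε) * (y + 3 * ε * u) ≤ (y ^ ε - m ^ ε) * (m * 3) :=
      mul_le_mul_of_nonneg_left hc (by linarith)
    nlinarith
  -- The growth of `M ^ ε` along the tree is paid for by the growth of the running maximum itself,
  -- whose average excess over `m` is linear in `A`.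
  have key : ∀ k m t, x t ≤ m →
      weightedMaxAverage l r x ε k m t ≤
        m ^ ε * x t + 3 * ε * m ^ ε * (maxAverage l r (fun _ => x) k m t - m) := by
    intro k
    induction k with
    | zero =>
      intro m t hm
      simp only [weightedMaxAverage, maxAverage, max_eq_left hm]
      linarith
    | succ k ih =>
      intro m t hm
      have hm0 : 0 < m := (hx t).trans_le hm
      -- A child below `m` is covered by induction. A child above `m` is at most `2m`; there the
      -- threshold is reset to `x s`, the `A_∞` condition at `s` bounds the new excess, and `jump`
      -- compares the two thresholds.
      have child : ∀ s, x s ≤ 2 * m → weightedMaxAverage l r x ε k m s ≤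
          m ^ ε * x s + 3 * ε * m ^ ε * (maxAverage l r (fun _ => x) k m s - m) := by
        intro s hs
        rcases le_total (x s) m with h1 | h1
        · exact ih m s h1
        · have h2 := ih (x s) s le_rfl
          have e1 : weightedMaxAverage l r x ε k (x s) s = weightedMaxAverage l r x ε k m s := by
            rw [← weightedMaxAverage_max k m s, max_eq_right h1]
          have e2 : maxAverage l r (fun _ => x) k (x s) s = maxAverage l r (fun _ => x) k m s := by
            have := maxAverage_max (b := fun _ => x) (l := l) (r := r) k m s
            rwa [max_eq_right h1] at this
          have e3 : maxAverage l r (fun _ => x) k (x s) s = maxAverage l r (fun _ => x) k 0 s := by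
            have := maxAverage_max (b := fun _ => x) (l := l) (r := r) k 0 s
            rwa [max_eq_right (hx s).le] at this
          have h3 := jump m (x s) (maxAverage l r (fun _ => x) k (x s) s - x s) hm0 h1 hs
            (by linarith [le_maxAverage (b := fun _ => x) (l := l) (r := r) k (x s) s])
            (by rw [e3]; linarith [hA k s])
          rw [← e1, ← e2]
          linarith
      have hm' := hmart t
      have h1 := child (l t) (by linarith [hx (r t)])
      have h2 := child (r t) (by linarith [hx (l t)])
      simp only [weightedMaxAverage, maxAverage, max_eq_left hm]
      rw [hm']
      linarith
  have h1 := key k (x t) t le_rfl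
  have h2 := leafAverage_rpow_le_weightedMaxAverage (l := l) (r := r) (fun t => (hx t).le) hε k (x t) t
  have e3 : maxAverage l r (fun _ => x) k (x t) t = maxAverage l r (fun _ => x) k 0 t := by
    have := maxAverage_max (b := fun _ => x) (l := l) (r := r) k 0 t
    rwa [max_eq_right (hx t).le] at this
  have hp := Real.rpow_pos_of_pos (hx t) ε
  rw [e3] at h1
  have h3 : 3 * ε * x t ^ ε * (maxAverage l r (fun _ => x) k 0 t - x t) ≤
      3 * ε * x t ^ ε * ((A - 1) * x t) :=
    mul_le_mul_of_nonneg_left (by linarith [hA k t]) (by positivity)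
  rw [Real.rpow_one_add' (hx t).le (by linarith)] at *
  have h4 : 0 ≤ x t ^ ε * x t := (mul_pos hp (hx t)).le
  nlinarith

/-! #### Hölder's inequality -/

/-- Young's inequality, normalized by the two averages, is linear in `x ^ p` and `y ^ q`, so it can
be averaged; the coefficients then add up by `1/p + 1/q = 1`. -/
theorem leafAverage_mul_le {x y : T → ℝ} (hx : ∀ t, 0 < x t) (hy : ∀ t, 0 < y t) {p q : ℝ}
    (hpq : p.HolderConjugate q) (k : ℕ) (t : T) :
    leafAverage l r (fun s => x s * y s) k t ≤
      leafAverage l r (fun s => x s ^ p) k t ^ (1 / p) *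
        leafAverage l r (fun s => y s ^ q) k t ^ (1 / q) := by
  have hX : 0 < leafAverage l r (fun s => x s ^ p) k t :=
    leafAverage_pos (fun s => Real.rpow_pos_of_pos (hx s) p) k t
  have hY : 0 < leafAverage l r (fun s => y s ^ q) k t :=
    leafAverage_pos (fun s => Real.rpow_pos_of_pos (hy s) q) k t
  set X := leafAverage l r (fun s => x s ^ p) k t with hXdef
  set Y := leafAverage l r (fun s => y s ^ q) k t with hYdef
  have hXp : 0 < X ^ (1 / p) := Real.rpow_pos_of_pos hX _
  have hYq : 0 < Y ^ (1 / q) := Real.rpow_pos_of_pos hY _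
  have hp := hpq.pos
  have hq := hpq.symm.pos
  have h1 : ∀ s, x s * y s ≤ (X ^ (1 / p) * Y ^ (1 / q) / (p * X)) * x s ^ p +
      (X ^ (1 / p) * Y ^ (1 / q) / (q * Y)) * y s ^ q := by
    intro s
    have h := Real.young_inequality_of_nonneg (div_pos (hx s) hXp).le (div_pos (hy s) hYq).le hpq
    rw [Real.div_rpow (hx s).le hXp.le, Real.div_rpow (hy s).le hYq.le, ← Real.rpow_mul hX.le,
      ← Real.rpow_mul hY.le, one_div_mul_cancel hp.ne', one_div_mul_cancel hq.ne', Real.rpow_one,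
      Real.rpow_one, div_mul_div_comm, div_le_iff₀ (mul_pos hXp hYq)] at h
    refine h.trans (le_of_eq ?_)
    field_simp
  have h2 := leafAverage_mono (l := l) (r := r) h1 k t
  rw [leafAverage_add_mul] at h2
  refine h2.trans (le_of_eq ?_)
  rw [← hXdef, ← hYdef]
  have := hpq.inv_add_inv_eq_one
  calc _ = X ^ (1 / p) * Y ^ (1 / q) * (p⁻¹ + q⁻¹) := by field_simp
    _ = _ := by rw [this, mul_one]

/-! ### The weighted estimate on the tree -/

lemma doob_constant_le {A : ℝ} (hA : 1 ≤ A) :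
    ((1 + 2 * (1 / (8 * A))) / (1 / (8 * A))) ^ ((1 + 2 * (1 / (8 * A))) / (1 + 1 / (8 * A))) ≤
      40 * A := by
  have hA0 : 0 < A := by linarith
  set ε := 1 / (8 * A) with hε
  have hε0 : 0 < ε := by positivity
  have hbase : (1 + 2 * ε) / ε = 8 * A + 2 := by rw [hε]; field_simp
  have hexp : (1 + 2 * ε) / (1 + ε) = 1 + ε / (1 + ε) := by field_simp; ring
  rw [hbase, hexp]
  have h10 : 0 < 10 * A := by positivity
  calc (8 * A + 2) ^ (1 + ε / (1 + ε)) ≤ (10 * A) ^ (1 + ε / (1 + ε)) :=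
        Real.rpow_le_rpow (by positivity) (by linarith) (by positivity)
    _ ≤ (10 * A) ^ (1 + ε) := by
        refine Real.rpow_le_rpow_of_exponent_le (by linarith) ?_
        have : ε / (1 + ε) ≤ ε := div_le_self hε0.le (by linarith)
        linarith
    _ = 10 * A * (10 * A) ^ ε := by rw [Real.rpow_add h10, Real.rpow_one]
    _ ≤ 10 * A * 4 := by
        -- `(10A) ^ ε` is bounded uniformly in `A`: its logarithm is at most `10Aε = 5/4`, and `e ^
        -- 5 ≤ 4 ^ 4`.
        refine mul_le_mul_of_nonneg_left ?_ h10.le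
        rw [Real.rpow_def_of_pos h10]
        have h1 : Real.log (10 * A) * ε ≤ 5 / 4 := by
          have h2 : Real.log (10 * A) ≤ 10 * A := (Real.log_le_sub_one_of_pos h10).trans (by linarith)
          calc Real.log (10 * A) * ε ≤ 10 * A * ε := mul_le_mul_of_nonneg_right h2 hε0.le
            _ = 5 / 4 := by rw [hε]; field_simp; norm_num
        refine (Real.exp_le_exp.2 h1).trans ?_
        have h3 : Real.exp (5 / 4) ^ 4 ≤ 4 ^ 4 := by
          rw [← Real.exp_nat_mul]
          have e : ((4 : ℕ) : ℝ) * (5 / 4) = ((5 : ℕ) : ℝ) * 1 := by norm_num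
          rw [e, Real.exp_nat_mul]
          have h4 : Real.exp 1 ≤ 2.7182818286 := Real.exp_one_lt_d9.le
          calc Real.exp 1 ^ 5 ≤ 2.7182818286 ^ 5 := pow_le_pow_left₀ (Real.exp_pos 1).le h4 5
            _ ≤ 4 ^ 4 := by norm_num
        exact le_of_pow_le_pow_left₀ (by norm_num) (by norm_num) h3
    _ = 40 * A := by ring

/-- The scalar core of the weighted square function estimate: for each node `t` there are
an `A_∞` weight `X t`, a martingale `u t` dominated by the geometric mean of `X t` and `y`, and
a stopping martingale `p t` that controls the square function `φ` by the energy `E t`. -/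
theorem descendantSum_le_of_weights {φ y : T → ℝ} {X u p E : T → T → ℝ} {C κ A : ℝ}
    (hC : 0 ≤ C) (hA1 : 1 ≤ A)
    (hX : ∀ t s, 0 < X t s) (hXm : ∀ t, IsMartingale l r (X t))
    (hXA : ∀ t k s, maxAverage l r (fun _ => X t) k 0 s ≤ A * X t s) (hXκ : ∀ t, X t t ≤ κ)
    (hy : ∀ t, 0 < y t) (hym : IsMartingale l r y)
    (hu : ∀ t s, 0 ≤ u t s) (hum : ∀ t, IsMartingale l r (u t))
    (hux : ∀ t s, u t s ≤ X t s ^ (1 / 2 : ℝ) * y s ^ (1 / 2 : ℝ))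
    (hp : ∀ t s, 0 ≤ p t s) (hpm : ∀ t, IsMartingale l r (p t)) (hp1 : ∀ t, p t t ≤ 1)
    (hE : ∀ t s, 0 ≤ E t s) (hEu : ∀ t s, E t s ≤ u t s ^ 2)
    (hφ : ∀ t s, p t s ≤ 4 → φ s + C * E t s ≤ C * ((E t (l s) + E t (r s)) / 2))
    (k : ℕ) (t : T) :
    descendantSum l r φ k t ≤ 10240 * C * κ * A * y t := by
  have hA0 : 0 < A := by linarith
  have hκ : 0 < κ := (hX t t).trans_le (hXκ t)
  set ε := 1 / (8 * A) with hε
  have hε0 : 0 < ε := by positivity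
  have hεA : 8 * ε * A ≤ 1 := by rw [hε]; field_simp; exact le_rfl
  -- The power `P` of `X ^ (1/2)` is `X ^ (1 + ε)`, to which the reverse Hölder inequality applies.
  -- With `q` conjugate to `P` and `ρ = 2 / q`, the function `h = y ^ (q/2)` satisfies `h ^ ρ = y`,
  -- so Doob's inequality in the exponent `ρ` returns to `y`.
  set P := 2 + 2 * ε with hP
  set q := P / (P - 1) with hq
  set ρ := (1 + 2 * ε) / (1 + ε) with hρ
  have hPq : P.HolderConjugate q := Real.HolderConjugate.conjExponent (by linarith)
  have hq0 : 0 < q := hPq.symm.pos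
  have hqρ : q / 2 * ρ = 1 := by
    have e : P - 1 = 1 + 2 * ε := by rw [hP]; ring
    rw [hq, hρ, e, hP]
    field_simp
  have hρ1 : 1 < ρ := by rw [hρ, lt_div_iff₀ (by linarith)]; linarith
  set h : T → ℝ := fun s => (y s ^ (1 / 2 : ℝ)) ^ q with hh
  have hpos : ∀ s, 0 < h s := fun s => Real.rpow_pos_of_pos (Real.rpow_pos_of_pos (hy s) _) _
  have hhρ : ∀ s, h s ^ ρ = y s := fun s => by
    simp only [hh]
    rw [← Real.rpow_mul (hy s).le, ← Real.rpow_mul (hy s).le]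
    have : 1 / 2 * q * ρ = 1 := by linarith
    rw [this, Real.rpow_one]
  -- The average of `h` is taken over the bottom generation of the finite tree, hence the dependence
  -- on the number `k` of generations left; no limit is needed.
  set b : ℕ → T → ℝ := fun k s => leafAverage l r h k s ^ ρ with hb
  have hbpos : ∀ k s, 0 < b k s := fun k s => Real.rpow_pos_of_pos (leafAverage_pos hpos k s) _
  -- the average of `u t` over `t`
  have hutt : ∀ k t, u t t ^ 2 ≤ 2 * κ * b k t := by
    intro k t
    have h1 : u t t ≤ leafAverage l r (fun s => X t s ^ (1 / 2 : ℝ) * y s ^ (1 / 2 : ℝ)) k t := by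
      rw [← (hum t).leafAverage_eq k t]
      exact leafAverage_mono (hux t) k t
    have h2 := leafAverage_mul_le (l := l) (r := r)
      (fun s => Real.rpow_pos_of_pos (hX t s) (1 / 2))
      (fun s => Real.rpow_pos_of_pos (hy s) (1 / 2)) hPq k t
    have e1 : ∀ s, (X t s ^ (1 / 2 : ℝ)) ^ P = X t s ^ (1 + ε) := fun s => by
      rw [← Real.rpow_mul (hX t s).le]; congr 1; rw [hP]; ring
    simp only [e1] at h2
    have h3 := leafAverage_rpow_le (hX t) (hXm t) hA1 (hXA t) hε0.le hεA k t
    have hx0 : 0 < leafAverage l r (fun s => X t s ^ (1 + ε)) k t :=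
      leafAverage_pos (fun s => Real.rpow_pos_of_pos (hX t s) _) k t
    have hH : 0 < leafAverage l r h k t := leafAverage_pos hpos k t
    set a := leafAverage l r (fun s => X t s ^ (1 + ε)) k t
    set H := leafAverage l r h k t with hHdef
    have h4 : u t t ^ 2 ≤ (a ^ (1 / P) * H ^ (1 / q)) ^ 2 :=
      pow_le_pow_left₀ (hu t t) (h1.trans h2) 2
    have e2 : (a ^ (1 / P) * H ^ (1 / q)) ^ 2 = a ^ (1 / (1 + ε)) * H ^ ρ := by
      rw [mul_pow, ← Real.rpow_natCast, ← Real.rpow_natCast, ← Real.rpow_mul hx0.le,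
        ← Real.rpow_mul hH.le]
      congr 2
      · rw [hP]; push_cast; field_simp
      · push_cast
        field_simp
        linarith
    have h5 : a ^ (1 / (1 + ε)) ≤ 2 * κ := by
      calc a ^ (1 / (1 + ε)) ≤ (2 * X t t ^ (1 + ε)) ^ (1 / (1 + ε)) :=
            Real.rpow_le_rpow hx0.le h3 (by positivity)
        _ = 2 ^ (1 / (1 + ε)) * X t t := by
            rw [Real.mul_rpow (by norm_num) (Real.rpow_nonneg (hX t t).le _),
              ← Real.rpow_mul (hX t t).le, mul_one_div_cancel (by linarith), Real.rpow_one]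
        _ ≤ 2 * κ := by
            have : (2 : ℝ) ^ (1 / (1 + ε)) ≤ 2 ^ (1 : ℝ) := by
              refine Real.rpow_le_rpow_of_exponent_le (by norm_num) ?_
              rw [div_le_one (by linarith)]; linarith
            rw [Real.rpow_one] at this
            exact mul_le_mul this (hXκ t) (hX t t).le (by norm_num)
    rw [e2] at h4
    exact h4.trans (mul_le_mul_of_nonneg_right h5 (Real.rpow_nonneg hH.le _))
  have hsparse : ∀ k t, descendantSum l r φ k t ≤
      2 * (C * (128 * κ)) * maxAverage l r b k 0 t := by
    intro k t
    refine descendantSum_le_maxAverage hC (by positivity) (fun k t => (hbpos k t).le) ?_ k t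
    intro k t
    set a := √(2 * κ * b k t) with ha
    have hb0 := hbpos k t
    have ha0 : 0 < a := Real.sqrt_pos.2 (by positivity)
    have ha2 : a ^ 2 = 2 * κ * b k t := Real.sq_sqrt (by positivity)
    have hua : u t t ≤ a := Real.le_sqrt_of_sq_le (hutt k t)
    have hu0 : ∀ s, 0 ≤ u t s / a := fun s => div_nonneg (hu t s) ha0.le
    -- One martingale serves both stopping rules. It starts at most at `1 + 1`; below 4 it forces `p
    -- ≤ 4`; below 8 it forces `u ≤ 8a`, hence an energy at most `64a² = 128κb`.
    refine ⟨fun s => p t s + u t s / a, E t, fun s => add_nonneg (hp t s) (hu0 s), ?_, ?_, ?_,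
      hE t, ?_⟩
    · intro s
      change p t s + u t s / a = _
      rw [hpm t s, hum t s]; ring
    · have : u t t / a ≤ 1 := (div_le_one ha0).2 hua
      linarith [hp1 t]
    · intro s hs
      exact hφ t s (by linarith [hu0 s])
    · intro s hs
      have h1 : u t s / a ≤ 8 := by linarith [hp t s]
      rw [div_le_iff₀ ha0] at h1
      calc E t s ≤ u t s ^ 2 := hEu t s
        _ ≤ (8 * a) ^ 2 := pow_le_pow_left₀ (hu t s) h1 2
        _ = 128 * κ * b k t := by rw [mul_pow, ha2]; ring
  have hdoob := maxAverage_rpow_le (l := l) (r := r) (fun s => (hpos s).le) hρ1 k t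
  simp only [hhρ] at hdoob
  rw [hym.leafAverage_eq] at hdoob
  have hρ' : ρ / (ρ - 1) = (1 + 2 * ε) / ε := by
    have : ρ - 1 = ε / (1 + ε) := by rw [hρ]; field_simp; ring
    rw [this, hρ]; field_simp
  rw [hρ'] at hdoob
  have hc := doob_constant_le hA1
  calc descendantSum l r φ k t ≤ 2 * (C * (128 * κ)) * maxAverage l r b k 0 t := hsparse k t
    _ ≤ 2 * (C * (128 * κ)) * (40 * A * y t) :=
        mul_le_mul_of_nonneg_left
          (hdoob.trans (mul_le_mul_of_nonneg_right hc (hy t).le)) (by positivity)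
    _ = _ := by ring

end BinaryTree

namespace MatrixWeight

variable {d : ℕ}

/-! ### Quadratic forms of positive matrices -/

/-- The real quadratic form `z ↦ Re ⟨A z, z⟩`. -/
def quadForm (A : Matrix (Fin d) (Fin d) ℂ) (z : EuclideanSpace ℂ (Fin d)) : ℝ :=
  RCLike.re (inner ℂ z (op A z))

lemma op_mul_apply (A B : Matrix (Fin d) (Fin d) ℂ) (z : EuclideanSpace ℂ (Fin d)) :
    op (A * B) z = op A (op B z) := by
  simp [op, map_mul]

lemma op_one_apply (z : EuclideanSpace ℂ (Fin d)) : op 1 z = z := by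
  simp [op]

lemma inner_op_left (A : Matrix (Fin d) (Fin d) ℂ) (x y : EuclideanSpace ℂ (Fin d)) :
    inner ℂ (op A x) y = inner ℂ x (op A.conjTranspose y) := by
  have h : op A.conjTranspose = ContinuousLinearMap.adjoint (op A) := by
    simp only [op]
    rw [← Matrix.star_eq_conjTranspose, map_star, ContinuousLinearMap.star_eq_adjoint]
  rw [h, ContinuousLinearMap.adjoint_inner_right]

lemma inner_op_of_isHermitian {A : Matrix (Fin d) (Fin d) ℂ} (hA : A.IsHermitian)
    (x y : EuclideanSpace ℂ (Fin d)) : inner ℂ (op A x) y = inner ℂ x (op A y) := by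
  rw [inner_op_left, hA.eq]

lemma op_inv_apply {A : Matrix (Fin d) (Fin d) ℂ} (hA : A.PosDef) (z : EuclideanSpace ℂ (Fin d)) :
    op A (op A⁻¹ z) = z := by
  rw [← op_mul_apply, Matrix.mul_nonsing_inv _ ((Matrix.isUnit_iff_isUnit_det _).1 hA.isUnit),
    op_one_apply]

lemma sqrt_isHermitian {A : Matrix (Fin d) (Fin d) ℂ} : (CFC.sqrt A).IsHermitian :=
  (Matrix.nonneg_iff_posSemidef.1 (CFC.sqrt_nonneg A)).isHermitian

lemma quadForm_eq_norm_sq {A : Matrix (Fin d) (Fin d) ℂ} (hA : A.PosSemidef)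
    (z : EuclideanSpace ℂ (Fin d)) : quadForm A z = ‖op (CFC.sqrt A) z‖ ^ 2 := by
  have h : A = CFC.sqrt A * CFC.sqrt A := (CFC.sqrt_mul_sqrt_self A hA.nonneg).symm
  rw [quadForm]
  conv_lhs => rw [h]
  rw [op_mul_apply, ← inner_op_of_isHermitian sqrt_isHermitian, inner_self_eq_norm_sq]

lemma quadForm_nonneg {A : Matrix (Fin d) (Fin d) ℂ} (hA : A.PosSemidef)
    (z : EuclideanSpace ℂ (Fin d)) : 0 ≤ quadForm A z := by
  rw [quadForm_eq_norm_sq hA]; positivity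

lemma quadForm_eq_dotProduct (A : Matrix (Fin d) (Fin d) ℂ) (z : EuclideanSpace ℂ (Fin d)) :
    quadForm A z = RCLike.re (star z.ofLp ⬝ᵥ A.mulVec z.ofLp) := by
  rw [quadForm, EuclideanSpace.inner_eq_star_dotProduct, dotProduct_comm]
  rfl

lemma quadForm_eq_sum (A : Matrix (Fin d) (Fin d) ℂ) (z : EuclideanSpace ℂ (Fin d)) :
    quadForm A z = ∑ i, ∑ j, ((starRingEnd ℂ) (z i) * A i j * z j).re := by
  rw [quadForm_eq_dotProduct]
  simp only [dotProduct, Matrix.mulVec, Finset.mul_sum, map_sum]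
  refine Finset.sum_congr rfl fun i _ => Finset.sum_congr rfl fun j _ => ?_
  simp [mul_assoc]

lemma quadForm_pos {A : Matrix (Fin d) (Fin d) ℂ} (hA : A.PosDef) {z : EuclideanSpace ℂ (Fin d)}
    (hz : z ≠ 0) : 0 < quadForm A z := by
  rw [quadForm_eq_dotProduct]
  exact hA.re_dotProduct_pos (fun h => hz ((WithLp.ofLp_eq_zero _).1 h))

lemma quadForm_inv {A : Matrix (Fin d) (Fin d) ℂ} (hA : A.PosDef) (z : EuclideanSpace ℂ (Fin d)) :
    quadForm A (op A⁻¹ z) = quadForm A⁻¹ z := by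
  rw [quadForm, quadForm, op_inv_apply hA, ← inner_conj_symm, RCLike.conj_re]

/-- The Cauchy–Schwarz inequality for the dual quadratic forms of `A` and `A⁻¹`. -/
lemma norm_inner_sq_le {A : Matrix (Fin d) (Fin d) ℂ} (hA : A.PosDef)
    (x z : EuclideanSpace ℂ (Fin d)) :
    ‖(inner ℂ x z : ℂ)‖ ^ 2 ≤ quadForm A⁻¹ x * quadForm A z := by
  have h : (inner ℂ x z : ℂ) =
      inner ℂ (op (CFC.sqrt A) (op A⁻¹ x)) (op (CFC.sqrt A) z) := by
    conv_lhs => rw [← op_inv_apply hA x]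
    rw [inner_op_of_isHermitian sqrt_isHermitian, ← op_mul_apply (CFC.sqrt A),
      CFC.sqrt_mul_sqrt_self A hA.posSemidef.nonneg, inner_op_of_isHermitian hA.isHermitian]
  rw [h, ← quadForm_inv hA, quadForm_eq_norm_sq hA.posSemidef, quadForm_eq_norm_sq hA.posSemidef,
    ← mul_pow]
  exact pow_le_pow_left₀ (norm_nonneg _) (norm_inner_le_norm _ _) 2

/-- The standard basis vector. -/
def basisVec (i : Fin d) : EuclideanSpace ℂ (Fin d) := EuclideanSpace.single i 1

lemma norm_basisVec (i : Fin d) : ‖basisVec i‖ = 1 := by simp [basisVec]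

lemma norm_sq_eq_sum_inner_basisVec (z : EuclideanSpace ℂ (Fin d)) :
    ‖z‖ ^ 2 = ∑ i, ‖(inner ℂ (basisVec i) z : ℂ)‖ ^ 2 := by
  rw [EuclideanSpace.norm_sq_eq]
  simp [basisVec, EuclideanSpace.inner_single_left]

/-- The columns of the square root of `A`. -/
def sqrtCol (A : Matrix (Fin d) (Fin d) ℂ) (i : Fin d) : EuclideanSpace ℂ (Fin d) :=
  op (CFC.sqrt A) (basisVec i)

/-- For positive semidefinite `A`, the real part of the trace of `A * B`. -/
def traceForm (A B : Matrix (Fin d) (Fin d) ℂ) : ℝ := ∑ i, quadForm B (sqrtCol A i)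

lemma inner_basisVec_op (A : Matrix (Fin d) (Fin d) ℂ) (i : Fin d) :
    inner ℂ (basisVec i) (op A (basisVec i)) = A i i := by
  simp only [basisVec, EuclideanSpace.inner_single_left]
  simp [op]

/-- Cyclicity of the trace. `traceForm` is by definition a sum of quadratic forms in its second
argument; this identity supplies the symmetry. -/
lemma traceForm_eq_re_trace {A : Matrix (Fin d) (Fin d) ℂ} (hA : A.PosSemidef)
    (B : Matrix (Fin d) (Fin d) ℂ) : traceForm A B = (A * B).trace.re := by
  have h : (A * B).trace = (CFC.sqrt A * B * CFC.sqrt A).trace := by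
    rw [Matrix.trace_mul_cycle, CFC.sqrt_mul_sqrt_self A hA.nonneg]
  rw [h, Matrix.trace, Complex.re_sum, traceForm]
  refine Finset.sum_congr rfl fun i _ => ?_
  rw [quadForm, sqrtCol, inner_op_of_isHermitian sqrt_isHermitian, ← op_mul_apply, ← op_mul_apply,
    inner_basisVec_op, Matrix.diag_apply, mul_assoc]
  rfl

lemma traceForm_comm {A B : Matrix (Fin d) (Fin d) ℂ} (hA : A.PosSemidef) (hB : B.PosSemidef) :
    traceForm A B = traceForm B A := by
  rw [traceForm_eq_re_trace hA, traceForm_eq_re_trace hB, Matrix.trace_mul_comm]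

lemma traceForm_inv_self {A : Matrix (Fin d) (Fin d) ℂ} (hA : A.PosDef) :
    traceForm A⁻¹ A = d := by
  rw [traceForm_eq_re_trace hA.inv.posSemidef,
    Matrix.nonsing_inv_mul _ ((Matrix.isUnit_iff_isUnit_det _).1 hA.isUnit)]
  simp

lemma traceForm_nonneg (A : Matrix (Fin d) (Fin d) ℂ) {B : Matrix (Fin d) (Fin d) ℂ}
    (hB : B.PosSemidef) : 0 ≤ traceForm A B :=
  Finset.sum_nonneg fun _ _ => quadForm_nonneg hB _

lemma quadForm_eq_sum_inner_sqrtCol {A : Matrix (Fin d) (Fin d) ℂ} (hA : A.PosSemidef)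
    (z : EuclideanSpace ℂ (Fin d)) :
    quadForm A z = ∑ i, ‖(inner ℂ (sqrtCol A i) z : ℂ)‖ ^ 2 := by
  rw [quadForm_eq_norm_sq hA, norm_sq_eq_sum_inner_basisVec]
  simp only [sqrtCol, inner_op_of_isHermitian sqrt_isHermitian]

/-- Split the form of `A` into the rank-one pieces given by the columns of its square root, and
apply Cauchy–Schwarz for the dual forms of `B` and `B⁻¹` to each. -/
lemma quadForm_le_traceForm_mul {A B : Matrix (Fin d) (Fin d) ℂ} (hA : A.PosSemidef)
    (hB : B.PosDef) (z : EuclideanSpace ℂ (Fin d)) :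
    quadForm A z ≤ traceForm A B⁻¹ * quadForm B z := by
  rw [quadForm_eq_sum_inner_sqrtCol hA, traceForm, Finset.sum_mul]
  exact Finset.sum_le_sum fun i _ => norm_inner_sq_le hB _ _

lemma norm_sq_le_sum_quadForm_mul {B : Matrix (Fin d) (Fin d) ℂ} (hB : B.PosDef)
    (z : EuclideanSpace ℂ (Fin d)) :
    ‖z‖ ^ 2 ≤ (∑ i, quadForm B⁻¹ (basisVec i)) * quadForm B z := by
  rw [norm_sq_eq_sum_inner_basisVec, Finset.sum_mul]
  exact Finset.sum_le_sum fun i _ => norm_inner_sq_le hB _ _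

lemma traceForm_pos (hd : 0 < d) {A B : Matrix (Fin d) (Fin d) ℂ} (hA : A.PosDef) (hB : B.PosDef) :
    0 < traceForm A B := by
  have : Nonempty (Fin d) := ⟨⟨0, hd⟩⟩
  refine Finset.sum_pos (fun i _ => quadForm_pos hB fun h => ?_) Finset.univ_nonempty
  have h1 : op A (basisVec i) = 0 := by
    rw [← CFC.sqrt_mul_sqrt_self A hA.posSemidef.nonneg, op_mul_apply]
    change op _ (sqrtCol A i) = 0
    rw [h, map_zero]
  have h2 : quadForm A (basisVec i) = 0 := by rw [quadForm, h1, inner_zero_right]; simp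
  have h3 : basisVec i ≠ 0 := fun h => by simpa [h] using norm_basisVec i
  exact (quadForm_pos hA h3).ne' h2

lemma norm_op_sqrt_mul_comm (A B : Matrix (Fin d) (Fin d) ℂ) :
    ‖op (CFC.sqrt B * CFC.sqrt A)‖ = ‖op (CFC.sqrt A * CFC.sqrt B)‖ := by
  have h : op (CFC.sqrt B * CFC.sqrt A) = star (op (CFC.sqrt A * CFC.sqrt B)) := by
    simp only [op]
    rw [← map_star, star_mul]
    simp only [Matrix.star_eq_conjTranspose, sqrt_isHermitian.eq]
  rw [h, ContinuousLinearMap.star_eq_adjoint]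
  exact ContinuousLinearMap.adjoint.norm_map _

/-- The trace is a squared Hilbert–Schmidt norm, at most `d` times the squared operator norm. -/
lemma traceForm_le_norm_sq {A B : Matrix (Fin d) (Fin d) ℂ} (hB : B.PosSemidef) :
    traceForm A B ≤ d * ‖op (CFC.sqrt A * CFC.sqrt B)‖ ^ 2 := by
  have h : ∀ i : Fin d, quadForm B (sqrtCol A i) ≤ ‖op (CFC.sqrt A * CFC.sqrt B)‖ ^ 2 := by
    intro i
    rw [quadForm_eq_norm_sq hB, sqrtCol, ← op_mul_apply, ← norm_op_sqrt_mul_comm]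
    refine pow_le_pow_left₀ (norm_nonneg _) ?_ 2
    simpa [norm_basisVec] using (op (CFC.sqrt B * CFC.sqrt A)).le_opNorm (basisVec i)
  calc traceForm A B ≤ ∑ _i : Fin d, ‖op (CFC.sqrt A * CFC.sqrt B)‖ ^ 2 :=
        Finset.sum_le_sum fun i _ => h i
    _ = _ := by simp

/-- The `A_2` condition as an order relation between `⟨W⁻¹⟩` and `⟨W⟩⁻¹`. No trace enters, so the
comparison of `A_∞` with `A_2` stays free of the dimension. -/
lemma quadForm_le_norm_sq_mul {A B : Matrix (Fin d) (Fin d) ℂ} (hA : A.PosDef)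
    (hB : B.PosSemidef) (z : EuclideanSpace ℂ (Fin d)) :
    quadForm B z ≤ ‖op (CFC.sqrt A * CFC.sqrt B)‖ ^ 2 * quadForm A⁻¹ z := by
  rw [quadForm_eq_norm_sq hB, ← quadForm_inv hA, quadForm_eq_norm_sq hA.posSemidef, ← mul_pow,
    ← norm_op_sqrt_mul_comm]
  refine pow_le_pow_left₀ (norm_nonneg _) ?_ 2
  have h : op (CFC.sqrt B) z =
      op (CFC.sqrt B * CFC.sqrt A) (op (CFC.sqrt A) (op A⁻¹ z)) := by
    rw [← op_mul_apply, mul_assoc, CFC.sqrt_mul_sqrt_self A hA.posSemidef.nonneg, op_mul_apply,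
      op_inv_apply hA]
  rw [h]
  exact ContinuousLinearMap.le_opNorm _ _

open BinaryTree

namespace DyadicIndex

/-! ### The tree of dyadic intervals -/

/-- The index of the left half. -/
def lo (I : DyadicIndex) : DyadicIndex :=
  ⟨I.1 + 1, ⟨2 * I.2, by have := I.2.2; rw [pow_succ]; omega⟩⟩

/-- The index of the right half. -/
def hi (I : DyadicIndex) : DyadicIndex :=
  ⟨I.1 + 1, ⟨2 * I.2 + 1, by have := I.2.2; rw [pow_succ]; omega⟩⟩

/-- The index of the whole interval. -/
def root : DyadicIndex := ⟨0, ⟨0, by simp⟩⟩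

/-- The length of the dyadic interval. -/
def length (I : DyadicIndex) : ℝ := (2 ^ I.1)⁻¹

lemma length_pos (I : DyadicIndex) : 0 < I.length := by unfold length; positivity

lemma interval_lo (I : DyadicIndex) : I.lo.interval = I.left := by
  unfold interval left lo midpoint
  push_cast
  congr 1 <;> rw [pow_succ] <;> field_simp

lemma interval_hi (I : DyadicIndex) : I.hi.interval = I.right := by
  unfold interval right hi midpoint
  push_cast
  congr 1 <;> rw [pow_succ] <;> field_simp
  ring

lemma interval_root : root.interval = Set.Ico 0 1 := by
  simp [interval, root]

lemma midpoint_mem (I : DyadicIndex) :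
    (I.2 : ℝ) / 2 ^ I.1 ≤ I.midpoint ∧ I.midpoint ≤ ((I.2 : ℝ) + 1) / 2 ^ I.1 := by
  unfold midpoint
  constructor <;> gcongr <;> linarith

lemma left_union_right (I : DyadicIndex) : I.left ∪ I.right = I.interval :=
  Set.Ico_union_Ico_eq_Ico I.midpoint_mem.1 I.midpoint_mem.2

lemma interval_eq_union (I : DyadicIndex) : I.interval = I.lo.interval ∪ I.hi.interval := by
  rw [interval_lo, interval_hi, left_union_right]

lemma disjoint_left_right (I : DyadicIndex) : Disjoint I.left I.right := by
  rw [Set.disjoint_left]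
  intro x hx hx'
  exact absurd hx.2 (not_lt.2 hx'.1)

lemma disjoint_lo_hi (I : DyadicIndex) : Disjoint I.lo.interval I.hi.interval := by
  rw [interval_lo, interval_hi]; exact I.disjoint_left_right

lemma measurableSet_interval (I : DyadicIndex) : MeasurableSet I.interval := measurableSet_Ico

lemma length_eq (I : DyadicIndex) :
    ((I.2 : ℝ) + 1) / 2 ^ I.1 - (I.2 : ℝ) / 2 ^ I.1 = I.length := by
  unfold length; ring

lemma volume_interval (I : DyadicIndex) : volume I.interval = ENNReal.ofReal I.length := by
  rw [interval, Real.volume_Ico, length_eq]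

lemma volume_real_interval (I : DyadicIndex) : volume.real I.interval = I.length := by
  rw [Measure.real, volume_interval, ENNReal.toReal_ofReal I.length_pos.le]

lemma volume_interval_ne_zero (I : DyadicIndex) : volume I.interval ≠ 0 := by
  rw [volume_interval]; simpa using I.length_pos

lemma volume_interval_ne_top (I : DyadicIndex) : volume I.interval ≠ ∞ := by
  rw [volume_interval]; exact ENNReal.ofReal_ne_top

lemma length_lo (I : DyadicIndex) : I.lo.length = I.length / 2 := by
  unfold length lo; rw [pow_succ]; field_simp

lemma length_hi (I : DyadicIndex) : I.hi.length = I.length / 2 := by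
  unfold length hi; rw [pow_succ]; field_simp

lemma length_root : root.length = 1 := by simp [length, root]

lemma interval_subset_Ico (I : DyadicIndex) : I.interval ⊆ Set.Ico 0 1 := by
  refine Set.Ico_subset_Ico (by positivity) ?_
  rw [div_le_one (by positivity)]
  have := I.2.2
  have h : (I.2 : ℕ) + 1 ≤ 2 ^ I.1 := this
  exact_mod_cast h

lemma interval_subset (I : DyadicIndex) : I.interval ⊆ J :=
  I.interval_subset_Ico.trans Set.Ico_subset_Icc_self

lemma lo_subset (I : DyadicIndex) : I.lo.interval ⊆ I.interval := by
  rw [I.interval_eq_union]; exact Set.subset_union_left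

lemma hi_subset (I : DyadicIndex) : I.hi.interval ⊆ I.interval := by
  rw [I.interval_eq_union]; exact Set.subset_union_right

lemma restrict_J : (volume.restrict J : Measure ℝ) = volume.restrict root.interval := by
  rw [interval_root, J]; exact restrict_Ico_eq_restrict_Icc.symm

/-! ### Averages -/

lemma average_eq {E : Type*} [NormedAddCommGroup E] [NormedSpace ℝ E] (I : DyadicIndex)
    (g : ℝ → E) : ⨍ x in I.interval, g x = I.length⁻¹ • ∫ x in I.interval, g x := by
  rw [setAverage_eq, volume_real_interval]

lemma integral_eq_add {E : Type*} [NormedAddCommGroup E] [NormedSpace ℝ E] (I : DyadicIndex)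
    {g : ℝ → E} (hg : IntegrableOn g J) :
    ∫ x in I.interval, g x = (∫ x in I.lo.interval, g x) + ∫ x in I.hi.interval, g x := by
  rw [I.interval_eq_union, setIntegral_union I.disjoint_lo_hi I.hi.measurableSet_interval
    (hg.mono_set I.lo.interval_subset) (hg.mono_set I.hi.interval_subset)]

lemma average_eq_add {E : Type*} [NormedAddCommGroup E] [NormedSpace ℝ E] (I : DyadicIndex)
    {g : ℝ → E} (hg : IntegrableOn g J) :
    ⨍ x in I.interval, g x =
      (2 : ℝ)⁻¹ • ((⨍ x in I.lo.interval, g x) + ⨍ x in I.hi.interval, g x) := by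
  have h := I.length_pos
  rw [average_eq, average_eq, average_eq, I.integral_eq_add hg, length_lo, length_hi, ← smul_add,
    smul_smul]
  congr 1
  field_simp

lemma isMartingale_average {g : ℝ → ℝ} (hg : IntegrableOn g J) :
    IsMartingale lo hi (fun I => ⨍ x in I.interval, g x) := by
  intro I
  have h := I.average_eq_add hg
  rw [smul_eq_mul] at h
  linarith

lemma lintegral_eq_add (I : DyadicIndex) (g : ℝ → ℝ≥0∞) :
    ∫⁻ x in I.interval, g x = (∫⁻ x in I.lo.interval, g x) + ∫⁻ x in I.hi.interval, g x := by
  rw [I.interval_eq_union, lintegral_union I.hi.measurableSet_interval I.disjoint_lo_hi]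

lemma haar_eq (I : DyadicIndex) (x : ℝ) :
    I.haar x = √(2 ^ I.1) * (I.hi.interval.indicator 1 x - I.lo.interval.indicator 1 x) := by
  rw [interval_lo, interval_hi]; rfl

lemma haar_sq (I : DyadicIndex) (x : ℝ) :
    I.haar x ^ 2 = I.interval.indicator (fun _ => I.length⁻¹) x := by
  rw [haar_eq, mul_pow, Real.sq_sqrt (by positivity), length, inv_inv]
  have hd : x ∈ I.lo.interval → x ∉ I.hi.interval := fun h =>
    Set.disjoint_left.1 I.disjoint_lo_hi h
  have hu : x ∈ I.interval ↔ x ∈ I.lo.interval ∨ x ∈ I.hi.interval := by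
    rw [I.interval_eq_union, Set.mem_union]
  by_cases h1 : x ∈ I.lo.interval <;> by_cases h2 : x ∈ I.hi.interval <;>
    simp_all [Set.indicator]

lemma haar_eq_zero {I : DyadicIndex} {x : ℝ} (hx : x ∉ I.interval) : I.haar x = 0 := by
  have := I.haar_sq x
  rw [Set.indicator_of_notMem hx] at this
  exact pow_eq_zero_iff two_ne_zero |>.1 this

lemma measurable_haar (I : DyadicIndex) : Measurable I.haar := by
  have : I.haar = fun x => √(2 ^ I.1) *
      (I.hi.interval.indicator 1 x - I.lo.interval.indicator 1 x) := funext I.haar_eq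
  rw [this]
  exact ((measurable_one.indicator I.hi.measurableSet_interval).sub
    (measurable_one.indicator I.lo.measurableSet_interval)).const_mul _

end DyadicIndex

open DyadicIndex

/-! ### Haar coefficients as differences of averages -/

lemma haarCoeff_eq {f : ℝ → EuclideanSpace ℂ (Fin d)} (hf : IntegrableOn f J) (I : DyadicIndex) :
    haarCoeff f I = (√(2 ^ I.1) * (I.length / 2)) •
      ((⨍ x in I.hi.interval, f x) - ⨍ x in I.lo.interval, f x) := by
  have h1 : ∀ x, I.haar x • f x = √(2 ^ I.1) • (I.hi.interval.indicator f x -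
      I.lo.interval.indicator f x) := by
    intro x
    rw [I.haar_eq, mul_smul, sub_smul]
    congr 2 <;> simp only [Set.indicator] <;> split_ifs <;> simp
  have hi1 : ∀ K : DyadicIndex, IntegrableOn (K.interval.indicator f) J :=
    fun K => Integrable.indicator hf K.measurableSet_interval
  have h2 : ∀ K : DyadicIndex, ∫ x in J, K.interval.indicator f x = ∫ x in K.interval, f x := by
    intro K
    rw [setIntegral_indicator K.measurableSet_interval, Set.inter_eq_right.2 K.interval_subset]
  rw [haarCoeff]
  simp only [h1]
  rw [integral_smul, integral_sub (hi1 _) (hi1 _), h2, h2, I.hi.average_eq, I.lo.average_eq,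
    length_lo, length_hi, ← smul_sub, smul_smul]
  congr 1
  have := I.length_pos
  field_simp

lemma norm_op_haarCoeff_sq {f : ℝ → EuclideanSpace ℂ (Fin d)} (hf : IntegrableOn f J)
    (B : Matrix (Fin d) (Fin d) ℂ) (I : DyadicIndex) :
    ‖op B (haarCoeff f I)‖ ^ 2 =
      I.length * (‖op B ((⨍ x in I.hi.interval, f x) - ⨍ x in I.lo.interval, f x)‖ ^ 2 / 4) := by
  have e : ∀ (c : ℝ) (z : EuclideanSpace ℂ (Fin d)), op B (c • z) = c • op B z :=
    fun c z => (op B).map_smul_of_tower c z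
  rw [haarCoeff_eq hf, e, norm_smul, mul_pow, Real.norm_eq_abs, sq_abs, mul_pow,
    Real.sq_sqrt (by positivity)]
  have : (2 : ℝ) ^ I.1 * I.length = 1 := by unfold length; field_simp
  linear_combination (I.length * ‖op B ((⨍ x in I.hi.interval, f x) -
    ⨍ x in I.lo.interval, f x)‖ ^ 2 / 4) * this

/-! ### Sums over the dyadic tree -/

lemma sum_fin_two_pow_succ (n : ℕ) (φ : DyadicIndex → ℝ) :
    ∑ j : Fin (2 ^ (n + 1)), φ ⟨n + 1, j⟩ =
      ∑ j : Fin (2 ^ n), (φ (lo ⟨n, j⟩) + φ (hi ⟨n, j⟩)) := by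
  rw [← (finProdFinEquiv.trans (finCongr (pow_succ 2 n).symm)).sum_comp, Fintype.sum_prod_type]
  refine Finset.sum_congr rfl fun j _ => ?_
  rw [Fin.sum_univ_two]
  congr 2
  · simp [lo, Fin.ext_iff]
  · simp [hi, Fin.ext_iff]
    ring

lemma leafAverage_succ' {T : Type*} {l r : T → T} (φ : T → ℝ) (k : ℕ) (t : T) :
    leafAverage l r φ (k + 1) t = leafAverage l r (fun s => (φ (l s) + φ (r s)) / 2) k t := by
  induction k generalizing t with
  | zero => rfl
  | succ k ih => rw [leafAverage, ih, ih]; rfl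

lemma leafAverage_root (φ : DyadicIndex → ℝ) (n : ℕ) :
    leafAverage lo hi φ n root = (2 ^ n)⁻¹ * ∑ j : Fin (2 ^ n), φ ⟨n, j⟩ := by
  induction n generalizing φ with
  | zero => simp [leafAverage, root]
  | succ n ih =>
    rw [leafAverage_succ', ih, sum_fin_two_pow_succ, ← Finset.sum_div, pow_succ]
    ring

lemma descendantSum_eq_sum {T : Type*} {l r : T → T} (φ : T → ℝ) (N : ℕ) (t : T) :
    descendantSum l r φ N t = ∑ n ∈ Finset.range N, leafAverage l r φ n t := by
  induction N generalizing t with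
  | zero => rfl
  | succ N ih =>
    rw [descendantSum, ih, ih, Finset.sum_range_succ', ← Finset.sum_add_distrib, Finset.sum_div,
      add_comm]
    rfl

lemma descendantSum_root (φ : DyadicIndex → ℝ) (N : ℕ) :
    descendantSum lo hi φ N root =
      ∑ n ∈ Finset.range N, ∑ j : Fin (2 ^ n), length ⟨n, j⟩ * φ ⟨n, j⟩ := by
  rw [descendantSum_eq_sum]
  refine Finset.sum_congr rfl fun n _ => ?_
  rw [leafAverage_root, Finset.mul_sum]
  rfl

/-! ### Regular weights -/

/-- A weight that is entrywise integrable, together with its inverse, and positive definite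
almost everywhere. -/
structure IsRegular (W : ℝ → Matrix (Fin d) (Fin d) ℂ) : Prop where
  integrable : EntrywiseIntegrable W
  integrable_inv : EntrywiseIntegrable fun x => (W x)⁻¹
  posDef : ∀ᵐ x ∂volume.restrict J, (W x).PosDef

lemma isRegular_of_matrixA2_lt_top {W : ℝ → Matrix (Fin d) (Fin d) ℂ} (hW : IsMatrixWeight W)
    (h : matrixA2 W < ∞) : IsRegular W := by
  unfold matrixA2 at h
  split_ifs at h with hc
  · refine ⟨hW.integrable, hc.2, ?_⟩
    filter_upwards [hW.posSemidef, hc.1] with x h1 h2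
    exact h1.posDef_iff_isUnit.2 h2
  · simp at h

lemma IsRegular.inv {W : ℝ → Matrix (Fin d) (Fin d) ℂ} (hW : IsRegular W) :
    IsRegular fun x => (W x)⁻¹ := by
  refine ⟨hW.integrable_inv, fun i j => ?_, hW.posDef.mono fun x hx => hx.inv⟩
  refine (hW.integrable i j).congr ?_
  filter_upwards [hW.posDef] with x hx
  rw [Matrix.nonsing_inv_nonsing_inv _ ((Matrix.isUnit_iff_isUnit_det _).1 hx.isUnit)]

lemma ae_restrict_interval {p : ℝ → Prop} (h : ∀ᵐ x ∂volume.restrict J, p x) (I : DyadicIndex) :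
    ∀ᵐ x ∂volume.restrict I.interval, p x :=
  ae_restrict_of_ae_restrict_of_subset I.interval_subset h

lemma integrableOn_quadForm {W : ℝ → Matrix (Fin d) (Fin d) ℂ} (hW : EntrywiseIntegrable W)
    (z : EuclideanSpace ℂ (Fin d)) : IntegrableOn (fun x => quadForm (W x) z) J := by
  simp only [quadForm_eq_sum]
  refine integrable_finsetSum _ fun i _ => integrable_finsetSum _ fun j _ => ?_
  exact (((hW i j).const_mul _).mul_const _).re

lemma quadForm_matAverage {W : ℝ → Matrix (Fin d) (Fin d) ℂ} (hW : EntrywiseIntegrable W)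
    (I : DyadicIndex) (z : EuclideanSpace ℂ (Fin d)) :
    quadForm (matAverage W I) z = ⨍ x in I.interval, quadForm (W x) z := by
  have hI : ∀ i j, IntegrableOn (fun x => W x i j) I.interval := fun i j =>
    (hW i j).mono_set I.interval_subset
  have hI' : ∀ i j, IntegrableOn (fun x => ((starRingEnd ℂ) (z i) * W x i j * z j).re)
      I.interval := fun i j => (((hI i j).const_mul _).mul_const _).re
  rw [I.average_eq]
  simp only [quadForm_eq_sum]
  rw [integral_finsetSum _ fun i _ => integrable_finsetSum _ fun j _ => hI' i j]
  simp only [integral_finsetSum _ fun j _ => hI' _ j]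
  rw [smul_eq_mul, Finset.mul_sum]
  refine Finset.sum_congr rfl fun i _ => ?_
  rw [Finset.mul_sum]
  refine Finset.sum_congr rfl fun j _ => ?_
  have h1 : ∫ x in I.interval, ((starRingEnd ℂ) (z i) * W x i j * z j).re =
      (∫ x in I.interval, (starRingEnd ℂ) (z i) * W x i j * z j).re :=
    integral_re (((hI i j).const_mul _).mul_const _)
  rw [h1, integral_mul_const, integral_const_mul, matAverage, Matrix.of_apply, I.average_eq,
    ← Complex.re_ofReal_mul, Complex.real_smul]
  congr 1
  ring

lemma posDef_of_quadForm_pos {A : Matrix (Fin d) (Fin d) ℂ} (hA : A.IsHermitian)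
    (h : ∀ z, z ≠ 0 → 0 < quadForm A z) : A.PosDef := by
  refine Matrix.PosDef.of_dotProduct_mulVec_pos hA fun z hz => ?_
  have h1 := h (WithLp.toLp 2 z) (fun h => hz ((WithLp.toLp_eq_zero _).1 h))
  rw [quadForm_eq_dotProduct] at h1
  rw [RCLike.pos_iff]
  exact ⟨h1, hA.im_star_dotProduct_mulVec_self z⟩

lemma matAverage_isHermitian {W : ℝ → Matrix (Fin d) (Fin d) ℂ}
    (hW : ∀ᵐ x ∂volume.restrict J, (W x).IsHermitian) (I : DyadicIndex) :
    (matAverage W I).IsHermitian := by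
  ext i j
  rw [Matrix.conjTranspose_apply, matAverage, Matrix.of_apply, Matrix.of_apply, I.average_eq,
    I.average_eq, star_smul, star_trivial]
  congr 1
  refine (integral_conj (f := fun x => W x j i)).symm.trans (integral_congr_ae ?_)
  filter_upwards [ae_restrict_interval hW I] with x hx
  exact hx.apply i j

lemma average_pos {g : ℝ → ℝ} (hg : IntegrableOn g J) (h : ∀ᵐ x ∂volume.restrict J, 0 < g x)
    (I : DyadicIndex) : 0 < ⨍ x in I.interval, g x := by
  rw [I.average_eq]
  refine mul_pos (inv_pos.2 I.length_pos) ?_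
  have hI := ae_restrict_interval h I
  rw [integral_pos_iff_support_of_nonneg_ae (hI.mono fun x hx => hx.le)
    (hg.mono_set I.interval_subset)]
  have h1 : (Function.support g : Set ℝ) =ᵐ[volume.restrict I.interval] Set.univ := by
    rw [eventuallyEq_univ]
    exact hI.mono fun x hx => hx.ne'
  rw [measure_congr h1, Measure.restrict_apply_univ, pos_iff_ne_zero]
  exact I.volume_interval_ne_zero

lemma average_mono {g h : ℝ → ℝ} (hg : IntegrableOn g J) (hh : IntegrableOn h J)
    (hgh : ∀ᵐ x ∂volume.restrict J, g x ≤ h x) (I : DyadicIndex) :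
    ⨍ x in I.interval, g x ≤ ⨍ x in I.interval, h x := by
  rw [I.average_eq, I.average_eq]
  exact mul_le_mul_of_nonneg_left (integral_mono_ae (hg.mono_set I.interval_subset)
    (hh.mono_set I.interval_subset) (ae_restrict_interval hgh I)) (inv_pos.2 I.length_pos).le

lemma IsRegular.matAverage_posDef {W : ℝ → Matrix (Fin d) (Fin d) ℂ} (hW : IsRegular W)
    (I : DyadicIndex) : (matAverage W I).PosDef := by
  refine posDef_of_quadForm_pos
    (matAverage_isHermitian (hW.posDef.mono fun x hx => hx.isHermitian) I) fun z hz => ?_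
  rw [quadForm_matAverage hW.integrable]
  exact average_pos (integrableOn_quadForm hW.integrable z)
    (hW.posDef.mono fun x hx => quadForm_pos hx hz) I

lemma isMartingale_quadForm {W : ℝ → Matrix (Fin d) (Fin d) ℂ} (hW : EntrywiseIntegrable W)
    (z : EuclideanSpace ℂ (Fin d)) :
    IsMartingale lo hi fun I => quadForm (matAverage W I) z := by
  simp only [quadForm_matAverage hW]
  exact isMartingale_average (integrableOn_quadForm hW z)

lemma isMartingale_traceForm {W : ℝ → Matrix (Fin d) (Fin d) ℂ} (hW : EntrywiseIntegrable W)
    (A : Matrix (Fin d) (Fin d) ℂ) :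
    IsMartingale lo hi fun I => traceForm A (matAverage W I) := by
  intro I
  simp only [traceForm]
  rw [← Finset.sum_add_distrib, Finset.sum_div]
  exact Finset.sum_congr rfl fun i _ => isMartingale_quadForm hW _ I

/-! ### Functions in the weighted space -/

lemma aestronglyMeasurable_quadForm {W : ℝ → Matrix (Fin d) (Fin d) ℂ} (hW : EntrywiseIntegrable W)
    {f : ℝ → EuclideanSpace ℂ (Fin d)} (hf : AEStronglyMeasurable f (volume.restrict J)) :
    AEStronglyMeasurable (fun x => quadForm (W x) (f x)) (volume.restrict J) := by
  simp only [quadForm_eq_sum]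
  have hc : ∀ i, AEStronglyMeasurable (fun x => f x i) (volume.restrict J) := fun i =>
    (EuclideanSpace.proj (𝕜 := ℂ) i).continuous.comp_aestronglyMeasurable hf
  refine Finset.aestronglyMeasurable_fun_sum _ fun i _ =>
    Finset.aestronglyMeasurable_fun_sum _ fun j _ => ?_
  exact Complex.continuous_re.comp_aestronglyMeasurable
    (((Complex.continuous_conj.comp_aestronglyMeasurable (hc i)).mul (hW i j).1).mul (hc j))

lemma enorm_op_sqrt_sq {A : Matrix (Fin d) (Fin d) ℂ} (hA : A.PosSemidef)
    (z : EuclideanSpace ℂ (Fin d)) :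
    ‖op (CFC.sqrt A) z‖ₑ ^ 2 = ENNReal.ofReal (quadForm A z) := by
  rw [quadForm_eq_norm_sq hA, ENNReal.ofReal_pow (norm_nonneg _), ofReal_norm]

lemma weightedNorm_sq {W : ℝ → Matrix (Fin d) (Fin d) ℂ}
    (hW : ∀ᵐ x ∂volume.restrict J, (W x).PosDef) (f : ℝ → EuclideanSpace ℂ (Fin d)) :
    weightedNorm W f ^ 2 = ∫⁻ x in J, ENNReal.ofReal (quadForm (W x) (f x)) := by
  rw [weightedNorm, ← ENNReal.rpow_natCast, ← ENNReal.rpow_mul]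
  norm_num
  exact lintegral_congr_ae (hW.mono fun x hx => enorm_op_sqrt_sq hx.posSemidef _)

lemma IsRegular.integrableOn_quadForm_of_mem {W : ℝ → Matrix (Fin d) (Fin d) ℂ} (hW : IsRegular W)
    {f : ℝ → EuclideanSpace ℂ (Fin d)} (hf : MemWeightedL2 W f) :
    IntegrableOn (fun x => quadForm (W x) (f x)) J := by
  refine ⟨aestronglyMeasurable_quadForm hW.integrable hf.1, ?_⟩
  rw [hasFiniteIntegral_iff_ofReal (hW.posDef.mono fun x hx => quadForm_nonneg hx.posSemidef _),
    ← weightedNorm_sq hW.posDef]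
  exact ENNReal.pow_lt_top hf.2

/-- Pointwise, `‖f‖² ≤ tr(W⁻¹) ⟨W f, f⟩`, a product of two integrable functions; hence `‖f‖` is
dominated by their sum. This gives the Haar coefficients their meaning. -/
lemma IsRegular.integrableOn_of_mem {W : ℝ → Matrix (Fin d) (Fin d) ℂ} (hW : IsRegular W)
    {f : ℝ → EuclideanSpace ℂ (Fin d)} (hf : MemWeightedL2 W f) : IntegrableOn f J := by
  have h1 : IntegrableOn (fun x => ∑ i, quadForm (W x)⁻¹ (basisVec i)) J :=
    integrable_finsetSum _ fun i _ => integrableOn_quadForm hW.integrable_inv _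
  refine (h1.add (hW.integrableOn_quadForm_of_mem hf)).mono' hf.1 ?_
  filter_upwards [hW.posDef] with x hx
  have h2 := norm_sq_le_sum_quadForm_mul hx (f x)
  have h3 : 0 ≤ ∑ i, quadForm (W x)⁻¹ (basisVec i) :=
    Finset.sum_nonneg fun i _ => quadForm_nonneg hx.inv.posSemidef _
  have h4 := quadForm_nonneg hx.posSemidef (f x)
  simp only [Pi.add_apply]
  refine le_of_pow_le_pow_left₀ two_ne_zero (add_nonneg h3 h4) (h2.trans ?_)
  nlinarith [mul_nonneg h3 h4, sq_nonneg (∑ i, quadForm (W x)⁻¹ (basisVec i)),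
    sq_nonneg (quadForm (W x) (f x))]

lemma IsRegular.ofReal_integral_quadForm {W : ℝ → Matrix (Fin d) (Fin d) ℂ} (hW : IsRegular W)
    {f : ℝ → EuclideanSpace ℂ (Fin d)} (hf : MemWeightedL2 W f) :
    ENNReal.ofReal (∫ x in J, quadForm (W x) (f x)) = weightedNorm W f ^ 2 := by
  rw [weightedNorm_sq hW.posDef, ofReal_integral_eq_lintegral_ofReal
    (hW.integrableOn_quadForm_of_mem hf)
    (hW.posDef.mono fun x hx => quadForm_nonneg hx.posSemidef _)]

/-! ### The upper bound for sums of weighted Haar coefficients -/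

lemma maxAverage_zero {T : Type*} {l r : T → T} (k : ℕ) (t : T) :
    maxAverage l r (fun _ _ => (0 : ℝ)) k 0 t = 0 := by
  induction k generalizing t with
  | zero => simp [maxAverage]
  | succ k ih => simp [maxAverage, ih]

lemma maxAverage_sum_le {T ι : Type*} {l r : T → T} (s : Finset ι) (x : ι → T → ℝ) (k : ℕ) (t : T) :
    maxAverage l r (fun _ u => ∑ i ∈ s, x i u) k 0 t ≤
      ∑ i ∈ s, maxAverage l r (fun _ => x i) k 0 t := by
  classical
  induction s using Finset.induction_on with
  | empty => simp [maxAverage_zero]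
  | insert a s ha ih =>
    simp only [Finset.sum_insert ha]
    have := maxAverage_add (l := l) (r := r) (x := x a) (y := fun u => ∑ i ∈ s, x i u) k 0 0 t
    rw [add_zero] at this
    linarith

/-- Cauchy–Schwarz through the weighted arithmetic–geometric mean inequality, with the optimal
weight `c = √Y / √X`; only upper bounds for the two averages are needed. -/
lemma average_mul_le_sqrt {a g h : ℝ → ℝ} (ha : IntegrableOn a J) (hg : IntegrableOn g J)
    (hh : IntegrableOn h J) (hagh : ∀ᵐ x ∂volume.restrict J, 0 ≤ g x ∧ 0 ≤ h x ∧ a x ^ 2 ≤ g x * h x)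
    (I : DyadicIndex) {X Y : ℝ} (hX : 0 < X) (hY : 0 < Y) (hgX : ⨍ x in I.interval, g x ≤ X)
    (hhY : ⨍ x in I.interval, h x ≤ Y) :
    ⨍ x in I.interval, a x ≤ X ^ (1 / 2 : ℝ) * Y ^ (1 / 2 : ℝ) := by
  rw [← Real.sqrt_eq_rpow, ← Real.sqrt_eq_rpow]
  have hx := Real.sqrt_pos.2 hX
  have hy := Real.sqrt_pos.2 hY
  set c := √Y / √X with hc
  have hc0 : 0 < c := div_pos hy hx
  have h1 : ∀ᵐ x ∂volume.restrict J, a x ≤ c / 2 * g x + c⁻¹ / 2 * h x := by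
    filter_upwards [hagh] with x hx
    obtain ⟨h1, h2, h3⟩ := hx
    refine le_of_abs_le (abs_le_of_sq_le_sq ?_ (by positivity))
    refine h3.trans ?_
    have e : c * c⁻¹ = 1 := mul_inv_cancel₀ hc0.ne'
    nlinarith [sq_nonneg (c / 2 * g x - c⁻¹ / 2 * h x)]
  have hI := I.interval_subset
  have h2 := average_mono ha ((hg.const_mul (c / 2)).add (hh.const_mul (c⁻¹ / 2))) h1 I
  have h3 : ⨍ x in I.interval, (c / 2 * g x + c⁻¹ / 2 * h x) =
      c / 2 * (⨍ x in I.interval, g x) + c⁻¹ / 2 * ⨍ x in I.interval, h x := by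
    rw [I.average_eq, I.average_eq, I.average_eq, integral_add
      ((hg.mono_set hI).const_mul _) ((hh.mono_set hI).const_mul _), integral_const_mul,
      integral_const_mul]
    simp only [smul_eq_mul]
    ring
  calc ⨍ x in I.interval, a x ≤ _ := h2
    _ = _ := h3
    _ ≤ c / 2 * X + c⁻¹ / 2 * Y := by gcongr
    _ = c / 2 * (√X) ^ 2 + c⁻¹ / 2 * (√Y) ^ 2 := by
        rw [Real.sq_sqrt hX.le, Real.sq_sqrt hY.le]
    _ = √X * √Y := by rw [hc]; field_simp; ring

/-- The square function bound, as an inequality for sums of weighted Haar coefficients. -/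
theorem sum_norm_op_haarCoeff_sq_le (hd : 0 < d) {W : ℝ → Matrix (Fin d) (Fin d) ℂ}
    (hW : IsRegular W) {Q A : ℝ}
    (hQ : ∀ I, ‖op (CFC.sqrt (matAverage W I) *
      CFC.sqrt (matAverage (fun x => (W x)⁻¹) I))‖ ^ 2 ≤ Q)
    (hA1 : 1 ≤ A)
    (hA : ∀ e k I, maxAverage lo hi (fun _ K => quadForm (matAverage (fun x => (W x)⁻¹) K) e) k 0 I ≤
      A * quadForm (matAverage (fun x => (W x)⁻¹) I) e)
    {f : ℝ → EuclideanSpace ℂ (Fin d)} (hf : MemWeightedL2 W f) (N : ℕ) :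
    ∑ n ∈ Finset.range N, ∑ j : Fin (2 ^ n),
      ‖op (CFC.sqrt (matAverage W ⟨n, j⟩)) (haarCoeff f ⟨n, j⟩)‖ ^ 2 ≤
      40960 * d ^ 2 * Q * A * ∫ x in J, quadForm (W x) (f x) := by
  have hfi := hW.integrableOn_of_mem hf
  have hqi := hW.integrableOn_quadForm_of_mem hf
  have hV := hW.inv
  set V : ℝ → Matrix (Fin d) (Fin d) ℂ := fun x => (W x)⁻¹ with hVdef
  have hWp := hW.matAverage_posDef
  have hVp := hV.matAverage_posDef
  have hd0 : (0 : ℝ) < d := by exact_mod_cast hd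
  have hQ0 : 0 ≤ Q := (sq_nonneg _).trans (hQ root)
  set F : DyadicIndex → EuclideanSpace ℂ (Fin d) := fun I => ⨍ x in I.interval, f x with hF
  have hFm : ∀ I, F I = (2 : ℝ)⁻¹ • (F I.lo + F I.hi) := fun I => I.average_eq_add hfi
  set φ : DyadicIndex → ℝ := fun I =>
    ‖op (CFC.sqrt (matAverage W I)) (F I.hi - F I.lo)‖ ^ 2 / 4 with hφ
  have hsum : ∑ n ∈ Finset.range N, ∑ j : Fin (2 ^ n),
      ‖op (CFC.sqrt (matAverage W ⟨n, j⟩)) (haarCoeff f ⟨n, j⟩)‖ ^ 2 =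
        descendantSum lo hi φ N root := by
    rw [descendantSum_root]
    exact Finset.sum_congr rfl fun n _ => Finset.sum_congr rfl fun j _ =>
      norm_op_haarCoeff_sq hfi _ _
  rw [hsum]
  have hroot : ⨍ x in root.interval, quadForm (W x) (f x) = ∫ x in J, quadForm (W x) (f x) := by
    rw [root.average_eq, length_root, inv_one, one_smul, restrict_J]
  -- the claim, up to a positive error
  suffices hη : ∀ η : ℝ, 0 < η → descendantSum lo hi φ N root ≤
      40960 * d ^ 2 * Q * A * ((∫ x in J, quadForm (W x) (f x)) + η) by
    refine le_of_forall_pos_le_add fun δ hδ => ?_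
    have hc : 0 ≤ 40960 * d ^ 2 * Q * A := by positivity
    have h1 := hη (δ / (40960 * d ^ 2 * Q * A + 1)) (by positivity)
    refine h1.trans ?_
    rw [mul_add]
    have : 40960 * d ^ 2 * Q * A * (δ / (40960 * d ^ 2 * Q * A + 1)) ≤ δ := by
      rw [mul_div_assoc', div_le_iff₀ (by positivity)]
      nlinarith
    linarith
  -- Adding `η` to the averages of `⟨W f, f⟩` makes them strictly positive, as the tree estimate
  -- requires of `y`, and keeps them a martingale.
  intro η hη
  have hy0 : ∀ I : DyadicIndex, 0 ≤ ⨍ x in I.interval, quadForm (W x) (f x) := by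
    intro I
    rw [I.average_eq]
    refine mul_nonneg (inv_pos.2 I.length_pos).le (integral_nonneg_of_ae ?_)
    exact (ae_restrict_interval hW.posDef I).mono fun x hx => quadForm_nonneg hx.posSemidef _
  -- Parallelogram law: for a fixed matrix, the Haar term is exactly the increment of the energy
  -- from `I` to its halves.
  have hEm : ∀ (B : Matrix (Fin d) (Fin d) ℂ) (I : DyadicIndex),
      ‖op B (F I.hi - F I.lo)‖ ^ 2 / 4 + ‖op B (F I)‖ ^ 2 =
        (‖op B (F I.lo)‖ ^ 2 + ‖op B (F I.hi)‖ ^ 2) / 2 := by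
    intro B I
    rw [hFm I, (op B).map_smul_of_tower, map_sub, map_add, norm_smul]
    have h1 := parallelogram_law_with_norm ℂ (op B (F I.hi)) (op B (F I.lo))
    rw [add_comm (op B (F I.hi))] at h1
    norm_num
    nlinarith
  have hnorm : ∀ B : Matrix (Fin d) (Fin d) ℂ, IntegrableOn (fun x => ‖op B (f x)‖) J := fun B =>
    ((op B).integrable_comp hfi).norm
  have main := descendantSum_le_of_weights (l := lo) (r := hi) (φ := φ)
    (y := fun I => (⨍ x in I.interval, quadForm (W x) (f x)) + η)
    (X := fun L K => traceForm (matAverage W L) (matAverage V K))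
    (u := fun L K => ⨍ x in K.interval, ‖op (CFC.sqrt (matAverage W L)) (f x)‖)
    (p := fun L K => traceForm (matAverage W L)⁻¹ (matAverage W K) / d)
    (E := fun L K => ‖op (CFC.sqrt (matAverage W L)) (F K)‖ ^ 2)
    (C := 4 * d) (κ := d * Q) (A := A) (by positivity) hA1
    (fun L K => traceForm_pos hd (hWp L) (hVp K))
    (fun L => isMartingale_traceForm hV.integrable _)
    ?_ ?_ (fun I => by linarith [hy0 I]) ?_ ?_ (fun L => isMartingale_average (hnorm _)) ?_
    (fun L K => div_nonneg (traceForm_nonneg _ (hWp K).posSemidef) hd0.le) ?_ ?_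
    (fun L K => sq_nonneg _) ?_ ?_ N root
  · refine main.trans (le_of_eq ?_)
    simp only [hroot]
    ring
  · intro L k K
    -- The trace is the sum of the scalar weights `V_e` over the columns `e` of the square root of
    -- `⟨W⟩_L`, each with the same `A_∞` constant.
    simp only [traceForm]
    rw [Finset.mul_sum]
    exact (maxAverage_sum_le _ _ _ _).trans (Finset.sum_le_sum fun i _ => hA _ k K)
  · intro L
    exact (traceForm_le_norm_sq (hVp L).posSemidef).trans
      (mul_le_mul_of_nonneg_left (hQ L) hd0.le)
  · intro I
    have := isMartingale_average hqi I
    simp only at this ⊢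
    linarith
  · intro L K
    rw [K.average_eq]
    exact mul_nonneg (inv_pos.2 K.length_pos).le (integral_nonneg fun x => norm_nonneg _)
  · intro L K
    have hti : ∀ x, traceForm (matAverage W L) (V x) =
        ∑ i, quadForm (V x) (sqrtCol (matAverage W L) i) := fun x => rfl
    have hg : IntegrableOn (fun x => traceForm (matAverage W L) (V x)) J := by
      simp only [hti]
      exact integrable_finsetSum _ fun i _ => integrableOn_quadForm hV.integrable _
    refine average_mul_le_sqrt (hnorm _) hg hqi ?_ K (traceForm_pos hd (hWp L) (hVp K))
      (by linarith [hy0 K]) ?_ (by linarith)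
    · filter_upwards [hW.posDef] with x hx
      refine ⟨traceForm_nonneg _ hx.inv.posSemidef, quadForm_nonneg hx.posSemidef _, ?_⟩
      rw [← quadForm_eq_norm_sq (hWp L).posSemidef]
      exact quadForm_le_traceForm_mul (hWp L).posSemidef hx _
    · refine le_of_eq ?_
      simp only [hti]
      rw [K.average_eq, integral_finsetSum _ fun i _ =>
        (integrableOn_quadForm hV.integrable _).mono_set K.interval_subset, traceForm,
        smul_eq_mul, Finset.mul_sum]
      exact Finset.sum_congr rfl fun i _ => by
        rw [quadForm_matAverage hV.integrable, K.average_eq, smul_eq_mul]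
  · intro L I
    have := isMartingale_traceForm hW.integrable (matAverage W L)⁻¹ I
    simp only at this ⊢
    rw [this]; ring
  · intro L
    rw [traceForm_inv_self (hWp L), div_self hd0.ne']
  · intro L K
    have h1 : op (CFC.sqrt (matAverage W L)) (F K) =
        ⨍ x in K.interval, op (CFC.sqrt (matAverage W L)) (f x) := by
      simp only [hF]
      rw [K.average_eq, K.average_eq,
        (op _).integral_comp_comm (hfi.mono_set K.interval_subset),
        (op _).map_smul_of_tower]
    refine pow_le_pow_left₀ (norm_nonneg _) ?_ 2
    rw [h1, K.average_eq, K.average_eq, norm_smul, Real.norm_eq_abs,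
      abs_of_pos (inv_pos.2 K.length_pos), smul_eq_mul]
    exact mul_le_mul_of_nonneg_left (norm_integral_le_integral_norm _)
      (inv_pos.2 K.length_pos).le
  -- Before stopping, `tr(⟨W⟩_L⁻¹ ⟨W⟩_K) ≤ 4d`, so the moving matrix `⟨W⟩_K` can be replaced by the
  -- frozen `⟨W⟩_L` at the cost `4d`.
  · intro L K hK
    rw [div_le_iff₀ hd0] at hK
    have h1 := quadForm_le_traceForm_mul (hWp K).posSemidef (hWp L) (F K.hi - F K.lo)
    rw [traceForm_comm (hWp K).posSemidef (hWp L).inv.posSemidef,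
      quadForm_eq_norm_sq (hWp K).posSemidef, quadForm_eq_norm_sq (hWp L).posSemidef] at h1
    have h2 := mul_le_mul_of_nonneg_right hK
      (sq_nonneg ‖op (CFC.sqrt (matAverage W L)) (F K.hi - F K.lo)‖)
    have h3 := hEm (CFC.sqrt (matAverage W L)) K
    rw [← h3]
    simp only [hφ]
    linarith

/-! ### The scalar `A_∞` characteristic and running maxima on the tree -/

lemma scalarAverage_eq (I : DyadicIndex) (w : ℝ → ℝ≥0∞) :
    scalarAverage I w = (∫⁻ x in I.interval, w x) / ENNReal.ofReal I.length := by
  rw [scalarAverage, setLAverage_eq, I.volume_interval]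

/-- A running maximum of finite depth is dominated by the full maximal function. This direction
extracts the tree condition from the `A_∞` characteristic, and `g` need not be measurable. -/
lemma ofReal_maxAverage_le_lintegral {x : DyadicIndex → ℝ} (k : ℕ) (m : ℝ) (I : DyadicIndex)
    {g : ℝ → ℝ≥0∞} (hm : ∀ y ∈ I.interval, ENNReal.ofReal m ≤ g y)
    (hg : ∀ L : DyadicIndex, L.interval ⊆ I.interval → ∀ y ∈ L.interval,
      ENNReal.ofReal (x L) ≤ g y) :
    ENNReal.ofReal (I.length * maxAverage lo hi (fun _ => x) k m I) ≤ ∫⁻ y in I.interval, g y := by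
  induction k generalizing m I with
  | zero =>
    rw [maxAverage, ENNReal.ofReal_mul I.length_pos.le, ← I.volume_interval, mul_comm,
      ← setLIntegral_const]
    refine setLIntegral_mono' I.measurableSet_interval fun y hy => ?_
    rcases max_cases m (x I) with h | h
    · rw [h.1]; exact hm y hy
    · rw [h.1]; exact hg I subset_rfl y hy
  | succ k ih =>
    rw [I.lintegral_eq_add, maxAverage]
    have hm' : ∀ y ∈ I.interval, ENNReal.ofReal (max m (x I)) ≤ g y := by
      intro y hy
      rcases max_cases m (x I) with h | h
      · rw [h.1]; exact hm y hy
      · rw [h.1]; exact hg I subset_rfl y hy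
    have h1 := ih (max m (x I)) I.lo (fun y hy => hm' y (I.lo_subset hy))
      (fun L hL => hg L (hL.trans I.lo_subset))
    have h2 := ih (max m (x I)) I.hi (fun y hy => hm' y (I.hi_subset hy))
      (fun L hL => hg L (hL.trans I.hi_subset))
    refine le_trans ?_ (add_le_add h1 h2)
    refine le_trans (ENNReal.ofReal_le_ofReal (le_of_eq ?_)) ENNReal.ofReal_add_le
    rw [length_lo, length_hi]
    ring

/-- The running maximum over the first `k` generations below `I`, as a function on `I`. -/
def runningMax (x : DyadicIndex → ℝ) : ℕ → ℝ → DyadicIndex → ℝ → ℝ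
  | 0, m, I, _ => max m (x I)
  | k + 1, m, I, y => (I.lo.interval.indicator (runningMax x k (max m (x I)) I.lo) y) +
      I.lo.intervalᶜ.indicator (runningMax x k (max m (x I)) I.hi) y

lemma measurable_runningMax (x : DyadicIndex → ℝ) (k : ℕ) (m : ℝ) (I : DyadicIndex) :
    Measurable (runningMax x k m I) := by
  induction k generalizing m I with
  | zero => exact measurable_const
  | succ k ih =>
    exact ((ih _ _).indicator I.lo.measurableSet_interval).add
      ((ih _ _).indicator I.lo.measurableSet_interval.compl)

lemma runningMax_succ_lo {x : DyadicIndex → ℝ} {k : ℕ} {m : ℝ} {I : DyadicIndex} {y : ℝ}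
    (hy : y ∈ I.lo.interval) :
    runningMax x (k + 1) m I y = runningMax x k (max m (x I)) I.lo y := by
  simp [runningMax, hy]

lemma runningMax_succ_hi {x : DyadicIndex → ℝ} {k : ℕ} {m : ℝ} {I : DyadicIndex} {y : ℝ}
    (hy : y ∉ I.lo.interval) :
    runningMax x (k + 1) m I y = runningMax x k (max m (x I)) I.hi y := by
  simp [runningMax, hy]

lemma le_runningMax (x : DyadicIndex → ℝ) (k : ℕ) (m : ℝ) (I : DyadicIndex) (y : ℝ) :
    max m (x I) ≤ runningMax x k m I y := by
  induction k generalizing m I with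
  | zero => exact le_rfl
  | succ k ih =>
    by_cases hy : y ∈ I.lo.interval
    · rw [runningMax_succ_lo hy]; exact (le_max_left _ _).trans (ih _ _)
    · rw [runningMax_succ_hi hy]; exact (le_max_left _ _).trans (ih _ _)

lemma runningMax_le_succ (x : DyadicIndex → ℝ) (k : ℕ) (m : ℝ) (I : DyadicIndex) (y : ℝ) :
    runningMax x k m I y ≤ runningMax x (k + 1) m I y := by
  induction k generalizing m I with
  | zero => exact le_runningMax x 1 m I y
  | succ k ih =>
    by_cases hy : y ∈ I.lo.interval
    · rw [runningMax_succ_lo hy, runningMax_succ_lo hy]; exact ih _ _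
    · rw [runningMax_succ_hi hy, runningMax_succ_hi hy]; exact ih _ _

lemma lintegral_runningMax (x : DyadicIndex → ℝ) (k : ℕ) {m : ℝ} (hm : 0 ≤ m) (I : DyadicIndex) :
    ∫⁻ y in I.interval, ENNReal.ofReal (runningMax x k m I y) =
      ENNReal.ofReal (I.length * maxAverage lo hi (fun _ => x) k m I) := by
  induction k generalizing m I with
  | zero =>
    simp only [runningMax, maxAverage]
    rw [setLIntegral_const, I.volume_interval, ENNReal.ofReal_mul I.length_pos.le, mul_comm]
  | succ k ih =>
    have hm' : 0 ≤ max m (x I) := hm.trans (le_max_left _ _)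
    rw [I.lintegral_eq_add, setLIntegral_congr_fun I.lo.measurableSet_interval
      (fun y hy => by rw [runningMax_succ_lo hy]), setLIntegral_congr_fun
      I.hi.measurableSet_interval
      (fun y hy => by rw [runningMax_succ_hi (Set.disjoint_right.1 I.disjoint_lo_hi hy)]),
      ih hm', ih hm', ← ENNReal.ofReal_add
        (mul_nonneg (length_pos _).le (hm'.trans (le_maxAverage _ _ _)))
        (mul_nonneg (length_pos _).le (hm'.trans (le_maxAverage _ _ _))), length_lo, length_hi,
      maxAverage]
    congr 1
    ring

lemma level_le_of_subset {L I : DyadicIndex} (h : L.interval ⊆ I.interval) : I.1 ≤ L.1 := by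
  have h1 := measure_mono (μ := volume) h
  rw [L.volume_interval, I.volume_interval, ENNReal.ofReal_le_ofReal_iff I.length_pos.le, length,
    length, inv_le_inv₀ (by positivity) (by positivity)] at h1
  exact (pow_le_pow_iff_right₀ (by norm_num : (1 : ℝ) < 2)).1 h1

/-- The midpoint of `I` is an integer multiple of the length of the shorter interval `L`, so `L`
cannot straddle it. -/
lemma subset_lo_or_subset_hi {L I : DyadicIndex} (h : L.interval ⊆ I.interval) (hlt : I.1 < L.1) :
    L.interval ⊆ I.lo.interval ∨ L.interval ⊆ I.hi.interval := by
  rw [interval_lo, interval_hi]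
  have hne : (L.2 : ℝ) / 2 ^ L.1 < ((L.2 : ℝ) + 1) / 2 ^ L.1 := by
    have := L.length_eq; linarith [L.length_pos]
  obtain ⟨h1, h2⟩ := (Set.Ico_subset_Ico_iff hne).1 h
  obtain ⟨q, hq⟩ : ∃ q, L.1 = I.1 + 1 + q := ⟨L.1 - (I.1 + 1), by omega⟩
  have hmid : DyadicIndex.midpoint I = ((2 * (I.2 : ℕ) + 1) * 2 ^ q : ℕ) / (2 : ℝ) ^ L.1 := by
    rw [hq, pow_add, pow_succ, DyadicIndex.midpoint]
    push_cast
    field_simp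
  have hp : (0 : ℝ) < 2 ^ L.1 := by positivity
  rcases lt_or_ge (L.2 : ℕ) ((2 * (I.2 : ℕ) + 1) * 2 ^ q) with hlt | hge
  · left
    refine Set.Ico_subset_Ico h1 ?_
    rw [hmid]
    gcongr
    exact_mod_cast hlt
  · right
    refine Set.Ico_subset_Ico ?_ h2
    rw [hmid]
    gcongr

lemma le_runningMax_of_subset (x : DyadicIndex → ℝ) (k : ℕ) (m : ℝ) (I L : DyadicIndex)
    (h : L.interval ⊆ I.interval) (hk : L.1 ≤ I.1 + k) {y : ℝ} (hy : y ∈ L.interval) :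
    x L ≤ runningMax x k m I y := by
  induction k generalizing m I with
  | zero =>
    have hlev : I.1 = L.1 := le_antisymm (level_le_of_subset h) hk
    have : I = L := by
      rcases I with ⟨n, i⟩
      rcases L with ⟨n', j⟩
      obtain rfl : n = n' := hlev
      have hne : ((j : ℕ) : ℝ) / 2 ^ n < (((j : ℕ) : ℝ) + 1) / 2 ^ n := by gcongr; linarith
      obtain ⟨h1, h2⟩ := (Set.Ico_subset_Ico_iff hne).1 h
      rw [div_le_div_iff_of_pos_right (by positivity)] at h1 h2
      have h1' : (i : ℕ) ≤ j := by exact_mod_cast h1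
      have h2' : (j : ℕ) + 1 ≤ i + 1 := by exact_mod_cast h2
      congr 1
      ext
      omega
    rw [← this]
    exact le_max_right _ _
  | succ k ih =>
    rcases (level_le_of_subset h).eq_or_lt with he | hlt
    · exact (ih m I h (by omega)).trans (runningMax_le_succ _ _ _ _ _)
    · rcases subset_lo_or_subset_hi h hlt with h1 | h1
      · rw [runningMax_succ_lo (h1 hy)]
        exact ih _ _ h1 (by simp only [lo]; omega)
      · rw [runningMax_succ_hi (Set.disjoint_right.1 I.disjoint_lo_hi (h1 hy))]
        exact ih _ _ h1 (by simp only [hi]; omega)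

/-- The local maximal function is bounded by the increasing limit of the running maxima of finite
depth, so monotone convergence applies. -/
lemma lintegral_localMaximal_le {w : ℝ → ℝ≥0∞} {x : DyadicIndex → ℝ}
    (hw : ∀ L, scalarAverage L w = ENNReal.ofReal (x L)) (I : DyadicIndex) {C : ℝ}
    (hC : ∀ k, maxAverage lo hi (fun _ => x) k 0 I ≤ C) :
    ∫⁻ y in I.interval, localMaximal w I y ≤ ENNReal.ofReal (I.length * C) := by
  calc ∫⁻ y in I.interval, localMaximal w I y
      ≤ ∫⁻ y in I.interval, ⨆ k, ENNReal.ofReal (runningMax x k 0 I y) := by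
        refine lintegral_mono fun y => ?_
        refine iSup_le fun L => iSup_le fun hL => iSup_le fun hy => ?_
        rw [hw]
        refine le_iSup_of_le L.1 (ENNReal.ofReal_le_ofReal ?_)
        exact le_runningMax_of_subset x L.1 0 I L hL (by omega) hy
    _ = ⨆ k, ∫⁻ y in I.interval, ENNReal.ofReal (runningMax x k 0 I y) := by
        refine lintegral_iSup (fun k => (measurable_runningMax x k 0 I).ennreal_ofReal) ?_
        exact monotone_nat_of_le_succ fun k y =>
          ENNReal.ofReal_le_ofReal (runningMax_le_succ x k 0 I y)
    _ ≤ ENNReal.ofReal (I.length * C) := by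
        refine iSup_le fun k => ?_
        rw [lintegral_runningMax x k le_rfl]
        exact ENNReal.ofReal_le_ofReal (mul_le_mul_of_nonneg_left (hC k) I.length_pos.le)

lemma scalarAInfty_le {w : ℝ → ℝ≥0∞} {x : DyadicIndex → ℝ}
    (hw : ∀ L, scalarAverage L w = ENNReal.ofReal (x L)) {A : ℝ} (hA0 : 0 ≤ A)
    (hA : ∀ k I, maxAverage lo hi (fun _ => x) k 0 I ≤ A * x I) :
    scalarAInfty w ≤ ENNReal.ofReal A := by
  refine sInf_le fun I => ?_
  rw [hw, scalarAverage_eq]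
  refine ENNReal.div_le_of_le_mul ?_
  refine (lintegral_localMaximal_le hw I fun k => hA k I).trans (le_of_eq ?_)
  rw [← ENNReal.ofReal_mul hA0, ENNReal.ofReal_mul I.length_pos.le, mul_comm]

lemma maxAverage_le_of_scalarAInfty {w : ℝ → ℝ≥0∞} {x : DyadicIndex → ℝ} (hx : ∀ L, 0 < x L)
    (hw : ∀ L, scalarAverage L w = ENNReal.ofReal (x L)) {A : ℝ} (hA0 : 0 ≤ A)
    (hA : scalarAInfty w ≤ ENNReal.ofReal A) (k : ℕ) (I : DyadicIndex) :
    maxAverage lo hi (fun _ => x) k 0 I ≤ A * x I := by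
  have hxI : ENNReal.ofReal (x I) ≠ 0 := by simpa using hx I
  have h1 : scalarAverage I (localMaximal w I) ≤ ENNReal.ofReal A * ENNReal.ofReal (x I) := by
    rw [← ENNReal.div_le_iff hxI ENNReal.ofReal_ne_top]
    refine le_trans (le_sInf fun C hC => ?_) hA
    rw [ENNReal.div_le_iff hxI ENNReal.ofReal_ne_top, ← hw]
    exact hC I
  have h2 := ofReal_maxAverage_le_lintegral (x := x) k 0 I (g := localMaximal w I) (by simp)
    (fun L hL y hy => by
      rw [← hw]
      exact le_iSup_of_le L (le_iSup_of_le hL (le_iSup_of_le hy le_rfl)))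
  rw [scalarAverage_eq, ENNReal.div_le_iff (by simpa using I.length_pos) ENNReal.ofReal_ne_top]
    at h1
  have h3 := h2.trans h1
  rw [← ENNReal.ofReal_mul hA0, ← ENNReal.ofReal_mul (mul_nonneg hA0 (hx I).le),
    ENNReal.ofReal_le_ofReal_iff
      (mul_nonneg (mul_nonneg hA0 (hx I).le) I.length_pos.le)] at h3
  rw [mul_comm] at h3
  exact le_of_mul_le_mul_right h3 I.length_pos

lemma IsRegular.scalarAverage_scalarWeight {V : ℝ → Matrix (Fin d) (Fin d) ℂ} (hV : IsRegular V)
    (e : EuclideanSpace ℂ (Fin d)) (I : DyadicIndex) :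
    scalarAverage I (scalarWeight V e) = ENNReal.ofReal (quadForm (matAverage V I) e) := by
  rw [scalarAverage_eq, quadForm_matAverage hV.integrable, I.average_eq, smul_eq_mul,
    ENNReal.ofReal_mul (inv_pos.2 I.length_pos).le, ENNReal.ofReal_inv_of_pos I.length_pos,
    ofReal_integral_eq_lintegral_ofReal
      ((integrableOn_quadForm hV.integrable e).mono_set I.interval_subset)
      ((ae_restrict_interval hV.posDef I).mono fun x hx => quadForm_nonneg hx.posSemidef e),
    mul_comm, ENNReal.div_eq_inv_mul, mul_comm]
  rfl

lemma IsRegular.maxAverage_le {V : ℝ → Matrix (Fin d) (Fin d) ℂ} (hV : IsRegular V) {A : ℝ}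
    (hA0 : 0 ≤ A) (hA : matrixAInfty V ≤ ENNReal.ofReal A) (e : EuclideanSpace ℂ (Fin d)) (k : ℕ)
    (I : DyadicIndex) :
    maxAverage lo hi (fun _ K => quadForm (matAverage V K) e) k 0 I ≤
      A * quadForm (matAverage V I) e := by
  rcases eq_or_ne e 0 with rfl | he
  · have h : ∀ K, quadForm (matAverage V K) 0 = 0 := fun K => by simp [quadForm]
    simp only [h, maxAverage_zero, mul_zero, le_refl]
  · exact maxAverage_le_of_scalarAInfty
      (fun L => quadForm_pos (hV.matAverage_posDef L) he)
      (hV.scalarAverage_scalarWeight e) hA0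
      ((le_iSup (fun e => scalarAInfty (scalarWeight V e)) e).trans hA) k I

lemma IsRegular.one_le_of_matrixAInfty_le (hd : 0 < d) {V : ℝ → Matrix (Fin d) (Fin d) ℂ}
    (hV : IsRegular V) {A : ℝ} (hA0 : 0 ≤ A) (hA : matrixAInfty V ≤ ENNReal.ofReal A) : 1 ≤ A := by
  have he : basisVec (⟨0, hd⟩ : Fin d) ≠ 0 := fun h => by
    simpa [h] using norm_basisVec (⟨0, hd⟩ : Fin d)
  have h1 := hV.maxAverage_le hA0 hA (basisVec ⟨0, hd⟩) 0 root
  have h2 := quadForm_pos (hV.matAverage_posDef root) he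
  rw [maxAverage, max_eq_right h2.le] at h1
  exact le_of_mul_le_mul_right (by linarith) h2

/-! ### The `A_∞` characteristic is dominated by the `A_2` characteristic -/

/-- With `y = ⟨W⟩⁻¹ e`, `t = ⟨e, y⟩` and `s² = ⟨W⁻¹ e, e⟩`, Cauchy–Schwarz gives `⟨W y, y⟩ ≥ t² /
s²` pointwise. The left side has average `t`, and by convexity of `s⁻²` the right side has average
at least `t² / c²`, where `c` is the average of `s`; hence `t ≤ c²`. -/
lemma quadForm_average_inv_le {W : ℝ → Matrix (Fin d) (Fin d) ℂ} (hW : IsRegular W)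
    {e : EuclideanSpace ℂ (Fin d)} (he : e ≠ 0) (I : DyadicIndex)
    (hs : IntegrableOn (fun x => √(quadForm (W x)⁻¹ e)) J) :
    quadForm (matAverage W I)⁻¹ e ≤ (⨍ x in I.interval, √(quadForm (W x)⁻¹ e)) ^ 2 := by
  have hp := hW.matAverage_posDef I
  set y := op (matAverage W I)⁻¹ e with hy
  set t := quadForm (matAverage W I)⁻¹ e with ht
  have ht0 : 0 < t := quadForm_pos hp.inv he
  set c := ⨍ x in I.interval, √(quadForm (W x)⁻¹ e) with hc
  have hc0 : 0 < c := average_pos hs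
    (hW.posDef.mono fun x hx => Real.sqrt_pos.2 (quadForm_pos hx.inv he)) I
  have hty : t = ⨍ x in I.interval, quadForm (W x) y := by
    rw [← quadForm_matAverage hW.integrable, hy, quadForm_inv hp]
  have hyi := integrableOn_quadForm hW.integrable y
  -- The tangent line of `s⁻²` at `s = c`, multiplied by `t² c³`: a linear minorant that can be
  -- integrated directly.
  have hpt : ∀ᵐ x ∂volume.restrict J,
      3 * t ^ 2 * c - 2 * t ^ 2 * √(quadForm (W x)⁻¹ e) ≤ c ^ 3 * quadForm (W x) y := by
    filter_upwards [hW.posDef] with x hx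
    have h1 := norm_inner_sq_le hx e y
    have h2 : t ≤ ‖(inner ℂ e y : ℂ)‖ := RCLike.re_le_norm _
    have h3 : t ^ 2 ≤ quadForm (W x)⁻¹ e * quadForm (W x) y :=
      (pow_le_pow_left₀ ht0.le h2 2).trans h1
    have h4 : 0 ≤ quadForm (W x) y := quadForm_nonneg hx.posSemidef y
    set s := √(quadForm (W x)⁻¹ e) with hs
    have h5 : s ^ 2 = quadForm (W x)⁻¹ e := Real.sq_sqrt (quadForm_nonneg hx.inv.posSemidef e)
    have h6 : 0 ≤ s := Real.sqrt_nonneg _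
    rw [← h5] at h3
    have h7 : (3 * c - 2 * s) * s ^ 2 ≤ c ^ 3 := by
      nlinarith [mul_nonneg (sq_nonneg (c - s)) (by positivity : 0 ≤ c + 2 * s)]
    rcases le_total 0 (3 * c - 2 * s) with h8 | h8
    · have h9 := mul_le_mul_of_nonneg_left h3 h8
      have h10 := mul_le_mul_of_nonneg_right h7 h4
      nlinarith
    · have h9 := mul_nonneg (sq_nonneg t) (neg_nonneg.2 h8)
      have h10 : 0 ≤ c ^ 3 * quadForm (W x) y := by positivity
      nlinarith
  have hconst : IntegrableOn (fun _ : ℝ => 3 * t ^ 2 * c) J := by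
    rw [J]; exact integrableOn_const (by simp)
  have hleft : IntegrableOn (fun x => 3 * t ^ 2 * c - 2 * t ^ 2 * √(quadForm (W x)⁻¹ e)) J :=
    hconst.sub (hs.const_mul _)
  have h := average_mono hleft (hyi.const_mul (c ^ 3)) hpt I
  have hI := I.interval_subset
  rw [I.average_eq, I.average_eq, integral_sub (hconst.mono_set hI)
    ((hs.mono_set hI).const_mul _), setIntegral_const, integral_const_mul, integral_const_mul,
    I.volume_real_interval] at h
  rw [I.average_eq, smul_eq_mul] at hc hty
  simp only [smul_eq_mul] at h
  have hl : I.length⁻¹ * I.length = 1 := inv_mul_cancel₀ I.length_pos.ne'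
  have h1 : 3 * t ^ 2 * c - 2 * t ^ 2 * c ≤ c ^ 3 * t := by
    calc _ = I.length⁻¹ * (I.length * (3 * t ^ 2 * c) -
          2 * t ^ 2 * ∫ x in I.interval, √(quadForm (W x)⁻¹ e)) := by
          linear_combination -(3 * t ^ 2 * c) * hl - (2 * t ^ 2) * hc
      _ ≤ _ := h
      _ = c ^ 3 * t := by linear_combination -(c ^ 3) * hty
  have h2 : 0 < c * t := mul_pos hc0 ht0
  nlinarith

theorem IsRegular.matrixAInfty_inv_le {W : ℝ → Matrix (Fin d) (Fin d) ℂ} (hW : IsRegular W) {Q : ℝ}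
    (hQ : ∀ I, ‖op (CFC.sqrt (matAverage W I) *
      CFC.sqrt (matAverage (fun x => (W x)⁻¹) I))‖ ^ 2 ≤ Q) :
    matrixAInfty (fun x => (W x)⁻¹) ≤ ENNReal.ofReal (4 * Q) := by
  have hV := hW.inv
  have hQ0 : 0 ≤ Q := (sq_nonneg _).trans (hQ root)
  refine iSup_le fun e => scalarAInfty_le (hV.scalarAverage_scalarWeight e) (by positivity) ?_
  intro k I
  set x : DyadicIndex → ℝ := fun K => quadForm (matAverage (fun x => (W x)⁻¹) K) e with hx
  rcases eq_or_ne e 0 with rfl | he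
  · have h : ∀ K, x K = 0 := fun K => by simp [hx, quadForm]
    have h' : x = fun _ => 0 := funext h
    rw [h', maxAverage_zero]
    simp [quadForm]
  have hqi := integrableOn_quadForm hV.integrable e
  have hone : IntegrableOn (fun _ : ℝ => (1 : ℝ)) J := by rw [J]; exact integrableOn_const (by simp)
  have hs : IntegrableOn (fun x => √(quadForm (W x)⁻¹ e)) J := by
    refine (hone.add hqi).mono' (Real.continuous_sqrt.comp_aestronglyMeasurable hqi.1) ?_
    filter_upwards [hV.posDef] with y hy
    have h0 := quadForm_nonneg hy.posSemidef e
    rw [Real.norm_eq_abs, abs_of_nonneg (Real.sqrt_nonneg _)]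
    refine Real.sqrt_le_iff.2 ⟨add_nonneg zero_le_one h0, ?_⟩
    simp only [Pi.add_apply]
    nlinarith
  -- Here `z² ≤ x ≤ Q z²`, so the maximal function of `x` is controlled by that of the martingale
  -- `z`, and Doob's constant in `L²` is 4.
  set z : DyadicIndex → ℝ := fun K => ⨍ x in K.interval, √(quadForm (W x)⁻¹ e) with hz
  have hzm : IsMartingale lo hi z := isMartingale_average hs
  have hz0 : ∀ K, 0 ≤ z K := fun K => (average_pos hs
    (hW.posDef.mono fun x hx => Real.sqrt_pos.2 (quadForm_pos hx.inv he)) K).le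
  have hxm : IsMartingale lo hi x := isMartingale_quadForm hV.integrable e
  have hxp : ∀ K, 0 < x K := fun K => quadForm_pos (hV.matAverage_posDef K) he
  have hxz : ∀ K, x K ≤ Q * z K ^ 2 := by
    intro K
    refine (quadForm_le_norm_sq_mul (hW.matAverage_posDef K)
      (hV.matAverage_posDef K).posSemidef e).trans ?_
    exact mul_le_mul (hQ K) (quadForm_average_inv_le hW he K hs)
      (quadForm_nonneg (hW.matAverage_posDef K).inv.posSemidef e) hQ0
  have hzx : ∀ K, z K ^ 2 ≤ x K := by
    intro K
    have h := average_mul_le_sqrt (a := fun x => √(quadForm (W x)⁻¹ e)) (h := fun _ => 1)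
      hs hqi hone ?_ K (hxp K) one_pos (le_of_eq (quadForm_matAverage hV.integrable K e).symm) ?_
    · rw [Real.one_rpow, mul_one, ← Real.sqrt_eq_rpow] at h
      calc z K ^ 2 ≤ √(x K) ^ 2 := pow_le_pow_left₀ (hz0 K) h 2
        _ = x K := Real.sq_sqrt (hxp K).le
    · filter_upwards [hV.posDef] with y hy
      have h0 := quadForm_nonneg hy.posSemidef e
      exact ⟨h0, zero_le_one, by rw [Real.sq_sqrt h0, mul_one]⟩
    · rw [K.average_eq, setIntegral_const, K.volume_real_interval, smul_eq_mul, smul_eq_mul,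
        mul_one, inv_mul_cancel₀ K.length_pos.ne']
  have hdoob := maxAverage_rpow_le (l := lo) (r := hi) hz0 (p := 2) (by norm_num) k I
  simp only [hzm.leafAverage_eq, Real.rpow_two] at hdoob
  calc maxAverage lo hi (fun _ => x) k 0 I
      ≤ maxAverage lo hi (fun _ K => Q * z K ^ 2) k (Q * 0) I := by
        rw [mul_zero]
        exact maxAverage_mono_right (fun _ K => hxz K) k 0 I
    _ = Q * maxAverage lo hi (fun _ K => z K ^ 2) k 0 I :=
        maxAverage_mul (b := fun _ K => z K ^ 2) hQ0 k 0 I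
    _ ≤ Q * (4 * x I) := by
        refine mul_le_mul_of_nonneg_left (hdoob.trans ?_) hQ0
        have h1 := leafAverage_mono (l := lo) (r := hi) hzx k I
        rw [hxm.leafAverage_eq] at h1
        norm_num
        exact h1
    _ = 4 * Q * x I := by ring

lemma norm_sq_le_toReal_matrixA2 {W : ℝ → Matrix (Fin d) (Fin d) ℂ} (h : matrixA2 W < ∞)
    (I : DyadicIndex) :
    ‖op (CFC.sqrt (matAverage W I) *
      CFC.sqrt (matAverage (fun x => (W x)⁻¹) I))‖ ^ 2 ≤ (matrixA2 W).toReal := by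
  have h1 : ‖op (CFC.sqrt (matAverage W I) *
      CFC.sqrt (matAverage (fun x => (W x)⁻¹) I))‖ₑ ^ 2 ≤ matrixA2 W := by
    unfold matrixA2 at h ⊢
    split_ifs at h ⊢ with hc
    · exact le_iSup (fun I => ‖op (CFC.sqrt (matAverage W I) *
        CFC.sqrt (matAverage (fun x => (W x)⁻¹) I))‖ₑ ^ 2) I
    · exact le_top
  have h2 := ENNReal.toReal_mono h.ne h1
  rwa [ENNReal.toReal_pow, toReal_enorm] at h2

end MatrixWeight

/-! ### Random series with independent signs -/

namespace RandomSeries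

open ProbabilityTheory

variable {Ω : Type*} {mΩ : MeasurableSpace Ω} {μ : Measure Ω}

/-- A sequence of independent, centred random variables with values `±1`. -/
structure IsSignSequence (ξ : ℕ → Ω → ℝ) (μ : Measure Ω) : Prop where
  measurable : ∀ n, Measurable (ξ n)
  indep : iIndepFun ξ μ
  sq_eq_one : ∀ n, ∀ᵐ ω ∂μ, ξ n ω ^ 2 = 1
  integral_eq_zero : ∀ n, ∫ ω, ξ n ω ∂μ = 0

variable {ξ : ℕ → Ω → ℝ}

lemma IsSignSequence.isProbabilityMeasure (hξ : IsSignSequence ξ μ) : IsProbabilityMeasure μ :=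
  hξ.indep.isProbabilityMeasure

lemma IsSignSequence.abs_le_one (hξ : IsSignSequence ξ μ) (n : ℕ) : ∀ᵐ ω ∂μ, ‖ξ n ω‖ ≤ 1 := by
  filter_upwards [hξ.sq_eq_one n] with ω h
  rw [Real.norm_eq_abs, abs_le_one_iff_mul_self_le_one]
  nlinarith

lemma IsSignSequence.integrable (hξ : IsSignSequence ξ μ) (n : ℕ) : Integrable (ξ n) μ := by
  have := hξ.isProbabilityMeasure
  exact Integrable.of_bound (hξ.measurable n).aestronglyMeasurable 1 (hξ.abs_le_one n)

lemma IsSignSequence.integrable_mul (hξ : IsSignSequence ξ μ) (n m : ℕ) :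
    Integrable (fun ω => ξ n ω * ξ m ω) μ := by
  have := hξ.isProbabilityMeasure
  refine Integrable.of_bound ((hξ.measurable n).mul (hξ.measurable m)).aestronglyMeasurable 1 ?_
  filter_upwards [hξ.abs_le_one n, hξ.abs_le_one m] with ω h1 h2
  rw [norm_mul]
  exact mul_le_one₀ h1 (norm_nonneg _) h2

lemma IsSignSequence.integral_mul (hξ : IsSignSequence ξ μ) (n m : ℕ) :
    ∫ ω, ξ n ω * ξ m ω ∂μ = if n = m then 1 else 0 := by
  have := hξ.isProbabilityMeasure
  split_ifs with h
  · subst h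
    rw [integral_congr_ae ((hξ.sq_eq_one n).mono fun ω h => by
      rw [← sq, h])]
    simp
  · have h1 := (hξ.indep.indepFun h).integral_mul_eq_mul_integral
      (hξ.measurable n).aestronglyMeasurable (hξ.measurable m).aestronglyMeasurable
    simp only [Pi.mul_apply] at h1
    rw [h1, hξ.integral_eq_zero, zero_mul]

/-- The signs are orthonormal, so all cross terms vanish in expectation. -/
lemma IsSignSequence.lintegral_norm_sum_sq (𝕜 : Type*) {E : Type*} [RCLike 𝕜]
    [NormedAddCommGroup E] [InnerProductSpace 𝕜 E] [NormedSpace ℝ E] [IsScalarTower ℝ 𝕜 E] (hξ : IsSignSequence ξ μ) (s : Finset ℕ) (b : ℕ → E) :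
    ∫⁻ ω, ‖∑ n ∈ s, ξ n ω • b n‖ₑ ^ 2 ∂μ = ∑ n ∈ s, ‖b n‖ₑ ^ 2 := by
  have hexp : ∀ ω, ‖∑ n ∈ s, ξ n ω • b n‖ ^ 2 =
      ∑ n ∈ s, ∑ m ∈ s, ξ n ω * ξ m ω * RCLike.re (inner 𝕜 (b n) (b m)) := by
    intro ω
    rw [← inner_self_eq_norm_sq (𝕜 := 𝕜), sum_inner, map_sum]
    refine Finset.sum_congr rfl fun n _ => ?_
    rw [inner_sum, map_sum]
    refine Finset.sum_congr rfl fun m _ => ?_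
    rw [← algebraMap_smul 𝕜 (ξ n ω), ← algebraMap_smul 𝕜 (ξ m ω), inner_smul_left,
      inner_smul_right]
    simp [mul_assoc]
  have hint : ∀ n m, Integrable
      (fun ω => ξ n ω * ξ m ω * RCLike.re (inner 𝕜 (b n) (b m))) μ := fun n m =>
    (hξ.integrable_mul n m).mul_const _
  have hfull : Integrable (fun ω => ‖∑ n ∈ s, ξ n ω • b n‖ ^ 2) μ := by
    simp only [hexp]
    exact integrable_finsetSum _ fun n _ => integrable_finsetSum _ fun m _ => hint n m
  have h1 : ∫ ω, ‖∑ n ∈ s, ξ n ω • b n‖ ^ 2 ∂μ = ∑ n ∈ s, ‖b n‖ ^ 2 := by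
    simp only [hexp]
    rw [integral_finsetSum _ fun n _ => integrable_finsetSum _ fun m _ => hint n m]
    refine Finset.sum_congr rfl fun n hn => ?_
    rw [integral_finsetSum _ fun m _ => hint n m]
    simp only [integral_mul_const, hξ.integral_mul]
    simp [hn]
  have h2 := ofReal_integral_eq_lintegral_ofReal hfull (ae_of_all _ fun ω => sq_nonneg _)
  rw [h1] at h2
  simp only [ENNReal.ofReal_pow (norm_nonneg _), ofReal_norm] at h2
  rw [← h2, ENNReal.ofReal_sum_of_nonneg fun _ _ => sq_nonneg _]
  simp only [ENNReal.ofReal_pow (norm_nonneg _), ofReal_norm]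

/-- The partial sums form a martingale bounded in `L²`, hence in `L¹`, and Doob's convergence
theorem applies. -/
lemma IsSignSequence.ae_tendsto_real (hξ : IsSignSequence ξ μ) {r : ℕ → ℝ}
    (hr : ∑' n, ‖r n‖ₑ ^ 2 ≠ ∞) :
    ∀ᵐ ω ∂μ, ∃ v, Tendsto (fun N => ∑ n ∈ Finset.range N, ξ n ω * r n) atTop (𝓝 v) := by
  have := hξ.isProbabilityMeasure
  have hsm : ∀ n, StronglyMeasurable (ξ n) := fun n => (hξ.measurable n).stronglyMeasurable
  -- The range `N + 1` makes `M N` use exactly the signs up to `ξ N`, matching the natural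
  -- filtration at time `N`.
  set M : ℕ → Ω → ℝ := fun N ω => ∑ n ∈ Finset.range (N + 1), ξ n ω * r n with hM
  have hMint : ∀ N, Integrable (M N) μ := fun N =>
    integrable_finsetSum _ fun n _ => (hξ.integrable n).mul_const _
  have hmart : Martingale M (Filtration.natural ξ hsm) μ := by
    refine martingale_of_condExp_sub_eq_zero_nat ?_ hMint fun i => ?_
    · intro N
      refine Finset.stronglyMeasurable_fun_sum _ fun n hn => ?_
      exact ((Filtration.stronglyAdapted_natural hsm).stronglyMeasurable_le
        (Nat.lt_succ_iff.1 (Finset.mem_range.1 hn))).mul_const _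
    · have h1 : M (i + 1) - M i = r (i + 1) • ξ (i + 1) := by
        ext ω
        simp only [hM, Pi.sub_apply, Pi.smul_apply, smul_eq_mul]
        rw [Finset.sum_range_succ _ (i + 1)]
        ring
      rw [h1]
      have h2 := hξ.indep.condExp_natural_ae_eq_of_lt hsm (Nat.lt_succ_self i)
      refine (condExp_smul _ _ _).trans ?_
      filter_upwards [h2] with ω hω
      rw [Pi.smul_apply, hω, hξ.integral_eq_zero]
      simp
  have hbound : ∀ N, eLpNorm (M N) 1 μ ≤ ((∑' n, ‖r n‖ₑ ^ 2) ^ (1 / 2 : ℝ)).toNNReal := by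
    intro N
    rw [ENNReal.coe_toNNReal (ENNReal.rpow_ne_top_of_nonneg (by norm_num) hr)]
    refine (eLpNorm_le_eLpNorm_of_exponent_le (q := 2) (by norm_num)
      (hMint N).1).trans ?_
    rw [eLpNorm_eq_lintegral_rpow_enorm_toReal (by norm_num) (by norm_num)]
    simp only [ENNReal.toReal_ofNat, ENNReal.rpow_ofNat]
    refine ENNReal.rpow_le_rpow ?_ (by norm_num)
    have := IsSignSequence.lintegral_norm_sum_sq ℝ hξ (Finset.range (N + 1)) r
    simp only [smul_eq_mul] at this
    rw [this]
    exact ENNReal.sum_le_tsum _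
  filter_upwards [hmart.submartingale.ae_tendsto_limitProcess hbound] with ω hω
  exact ⟨_, (tendsto_add_atTop_iff_nat 1).1 hω⟩

variable {d : ℕ}

lemma IsSignSequence.ae_tendsto (hξ : IsSignSequence ξ μ) {a : ℕ → EuclideanSpace ℂ (Fin d)}
    (ha : ∑' n, ‖a n‖ₑ ^ 2 ≠ ∞) :
    ∀ᵐ ω ∂μ, ∃ v, Tendsto (fun N => ∑ n ∈ Finset.range N, ξ n ω • a n) atTop (𝓝 v) := by
  have hle : ∀ (r : ℕ → ℝ), (∀ n, ‖r n‖ ≤ ‖a n‖) → ∑' n, ‖r n‖ₑ ^ 2 ≠ ∞ := by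
    intro r hr
    refine ne_top_of_le_ne_top ha (ENNReal.tsum_le_tsum fun n => ?_)
    exact pow_le_pow_left' (enorm_le_iff_norm_le.2 (hr n)) 2
  have h1 : ∀ i, ∀ᵐ ω ∂μ, ∃ v, Tendsto
      (fun N => ∑ n ∈ Finset.range N, ξ n ω * (a n i).re) atTop (𝓝 v) := fun i =>
    hξ.ae_tendsto_real (hle _ fun n => (Complex.abs_re_le_norm _).trans (PiLp.norm_apply_le _ i))
  have h2 : ∀ i, ∀ᵐ ω ∂μ, ∃ v, Tendsto
      (fun N => ∑ n ∈ Finset.range N, ξ n ω * (a n i).im) atTop (𝓝 v) := fun i =>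
    hξ.ae_tendsto_real (hle _ fun n => (Complex.abs_im_le_norm _).trans (PiLp.norm_apply_le _ i))
  filter_upwards [ae_all_iff.2 h1, ae_all_iff.2 h2] with ω hre him
  choose u hu using hre
  choose w hw using him
  have hlim : ∀ i, Tendsto (fun N => ((∑ n ∈ Finset.range N, ξ n ω * (a n i).re : ℝ) : ℂ) +
      ((∑ n ∈ Finset.range N, ξ n ω * (a n i).im : ℝ) : ℂ) * Complex.I) atTop
      (𝓝 ((u i : ℂ) + (w i : ℂ) * Complex.I)) := fun i =>
    ((Complex.continuous_ofReal.tendsto _).comp (hu i)).add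
      (((Complex.continuous_ofReal.tendsto _).comp (hw i)).mul_const _)
  have hsum := tendsto_finsetSum Finset.univ fun i _ =>
    (hlim i).smul_const (MatrixWeight.basisVec i)
  refine ⟨_, hsum.congr fun N => ?_⟩
  ext i
  simp only [MatrixWeight.basisVec, WithLp.ofLp_sum, WithLp.ofLp_smul, Finset.sum_apply,
    Pi.smul_apply, PiLp.single_apply, smul_eq_mul, mul_ite, mul_one, mul_zero, Finset.sum_ite_eq,
    Finset.mem_univ, if_true]
  apply Complex.ext <;> simp [Complex.re_sum, Complex.im_sum]

/-- The second moment of the sum of a random series. -/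
lemma IsSignSequence.lintegral_norm_limit_sq (hξ : IsSignSequence ξ μ)
    {b : ℕ → EuclideanSpace ℂ (Fin d)} (hb : ∑' n, ‖b n‖ₑ ^ 2 ≠ ∞)
    {Y : Ω → EuclideanSpace ℂ (Fin d)}
    (hY : ∀ᵐ ω ∂μ, Tendsto (fun N => ∑ n ∈ Finset.range N, ξ n ω • b n) atTop (𝓝 (Y ω))) :
    ∫⁻ ω, ‖Y ω‖ₑ ^ 2 ∂μ = ∑' n, ‖b n‖ₑ ^ 2 := by
  set S : ℕ → Ω → EuclideanSpace ℂ (Fin d) := fun N ω => ∑ n ∈ Finset.range N, ξ n ω • b n with hS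
  have hSm : ∀ N, Measurable (S N) := fun N =>
    Finset.measurable_fun_sum _ fun n _ => (hξ.measurable n).smul_const _
  have hYm : AEStronglyMeasurable Y μ :=
    aestronglyMeasurable_of_tendsto_ae atTop (fun N => (hSm N).aestronglyMeasurable) hY
  have hLp : ∀ g : Ω → EuclideanSpace ℂ (Fin d),
      eLpNorm g 2 μ = (∫⁻ ω, ‖g ω‖ₑ ^ 2 ∂μ) ^ (1 / 2 : ℝ) := by
    intro g
    rw [eLpNorm_eq_lintegral_rpow_enorm_toReal (by norm_num) (by norm_num)]
    simp only [ENNReal.toReal_ofNat, ENNReal.rpow_ofNat]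
  have hSL : ∀ N, ∫⁻ ω, ‖S N ω‖ₑ ^ 2 ∂μ = ∑ n ∈ Finset.range N, ‖b n‖ₑ ^ 2 := fun N =>
    IsSignSequence.lintegral_norm_sum_sq ℂ hξ (Finset.range N) b
  -- Fatou's lemma upgrades almost sure convergence to convergence in `L²`, with the tail of the
  -- series as rate; the norms then converge too.
  have hdiff : ∀ M, ∫⁻ ω, ‖Y ω - S M ω‖ₑ ^ 2 ∂μ ≤ ∑' n, ‖b (n + M)‖ₑ ^ 2 := by
    intro M
    have hlim : ∀ᵐ ω ∂μ, Tendsto (fun N => ‖S (N + M) ω - S M ω‖ₑ ^ 2) atTop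
        (𝓝 (‖Y ω - S M ω‖ₑ ^ 2)) := by
      filter_upwards [hY] with ω hω
      exact ENNReal.Tendsto.pow
        ((((tendsto_add_atTop_iff_nat M).2 hω).sub_const _).enorm)
    calc ∫⁻ ω, ‖Y ω - S M ω‖ₑ ^ 2 ∂μ
        = ∫⁻ ω, liminf (fun N => ‖S (N + M) ω - S M ω‖ₑ ^ 2) atTop ∂μ :=
          lintegral_congr_ae (hlim.mono fun ω hω => hω.liminf_eq.symm)
      _ ≤ liminf (fun N => ∫⁻ ω, ‖S (N + M) ω - S M ω‖ₑ ^ 2 ∂μ) atTop :=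
          lintegral_liminf_le fun N => ((hSm _).sub (hSm _)).enorm.pow_const 2
      _ ≤ ∑' n, ‖b (n + M)‖ₑ ^ 2 := by
          refine liminf_le_of_frequently_le' (Frequently.of_forall fun N => ?_)
          have h1 : ∀ ω, S (N + M) ω - S M ω = ∑ n ∈ Finset.Ico M (N + M), ξ n ω • b n := by
            intro ω
            rw [Finset.sum_Ico_eq_sub _ (Nat.le_add_left M N)]
          simp only [h1]
          rw [IsSignSequence.lintegral_norm_sum_sq ℂ hξ, Finset.sum_Ico_eq_sum_range]
          simp only [add_comm M]
          exact ENNReal.sum_le_tsum _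
  have htail : Tendsto (fun M => eLpNorm (Y - S M) 2 μ) atTop (𝓝 0) := by
    have h0 : Tendsto (fun M => (∑' n, ‖b (n + M)‖ₑ ^ 2) ^ (1 / 2 : ℝ)) atTop (𝓝 0) := by
      have := (ENNReal.continuous_rpow_const (y := 1 / 2)).tendsto 0 |>.comp
        (ENNReal.tendsto_sum_nat_add (fun n => ‖b n‖ₑ ^ 2) hb)
      rwa [ENNReal.zero_rpow_of_pos (by norm_num)] at this
    refine tendsto_of_tendsto_of_tendsto_of_le_of_le tendsto_const_nhds h0
      (fun _ => zero_le) fun M => ?_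
    rw [hLp]
    exact ENNReal.rpow_le_rpow (hdiff M) (by norm_num)
  have hconv : Tendsto (fun M => eLpNorm (S M) 2 μ) atTop
      (𝓝 ((∑' n, ‖b n‖ₑ ^ 2) ^ (1 / 2 : ℝ))) := by
    simp only [hLp, hSL]
    exact (ENNReal.continuous_rpow_const (y := 1 / 2)).tendsto _ |>.comp
      ENNReal.summable.hasSum.tendsto_sum_nat
  have hle : eLpNorm Y 2 μ ≤ (∑' n, ‖b n‖ₑ ^ 2) ^ (1 / 2 : ℝ) := by
    refine ge_of_tendsto' (by simpa using htail.add hconv) fun M => ?_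
    have := eLpNorm_add_le (p := 2) (hYm.sub (hSm M).aestronglyMeasurable)
      (hSm M).aestronglyMeasurable (by norm_num)
    rwa [sub_add_cancel] at this
  have hge : (∑' n, ‖b n‖ₑ ^ 2) ^ (1 / 2 : ℝ) ≤ eLpNorm Y 2 μ := by
    refine le_of_tendsto_of_tendsto' hconv
      (by simpa using htail.const_add (eLpNorm Y 2 μ)) fun M => ?_
    have := eLpNorm_sub_le (p := 2) hYm (hYm.sub (hSm M).aestronglyMeasurable) (by norm_num)
    rwa [sub_sub_cancel] at this
  have heq := le_antisymm hle hge
  rw [hLp] at heq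
  exact (ENNReal.rpow_left_injective (by norm_num : (1 / 2 : ℝ) ≠ 0)) heq

end RandomSeries

namespace MatrixWeight

open BinaryTree DyadicIndex RandomSeries ProbabilityTheory

variable {d : ℕ}

/-! ### The square function as a sum over Haar coefficients -/

lemma exists_mem_interval (n : ℕ) {x : ℝ} (hx : x ∈ Set.Ico (0 : ℝ) 1) :
    ∃ j : Fin (2 ^ n), x ∈ interval ⟨n, j⟩ := by
  have hp : (0 : ℝ) < 2 ^ n := by positivity
  have h0 : 0 ≤ x * 2 ^ n := mul_nonneg hx.1 hp.le
  have h1 : x * 2 ^ n < 2 ^ n := by nlinarith [hx.2]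
  refine ⟨⟨⌊x * 2 ^ n⌋₊, ?_⟩, ?_, ?_⟩
  · rw [Nat.floor_lt h0]
    exact_mod_cast h1
  · rw [div_le_iff₀ hp]
    exact Nat.floor_le h0
  · rw [lt_div_iff₀ hp]
    exact Nat.lt_floor_add_one _

lemma eq_of_mem_interval {n : ℕ} {i j : Fin (2 ^ n)} {x : ℝ} (hi : x ∈ interval ⟨n, i⟩)
    (hj : x ∈ interval ⟨n, j⟩) : i = j := by
  have hp : (0 : ℝ) < 2 ^ n := by positivity
  have h1 := (div_lt_div_iff_of_pos_right hp).1 (hi.1.trans_lt hj.2)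
  have h2 := (div_lt_div_iff_of_pos_right hp).1 (hj.1.trans_lt hi.2)
  have h1' : (i : ℕ) < j + 1 := by exact_mod_cast h1
  have h2' : (j : ℕ) < i + 1 := by exact_mod_cast h2
  ext
  omega

lemma sum_level_eq {M : Type*} [AddCommMonoid M] {n : ℕ} {j : Fin (2 ^ n)} {x : ℝ}
    (hj : x ∈ interval ⟨n, j⟩) {g : DyadicIndex → M} (hg : ∀ I : DyadicIndex, x ∉ I.interval → g I = 0) :
    ∑ i : Fin (2 ^ n), g ⟨n, i⟩ = g ⟨n, j⟩ :=
  Finset.sum_eq_single j (fun i _ hij => hg _ fun hi => hij (eq_of_mem_interval hi hj)) (by simp)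

lemma integrable_signLaw (g : ℝ → ℝ) : Integrable g signLaw := by
  unfold signLaw
  refine Integrable.add_measure ?_ ?_ <;>
    exact (integrable_dirac (by simp)).smul_measure (by simp)

lemma integral_signLaw (g : ℝ → ℝ) : ∫ s, g s ∂signLaw = (g 1 + g (-1)) / 2 := by
  have h := integrable_signLaw g
  unfold signLaw at h ⊢
  rw [integral_add_measure (h.mono_measure (Measure.le_add_right le_rfl))
    (h.mono_measure (Measure.le_add_left le_rfl)), integral_smul_measure, integral_smul_measure,
    integral_dirac, integral_dirac]
  simp
  ring

lemma ae_signLaw_sq : ∀ᵐ s ∂signLaw, s ^ 2 = 1 := by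
  unfold signLaw
  rw [ae_add_measure_iff]
  constructor <;> refine Measure.ae_smul_measure ?_ _ <;>
    rw [ae_dirac_iff (measurableSet_eq_fun (by fun_prop) (by fun_prop))] <;> norm_num

lemma isSignSequence_signs {I : ℕ → DyadicIndex} (hI : Function.Injective I) :
    IsSignSequence (fun n (σ : DyadicIndex → ℝ) => σ (I n)) signs := by
  have hmap : ∀ n, Measure.map (fun σ : DyadicIndex → ℝ => σ (I n)) signs = signLaw := fun n =>
    Measure.infinitePi_map_eval (fun _ : DyadicIndex => signLaw) (I n)
  have hmeas : ∀ n, Measurable fun σ : DyadicIndex → ℝ => σ (I n) := fun n => measurable_pi_apply _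
  refine ⟨hmeas, ?_, fun n => ?_, fun n => ?_⟩
  · have h : iIndepFun (fun (K : DyadicIndex) (σ : DyadicIndex → ℝ) => σ K) signs :=
      iIndepFun_infinitePi (P := fun _ : DyadicIndex => signLaw) (X := fun _ s => s)
        fun _ => measurable_id
    exact h.precomp hI
  · have h := ae_signLaw_sq
    rw [← hmap n] at h
    exact ae_of_ae_map (hmeas n).aemeasurable h
  · have h := integral_map (μ := signs) (hmeas n).aemeasurable
      (f := fun s : ℝ => s) aestronglyMeasurable_id
    rw [← h, hmap, integral_signLaw]
    norm_num

/-- The sum of the squares of the weighted terms of the Haar series at `x`. -/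
def haarSquareSum (W : ℝ → Matrix (Fin d) (Fin d) ℂ) (f : ℝ → EuclideanSpace ℂ (Fin d))
    (x : ℝ) : ℝ≥0∞ :=
  ∑' I : DyadicIndex, ENNReal.ofReal (I.haar x ^ 2 * quadForm (W x) (haarCoeff f I))

lemma squareFunction_at {W : ℝ → Matrix (Fin d) (Fin d) ℂ} {f : ℝ → EuclideanSpace ℂ (Fin d)} {x : ℝ}
    (hx : x ∈ Set.Ico (0 : ℝ) 1) (hW : (W x).PosDef) (hsum : haarSquareSum W f x ≠ ∞) :
    (∀ᵐ σ ∂signs, ∃ v, Tendsto (fun N => transformPartial σ f N x) atTop (𝓝 v)) ∧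
      squareFunction W f x = haarSquareSum W f x ^ (1 / 2 : ℝ) := by
  choose j hj using fun n => exists_mem_interval n hx
  -- Only one interval per generation contains `x`, so the Haar series at `x` is an ordinary series
  -- with independent signs.
  set I : ℕ → DyadicIndex := fun n => ⟨n, j n⟩ with hI
  have hinj : Function.Injective I := fun n m h => congrArg Sigma.fst h
  have hξ := isSignSequence_signs hinj
  set B := CFC.sqrt (W x)
  set a : ℕ → EuclideanSpace ℂ (Fin d) := fun n => (I n).haar x • haarCoeff f (I n) with ha
  have hpart : ∀ σ N, transformPartial σ f N x = ∑ n ∈ Finset.range N, σ (I n) • a n := by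
    intro σ N
    refine Finset.sum_congr rfl fun n _ => ?_
    rw [sum_level_eq (hj n) (g := fun K => (σ K * K.haar x) • haarCoeff f K)
      (fun K hK => by rw [haar_eq_zero hK, mul_zero, zero_smul]), ha, mul_smul]
  have hq : ∀ n, ‖op B (a n)‖ₑ ^ 2 =
      ENNReal.ofReal ((I n).haar x ^ 2 * quadForm (W x) (haarCoeff f (I n))) := by
    intro n
    rw [ha, (op B).map_smul_of_tower, enorm_smul, mul_pow, enorm_op_sqrt_sq hW.posSemidef,
      ENNReal.ofReal_mul (sq_nonneg _), Real.enorm_eq_ofReal_abs, ← ENNReal.ofReal_pow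
      (abs_nonneg _), sq_abs]
  have hBsum : ∑' n, ‖op B (a n)‖ₑ ^ 2 = haarSquareSum W f x := by
    rw [haarSquareSum, ENNReal.tsum_sigma']
    refine tsum_congr fun n => ?_
    rw [tsum_fintype, sum_level_eq (hj n)
      (g := fun K => ENNReal.ofReal (K.haar x ^ 2 * quadForm (W x) (haarCoeff f K)))
      (fun K hK => by rw [haar_eq_zero hK]; simp), hq]
  -- `W x` is invertible, so summability of the weighted terms gives summability of the unweighted
  -- ones, with the factor `tr((W x)⁻¹)`.
  have hasum : ∑' n, ‖a n‖ₑ ^ 2 ≠ ∞ := by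
    have hc : ∀ n, ‖a n‖ₑ ^ 2 ≤
        ENNReal.ofReal (∑ i, quadForm (W x)⁻¹ (basisVec i)) * ‖op B (a n)‖ₑ ^ 2 := by
      intro n
      rw [enorm_op_sqrt_sq hW.posSemidef, ← ENNReal.ofReal_mul
        (Finset.sum_nonneg fun i _ => quadForm_nonneg hW.inv.posSemidef _), ← ofReal_norm,
        ← ENNReal.ofReal_pow (norm_nonneg _)]
      exact ENNReal.ofReal_le_ofReal (norm_sq_le_sum_quadForm_mul hW _)
    refine ne_top_of_le_ne_top ?_ (ENNReal.tsum_le_tsum hc)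
    rw [ENNReal.tsum_mul_left, hBsum]
    exact ENNReal.mul_ne_top ENNReal.ofReal_ne_top hsum
  have hconv := hξ.ae_tendsto hasum
  refine ⟨hconv.mono fun σ hσ => by simpa only [hpart] using hσ, ?_⟩
  rw [squareFunction, ← hBsum, hξ.lintegral_norm_limit_sq (by rw [hBsum]; exact hsum)
    (Y := fun σ => op B (transform σ f x))]
  filter_upwards [hconv] with σ hσ
  have h1 := tendsto_nhds_limUnder hσ
  have h2 : transform σ f x = limUnder atTop fun N => ∑ n ∈ Finset.range N, σ (I n) • a n := by
    rw [transform]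
    simp only [hpart]
  rw [h2]
  refine (((op B).continuous.tendsto _).comp h1).congr fun N => ?_
  simp only [Function.comp_apply, map_sum, (op B).map_smul_of_tower]

lemma aemeasurable_haarSquareSum {W : ℝ → Matrix (Fin d) (Fin d) ℂ} (hW : EntrywiseIntegrable W)
    (f : ℝ → EuclideanSpace ℂ (Fin d)) : AEMeasurable (haarSquareSum W f) (volume.restrict J) := by
  refine AEMeasurable.tsum fun I => ?_
  exact ((I.measurable_haar.pow_const 2).aemeasurable.mul
    (integrableOn_quadForm hW _).1.aemeasurable).ennreal_ofReal

/-- Tonelli, with the square of `h_I` equal to the indicator of `I` over its length: integration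
turns `W x` into `⟨W⟩_I`. -/
lemma IsRegular.lintegral_haarSquareSum {W : ℝ → Matrix (Fin d) (Fin d) ℂ} (hW : IsRegular W)
    (f : ℝ → EuclideanSpace ℂ (Fin d)) :
    ∫⁻ x in J, haarSquareSum W f x =
      ∑' I, ENNReal.ofReal (quadForm (matAverage W I) (haarCoeff f I)) := by
  unfold haarSquareSum
  rw [lintegral_tsum fun I => ((I.measurable_haar.pow_const 2).aemeasurable.mul
    (integrableOn_quadForm hW.integrable _).1.aemeasurable).ennreal_ofReal]
  refine tsum_congr fun I => ?_
  have h1 : ∀ x, ENNReal.ofReal (I.haar x ^ 2 * quadForm (W x) (haarCoeff f I)) =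
      I.interval.indicator
        (fun x => ENNReal.ofReal (I.length⁻¹ * quadForm (W x) (haarCoeff f I))) x := by
    intro x
    rw [haar_sq]
    by_cases hx : x ∈ I.interval <;> simp [hx]
  simp only [h1]
  have hint := (integrableOn_quadForm hW.integrable (haarCoeff f I)).mono_set I.interval_subset
  rw [setLIntegral_indicator I.measurableSet_interval, Set.inter_eq_left.2 I.interval_subset,
    ← ofReal_integral_eq_lintegral_ofReal (hint.const_mul _)
      ((ae_restrict_interval hW.posDef I).mono fun x hx =>
        mul_nonneg (inv_pos.2 I.length_pos).le (quadForm_nonneg hx.posSemidef _)),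
    integral_const_mul, quadForm_matAverage hW.integrable, I.average_eq, smul_eq_mul]

lemma ae_mem_Ico : ∀ᵐ x ∂volume.restrict J, x ∈ Set.Ico (0 : ℝ) 1 := by
  rw [restrict_J, interval_root]
  exact ae_restrict_mem measurableSet_Ico

lemma IsRegular.squareFunction_ae {W : ℝ → Matrix (Fin d) (Fin d) ℂ} (hW : IsRegular W)
    {f : ℝ → EuclideanSpace ℂ (Fin d)}
    (hsum : ∑' I, ENNReal.ofReal (quadForm (matAverage W I) (haarCoeff f I)) ≠ ∞) :
    ∀ᵐ x ∂volume.restrict J,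
      (∀ᵐ σ ∂signs, ∃ v, Tendsto (fun N => transformPartial σ f N x) atTop (𝓝 v)) ∧
        squareFunction W f x = haarSquareSum W f x ^ (1 / 2 : ℝ) := by
  have hfin : ∀ᵐ x ∂volume.restrict J, haarSquareSum W f x < ∞ :=
    ae_lt_top' (aemeasurable_haarSquareSum hW.integrable f)
      (by rw [hW.lintegral_haarSquareSum]; exact hsum)
  filter_upwards [hfin, hW.posDef, ae_mem_Ico] with x h1 h2 h3
  exact squareFunction_at h3 h2 h1.ne

/-- The norm of the square function is the sum of the weighted Haar coefficients. -/
lemma IsRegular.l2Norm_squareFunction {W : ℝ → Matrix (Fin d) (Fin d) ℂ} (hW : IsRegular W)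
    {f : ℝ → EuclideanSpace ℂ (Fin d)}
    (hsum : ∑' I, ENNReal.ofReal (quadForm (matAverage W I) (haarCoeff f I)) ≠ ∞) :
    l2Norm (squareFunction W f) =
      (∑' I, ENNReal.ofReal (quadForm (matAverage W I) (haarCoeff f I))) ^ (1 / 2 : ℝ) := by
  rw [l2Norm, ← hW.lintegral_haarSquareSum]
  congr 1
  refine lintegral_congr_ae ((hW.squareFunction_ae hsum).mono fun x hx => ?_)
  simp only
  rw [hx.2, ← ENNReal.rpow_natCast, ← ENNReal.rpow_mul]
  norm_num

lemma tsum_dyadicIndex_le {g : DyadicIndex → ℝ} (hg : ∀ I, 0 ≤ g I) {C : ℝ}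
    (h : ∀ N, ∑ n ∈ Finset.range N, ∑ j : Fin (2 ^ n), g ⟨n, j⟩ ≤ C) :
    ∑' I, ENNReal.ofReal (g I) ≤ ENNReal.ofReal C := by
  rw [ENNReal.tsum_sigma', ENNReal.tsum_eq_iSup_nat]
  refine iSup_le fun N => ?_
  simp only [tsum_fintype]
  refine le_trans (le_of_eq ?_) (ENNReal.ofReal_le_ofReal (h N))
  rw [ENNReal.ofReal_sum_of_nonneg fun n _ => Finset.sum_nonneg fun j _ => hg _]
  exact Finset.sum_congr rfl fun n _ => (ENNReal.ofReal_sum_of_nonneg fun j _ => hg _).symm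


/-! ### The upper bounds -/

lemma IsRegular.matrixAInfty_inv_le_matrixA2 {W : ℝ → Matrix (Fin d) (Fin d) ℂ} (hW : IsRegular W)
    (h : matrixA2 W < ∞) : matrixAInfty (fun x => (W x)⁻¹) ≤ 4 * matrixA2 W := by
  refine (hW.matrixAInfty_inv_le (norm_sq_le_toReal_matrixA2 h)).trans (le_of_eq ?_)
  rw [ENNReal.ofReal_mul (by norm_num), ENNReal.ofReal_toReal h.ne]
  norm_num

theorem IsRegular.tsum_haarCoeff_le {W : ℝ → Matrix (Fin d) (Fin d) ℂ} (hW : IsRegular W)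
    (h : matrixA2 W < ∞) {f : ℝ → EuclideanSpace ℂ (Fin d)} (hf : MemWeightedL2 W f) :
    ∑' I, ENNReal.ofReal (quadForm (matAverage W I) (haarCoeff f I)) ≤
      ENNReal.ofReal (40960 * d ^ 2) * matrixA2 W * matrixAInfty (fun x => (W x)⁻¹) *
        weightedNorm W f ^ 2 := by
  -- In dimension 0 there is no nonzero vector to force `A ≥ 1`; both sides of the estimate are
  -- trivial.
  rcases Nat.eq_zero_or_pos d with rfl | hd
  · have h0 : ∀ I, quadForm (matAverage W I) (haarCoeff f I) = 0 := fun I => by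
      simp [quadForm_eq_sum]
    simp [h0]
  have hAtop : matrixAInfty (fun x => (W x)⁻¹) ≠ ∞ :=
    ne_top_of_le_ne_top (ENNReal.mul_ne_top (by norm_num) h.ne) (hW.matrixAInfty_inv_le_matrixA2 h)
  set A := (matrixAInfty fun x => (W x)⁻¹).toReal with hA
  have hA0 : 0 ≤ A := ENNReal.toReal_nonneg
  have hA' : matrixAInfty (fun x => (W x)⁻¹) ≤ ENNReal.ofReal A := by
    rw [hA, ENNReal.ofReal_toReal hAtop]
  have h1 := tsum_dyadicIndex_le
    (g := fun I => ‖op (CFC.sqrt (matAverage W I)) (haarCoeff f I)‖ ^ 2) (fun I => sq_nonneg _)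
    (sum_norm_op_haarCoeff_sq_le hd hW (norm_sq_le_toReal_matrixA2 h)
      (hW.inv.one_le_of_matrixAInfty_le hd hA0 hA') (hW.inv.maxAverage_le hA0 hA') hf)
  simp only [← quadForm_eq_norm_sq (hW.matAverage_posDef _).posSemidef] at h1
  refine h1.trans (le_of_eq ?_)
  rw [ENNReal.ofReal_mul (by positivity), ENNReal.ofReal_mul (by positivity),
    ENNReal.ofReal_mul (by positivity), hW.ofReal_integral_quadForm hf, hA,
    ENNReal.ofReal_toReal h.ne, ENNReal.ofReal_toReal hAtop]

theorem IsRegular.tsum_haarCoeff_ne_top {W : ℝ → Matrix (Fin d) (Fin d) ℂ} (hW : IsRegular W)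
    (h : matrixA2 W < ∞) {f : ℝ → EuclideanSpace ℂ (Fin d)} (hf : MemWeightedL2 W f) :
    ∑' I, ENNReal.ofReal (quadForm (matAverage W I) (haarCoeff f I)) ≠ ∞ := by
  refine ne_top_of_le_ne_top ?_ (hW.tsum_haarCoeff_le h hf)
  refine ENNReal.mul_ne_top (ENNReal.mul_ne_top (ENNReal.mul_ne_top ENNReal.ofReal_ne_top h.ne) ?_)
    (ENNReal.pow_ne_top hf.2.ne)
  exact ne_top_of_le_ne_top (ENNReal.mul_ne_top (by norm_num) h.ne)
    (hW.matrixAInfty_inv_le_matrixA2 h)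

theorem IsRegular.mapsToL2 {W : ℝ → Matrix (Fin d) (Fin d) ℂ} (hW : IsRegular W)
    (h : matrixA2 W < ∞) : MapsToL2 W := by
  intro f hf
  have hsum := hW.tsum_haarCoeff_ne_top h hf
  have hae := hW.squareFunction_ae hsum
  refine ⟨hae.mono fun x hx => hx.1, ?_, ?_⟩
  · exact ((aemeasurable_haarSquareSum hW.integrable f).pow_const (1 / 2 : ℝ)).congr
      (hae.mono fun x hx => hx.2.symm)
  · rw [hW.l2Norm_squareFunction hsum]
    exact ENNReal.rpow_lt_top_of_nonneg (by norm_num) hsum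

lemma sq_rpow_half (a : ℝ≥0∞) : (a ^ 2) ^ (1 / 2 : ℝ) = a := by
  rw [← ENNReal.rpow_natCast, ← ENNReal.rpow_mul]
  norm_num

theorem IsRegular.squareFunctionNorm_le {W : ℝ → Matrix (Fin d) (Fin d) ℂ} (hW : IsRegular W)
    (h : matrixA2 W < ∞) :
    squareFunctionNorm W ≤ (203 * d : ℝ≥0) *
      (matrixA2 W ^ (1 / 2 : ℝ) * matrixAInfty (fun x => (W x)⁻¹) ^ (1 / 2 : ℝ)) := by
  refine sInf_le fun f hf => ?_
  rw [hW.l2Norm_squareFunction (hW.tsum_haarCoeff_ne_top h hf)]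
  refine (ENNReal.rpow_le_rpow (hW.tsum_haarCoeff_le h hf) (by norm_num)).trans ?_
  rw [ENNReal.mul_rpow_of_nonneg _ _ (by norm_num), ENNReal.mul_rpow_of_nonneg _ _ (by norm_num),
    ENNReal.mul_rpow_of_nonneg _ _ (by norm_num), sq_rpow_half, mul_assoc (_ ^ (1 / 2 : ℝ))]
  gcongr
  -- `203² = 41209` exceeds `40960 = 10240 · 4`.
  have hc : ENNReal.ofReal (40960 * d ^ 2) ≤ ((203 * d : ℝ≥0) : ℝ≥0∞) ^ 2 := by
    rw [← ENNReal.ofReal_coe_nnreal, ← ENNReal.ofReal_pow NNReal.zero_le_coe]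
    refine ENNReal.ofReal_le_ofReal ?_
    push_cast
    nlinarith [sq_nonneg (d : ℝ)]
  exact (ENNReal.rpow_le_rpow hc (by norm_num)).trans (sq_rpow_half _).le

theorem IsRegular.mixed_le_linear {W : ℝ → Matrix (Fin d) (Fin d) ℂ} (hW : IsRegular W)
    (h : matrixA2 W < ∞) :
    matrixA2 W ^ (1 / 2 : ℝ) * matrixAInfty (fun x => (W x)⁻¹) ^ (1 / 2 : ℝ) ≤
      (2 : ℝ≥0) * matrixA2 W := by
  rw [← ENNReal.mul_rpow_of_nonneg _ _ (by norm_num)]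
  have h1 : matrixA2 W * matrixAInfty (fun x => (W x)⁻¹) ≤ ((2 : ℝ≥0) * matrixA2 W) ^ 2 := by
    calc _ ≤ matrixA2 W * (4 * matrixA2 W) := by gcongr; exact hW.matrixAInfty_inv_le_matrixA2 h
      _ = ((2 : ℝ≥0) * matrixA2 W) ^ 2 := by
        rw [mul_pow]
        push_cast
        norm_num
        ring
  exact (ENNReal.rpow_le_rpow h1 (by norm_num)).trans (sq_rpow_half _).le

/-! ### Geometric step functions -/

/-- The dyadic interval `[0, 2 ^ (-n))`. -/
def DyadicIndex.corner (n : ℕ) : DyadicIndex := ⟨n, ⟨0, by positivity⟩⟩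

lemma interval_corner (n : ℕ) : (corner n).interval = Set.Ico (0 : ℝ) (2 ^ n)⁻¹ := by
  simp [interval, corner]

lemma lo_corner (n : ℕ) : (corner n).lo = corner (n + 1) := by
  simp [lo, corner]

lemma interval_hi_corner (n : ℕ) :
    (corner n).hi.interval = Set.Ico ((2 : ℝ) ^ (n + 1))⁻¹ (2 ^ n)⁻¹ := by
  simp only [interval, hi, corner]
  congr 1
  · simp
  · rw [pow_succ]; push_cast; field_simp; norm_num

lemma length_corner (n : ℕ) : (corner n).length = (2 ^ n)⁻¹ := rfl

lemma corner_injective : Function.Injective corner := fun _ _ h => congrArg Sigma.fst h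

/-- The number `k` with `2 ^ (-k - 1) ≤ x < 2 ^ (-k)`. -/
def level (x : ℝ) : ℕ := (-(Int.log 2 x) - 1).toNat

lemma level_eq {k : ℕ} {x : ℝ} (hx : x ∈ Set.Ico ((2 : ℝ) ^ (k + 1))⁻¹ (2 ^ k)⁻¹) :
    level x = k := by
  have hx0 : 0 < x := lt_of_lt_of_le (by positivity) hx.1
  have h1 : (-(k + 1 : ℕ) : ℤ) ≤ Int.log 2 x := by
    rw [← Int.zpow_le_iff_le_log (by norm_num) hx0, zpow_neg, zpow_natCast]
    exact_mod_cast hx.1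
  have h2 : Int.log 2 x < (-(k : ℕ) : ℤ) := by
    rw [← Int.lt_zpow_iff_log_lt (by norm_num) hx0, zpow_neg, zpow_natCast]
    exact_mod_cast hx.2
  unfold level
  push_cast at h1
  omega

lemma iUnion_hi_corner (n : ℕ) :
    ⋃ k, (corner (n + k)).hi.interval = Set.Ioo (0 : ℝ) (2 ^ n)⁻¹ := by
  ext x
  simp only [Set.mem_iUnion, interval_hi_corner]
  constructor
  · rintro ⟨k, h1, h2⟩
    refine ⟨lt_of_lt_of_le (by positivity) h1, h2.trans_le ?_⟩
    gcongr
    · norm_num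
    · omega
  · rintro ⟨h0, h1⟩
    have h2 : Int.log 2 x < (-(n : ℕ) : ℤ) := by
      rw [← Int.lt_zpow_iff_log_lt (by norm_num) h0, zpow_neg, zpow_natCast]
      exact_mod_cast h1
    obtain ⟨k, hk⟩ : ∃ k : ℕ, Int.log 2 x = -((n + k + 1 : ℕ) : ℤ) :=
      ⟨(-(Int.log 2 x) - 1 - n).toNat, by push_cast; omega⟩
    refine ⟨k, ?_, ?_⟩
    · have := (Int.zpow_le_iff_le_log (b := 2) (by norm_num) h0).2 hk.ge
      rw [zpow_neg, zpow_natCast] at this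
      exact_mod_cast this
    · have := (Int.lt_zpow_iff_log_lt (b := 2) (x := -((n + k : ℕ) : ℤ)) (by norm_num) h0).2
        (by rw [hk]; push_cast; omega)
      rw [zpow_neg, zpow_natCast] at this
      exact_mod_cast this

lemma setIntegral_pow_level (r : ℝ) (k : ℕ) :
    IntegrableOn (fun x => r ^ level x) (corner k).hi.interval ∧
      ∫ x in (corner k).hi.interval, r ^ level x = (2 ^ (k + 1))⁻¹ * r ^ k := by
  have hc : Set.EqOn (fun x => r ^ level x) (fun _ => r ^ k) (corner k).hi.interval := by
    intro x hx
    rw [interval_hi_corner] at hx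
    simp only [level_eq hx]
  constructor
  · refine IntegrableOn.congr_fun (integrableOn_const ?_) hc.symm (measurableSet_interval _)
    exact volume_interval_ne_top _
  · rw [setIntegral_congr_fun (measurableSet_interval _) hc, setIntegral_const,
      volume_real_interval, smul_eq_mul]
    rfl

/-- Summing over the steps below `2 ^ (-n)` gives a geometric series of ratio `r / 2`; this is where
`r < 2` is needed. -/
lemma pow_level_corner {r : ℝ} (hr0 : 0 ≤ r) (hr2 : r < 2) (n : ℕ) :
    IntegrableOn (fun x => r ^ level x) (corner n).interval ∧
      ⨍ x in (corner n).interval, r ^ level x = r ^ n / (2 - r) := by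
  have hdisj : Pairwise (Function.onFun Disjoint fun k => (corner (n + k)).hi.interval) := by
    intro k k' hk
    rw [Function.onFun, Set.disjoint_left]
    intro x h1 h2
    rw [interval_hi_corner] at h1 h2
    have := (level_eq h1).symm.trans (level_eq h2)
    omega
  have hgeom : HasSum (fun k : ℕ => (2 ^ (n + k + 1))⁻¹ * r ^ (n + k))
      ((2 ^ n)⁻¹ * r ^ n / (2 - r)) := by
    have h1 := (hasSum_geometric_of_lt_one (r := r / 2) (by positivity) (by linarith)).mul_left
      ((2 ^ n)⁻¹ * r ^ n / 2)
    have e : (2 ^ n)⁻¹ * r ^ n / 2 * (1 - r / 2)⁻¹ = (2 ^ n)⁻¹ * r ^ n / (2 - r) := by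
      have : (2 - r) ≠ 0 := by linarith
      have h' : 1 - r / 2 = (2 - r) / 2 := by ring
      rw [h']
      field_simp
    rw [e] at h1
    refine h1.congr_fun fun k => ?_
    rw [pow_succ, pow_add, pow_add, div_pow]
    field_simp
  have hnorm : ∀ k, ∫ x in (corner (n + k)).hi.interval, ‖r ^ level x‖ =
      (2 ^ (n + k + 1))⁻¹ * r ^ (n + k) := by
    intro k
    rw [← (setIntegral_pow_level r (n + k)).2]
    refine integral_congr_ae (ae_of_all _ fun x => ?_)
    simp only [Real.norm_eq_abs, abs_of_nonneg (pow_nonneg hr0 _)]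
  have hint : IntegrableOn (fun x => r ^ level x) (⋃ k, (corner (n + k)).hi.interval) := by
    refine integrableOn_iUnion_of_summable_integral_norm
      (fun k => (setIntegral_pow_level r (n + k)).1) ?_
    simp only [hnorm]
    exact hgeom.summable
  have hsum := hasSum_integral_iUnion (fun k => measurableSet_interval _) hdisj hint
  simp only [(setIntegral_pow_level r _).2] at hsum
  have hval := hsum.unique hgeom
  rw [iUnion_hi_corner] at hint hval
  rw [DyadicIndex.average_eq, interval_corner, length_corner, integrableOn_Ico_iff_integrableOn_Ioo,
    integral_Ico_eq_integral_Ioo, hval]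
  refine ⟨hint, ?_⟩
  rw [smul_eq_mul]
  have : (2 - r) ≠ 0 := by linarith
  field_simp

lemma integrableOn_pow_level {r : ℝ} (hr0 : 0 ≤ r) (hr2 : r < 2) :
    IntegrableOn (fun x => r ^ level x) J := by
  have h := (pow_level_corner hr0 hr2 0).1
  rw [IntegrableOn, restrict_J]
  exact h

lemma average_pow_level_hi_corner (r : ℝ) (k : ℕ) :
    ⨍ x in (corner k).hi.interval, r ^ level x = r ^ k := by
  rw [DyadicIndex.average_eq, (setIntegral_pow_level r k).2, smul_eq_mul]
  change ((2 ^ (k + 1))⁻¹)⁻¹ * _ = _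
  field_simp

/-- An interval not touching the origin lies in a single step, located by the binary length of its
index. The same `k` serves every `r`, so a weight and its inverse have reciprocal averages there. -/
lemma average_pow_level_of_ne (I : DyadicIndex) (hI : (I.2 : ℕ) ≠ 0) :
    ∃ k, ∀ r : ℝ, ⨍ x in I.interval, r ^ level x = r ^ k := by
  obtain ⟨n, j⟩ := I
  set m := Nat.log 2 j with hm
  have h1 : 2 ^ m ≤ (j : ℕ) := Nat.pow_log_le_self 2 hI
  have h2 : (j : ℕ) < 2 ^ (m + 1) := Nat.lt_pow_succ_log_self (by norm_num) _
  have h3 : m < n := by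
    have := h1.trans_lt j.2
    exact (Nat.pow_lt_pow_iff_right (by norm_num)).1 this
  obtain ⟨k, hk⟩ : ∃ k, n = m + 1 + k := ⟨n - (m + 1), by omega⟩
  refine ⟨k, fun r => ?_⟩
  have hc : Set.EqOn (fun x => r ^ level x) (fun _ => r ^ k)
      (interval ⟨n, j⟩) := by
    intro x hx
    have hp : (0 : ℝ) < 2 ^ n := by positivity
    have e1 : (2 : ℝ) ^ n = 2 ^ (k + 1) * 2 ^ m := by rw [hk]; ring
    have e2 : (2 : ℝ) ^ n = 2 ^ k * 2 ^ (m + 1) := by rw [hk]; ring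
    have h1' : (2 : ℝ) ^ m ≤ (j : ℕ) := by exact_mod_cast h1
    have h2' : ((j : ℕ) : ℝ) + 1 ≤ 2 ^ (m + 1) := by exact_mod_cast h2
    have hlev : level x = k := by
      refine level_eq ⟨le_trans ?_ hx.1, lt_of_lt_of_le hx.2 ?_⟩
      · rw [le_div_iff₀ hp, e1, inv_mul_cancel_left₀ (by positivity)]
        exact h1'
      · rw [div_le_iff₀ hp, e2, inv_mul_cancel_left₀ (by positivity)]
        exact h2'
    simp only [hlev]
  rw [DyadicIndex.average_eq, setIntegral_congr_fun (measurableSet_interval _) hc,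
    setIntegral_const, volume_real_interval, smul_smul, inv_mul_cancel₀ (length_pos _).ne',
    one_smul]

/-! ### Scalar multiples of the identity matrix -/

/-- The matrix `a • 1` for a real scalar `a`. -/
def scalarMatrix (d : ℕ) (a : ℝ) : Matrix (Fin d) (Fin d) ℂ := (a : ℂ) • 1

lemma scalarMatrix_mul (a b : ℝ) :
    scalarMatrix d a * scalarMatrix d b = scalarMatrix d (a * b) := by
  simp only [scalarMatrix, smul_mul_smul_comm, mul_one, ← Complex.ofReal_mul]

lemma scalarMatrix_inv {a : ℝ} (ha : a ≠ 0) : (scalarMatrix d a)⁻¹ = scalarMatrix d a⁻¹ := by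
  refine Matrix.inv_eq_right_inv ?_
  rw [scalarMatrix_mul, mul_inv_cancel₀ ha]
  simp [scalarMatrix]

lemma posSemidef_scalarMatrix {a : ℝ} (ha : 0 ≤ a) : (scalarMatrix d a).PosSemidef :=
  Matrix.PosSemidef.one.smul (by exact_mod_cast ha)

lemma isUnit_scalarMatrix {a : ℝ} (ha : a ≠ 0) : IsUnit (scalarMatrix d a) :=
  IsUnit.of_mul_eq_one (scalarMatrix d a⁻¹)
    (by rw [scalarMatrix_mul, mul_inv_cancel₀ ha]; simp [scalarMatrix])

lemma sqrt_scalarMatrix {a : ℝ} (ha : 0 ≤ a) :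
    CFC.sqrt (scalarMatrix d a) = scalarMatrix d (√a) :=
  CFC.sqrt_unique (by rw [scalarMatrix_mul, Real.mul_self_sqrt ha])
    (posSemidef_scalarMatrix (Real.sqrt_nonneg a)).nonneg

lemma op_scalarMatrix (a : ℝ) : op (scalarMatrix d a) = (a : ℂ) • (1 : _ →L[ℂ] _) := by
  rw [op, scalarMatrix, map_smul, map_one]

lemma quadForm_scalarMatrix (a : ℝ) (z : EuclideanSpace ℂ (Fin d)) :
    quadForm (scalarMatrix d a) z = a * ‖z‖ ^ 2 := by
  rw [quadForm, op_scalarMatrix, smul_apply, inner_smul_right, one_apply_eq_self,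
    inner_self_eq_norm_sq_to_K]
  change ((a : ℂ) * ((‖z‖ : ℝ) : ℂ) ^ 2).re = _
  rw [← Complex.ofReal_pow, ← Complex.ofReal_mul, Complex.ofReal_re]

lemma enorm_op_sqrt_scalarMatrix (hd : 0 < d) {a b : ℝ} (ha : 0 ≤ a) (hb : 0 ≤ b) :
    ‖op (CFC.sqrt (scalarMatrix d a) * CFC.sqrt (scalarMatrix d b))‖ₑ ^ 2 =
      ENNReal.ofReal (a * b) := by
  have : Nonempty (Fin d) := ⟨⟨0, hd⟩⟩
  have : Nontrivial (EuclideanSpace ℂ (Fin d)) := inferInstance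
  rw [sqrt_scalarMatrix ha, sqrt_scalarMatrix hb, scalarMatrix_mul, op_scalarMatrix, ← ofReal_norm,
    norm_smul, ContinuousLinearMap.one_def, ContinuousLinearMap.norm_id, mul_one,
    Complex.norm_real, Real.norm_eq_abs, abs_of_nonneg (by positivity),
    ← ENNReal.ofReal_pow (by positivity), mul_pow, Real.sq_sqrt ha, Real.sq_sqrt hb]

lemma entrywiseIntegrable_scalarMatrix {w : ℝ → ℝ} (hw : IntegrableOn w J) :
    EntrywiseIntegrable fun x => scalarMatrix d (w x) := by
  intro i j
  simp only [scalarMatrix, Matrix.smul_apply, smul_eq_mul]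
  exact hw.ofReal.mul_const _

lemma matAverage_scalarMatrix (w : ℝ → ℝ) (I : DyadicIndex) :
    matAverage (fun x => scalarMatrix d (w x)) I = scalarMatrix d (⨍ x in I.interval, w x) := by
  ext i j
  simp only [matAverage, Matrix.of_apply, scalarMatrix, Matrix.smul_apply, smul_eq_mul]
  rw [I.average_eq, I.average_eq, integral_mul_const, integral_complex_ofReal]
  simp [mul_assoc]

/-! ### The extremal weights -/

/-- The weight `ρ ^ (-k)` on `[2 ^ (-k - 1), 2 ^ (-k))`, times the identity. -/
def stepWeight (d : ℕ) (ρ : ℝ) (x : ℝ) : Matrix (Fin d) (Fin d) ℂ :=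
  scalarMatrix d (ρ⁻¹ ^ level x)

lemma stepWeight_inv {ρ : ℝ} (hρ : 0 < ρ) (x : ℝ) :
    (stepWeight d ρ x)⁻¹ = scalarMatrix d (ρ ^ level x) := by
  rw [stepWeight, scalarMatrix_inv (by positivity), inv_pow, inv_inv]

lemma isMatrixWeight_stepWeight {ρ : ℝ} (hρ : 1 ≤ ρ) : IsMatrixWeight (stepWeight d ρ) where
  integrable := entrywiseIntegrable_scalarMatrix (integrableOn_pow_level (by positivity)
    ((inv_le_one_of_one_le₀ hρ).trans_lt (by norm_num)))
  posSemidef := ae_of_all _ fun x => posSemidef_scalarMatrix (by positivity)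

/-- The product of averages is `ρ / ((2 - ρ)(2ρ - 1))` on every interval at the origin, by
self-similarity, and 1 on all others. -/
lemma matrixA2_stepWeight (hd : 0 < d) {ρ t : ℝ} (hρ1 : 1 ≤ ρ) (hρ2 : ρ < 2) (ht : 1 ≤ t)
    (h : (2 - ρ) * (2 * ρ - 1) * t = ρ) : matrixA2 (stepWeight d ρ) = ENNReal.ofReal t := by
  have hρ0 : 0 < ρ := by linarith
  have hi2 : ρ⁻¹ < 2 := (inv_le_one_of_one_le₀ hρ1).trans_lt (by norm_num)
  have hi0 : 0 ≤ ρ⁻¹ := by positivity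
  have hinv : (fun x => (stepWeight d ρ x)⁻¹) = fun x => scalarMatrix d (ρ ^ level x) :=
    funext fun x => stepWeight_inv hρ0 x
  have hcond : (∀ᵐ x ∂volume.restrict J, IsUnit (stepWeight d ρ x)) ∧
      EntrywiseIntegrable fun x => (stepWeight d ρ x)⁻¹ := by
    refine ⟨ae_of_all _ fun x => isUnit_scalarMatrix (by positivity), ?_⟩
    rw [hinv]
    exact entrywiseIntegrable_scalarMatrix (integrableOn_pow_level hρ0.le hρ2)
  rw [matrixA2, if_pos hcond, hinv]
  have hterm : ∀ I : DyadicIndex, ‖op (CFC.sqrt (matAverage (stepWeight d ρ) I) *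
      CFC.sqrt (matAverage (fun x => scalarMatrix d (ρ ^ level x)) I))‖ₑ ^ 2 =
        if (I.2 : ℕ) = 0 then ENNReal.ofReal t else 1 := by
    intro I
    rw [matAverage_scalarMatrix, show stepWeight d ρ = fun x => scalarMatrix d (ρ⁻¹ ^ level x)
      from rfl, matAverage_scalarMatrix]
    split_ifs with hI
    · obtain ⟨n, j⟩ := I
      have hj : (⟨n, j⟩ : DyadicIndex) = corner n := by
        unfold corner
        congr 1
        ext
        exact hI
      have h1 : 0 < 2 - ρ⁻¹ := by linarith
      have h2 : 0 < 2 - ρ := by linarith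
      rw [hj, (pow_level_corner hi0 hi2 n).2, (pow_level_corner hρ0.le hρ2 n).2,
        enorm_op_sqrt_scalarMatrix hd (by positivity) (by positivity)]
      congr 1
      have h3 : 2 * ρ - 1 ≠ 0 := by linarith
      have e : 2 - ρ⁻¹ = (2 * ρ - 1) / ρ := by field_simp
      rw [e, inv_pow]
      field_simp
      linarith
    · obtain ⟨k, hk⟩ := average_pow_level_of_ne I hI
      rw [hk, hk, enorm_op_sqrt_scalarMatrix hd (by positivity) (by positivity), ← mul_pow,
        inv_mul_cancel₀ hρ0.ne', one_pow, ENNReal.ofReal_one]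
  simp only [hterm]
  refine le_antisymm (iSup_le fun I => ?_) (le_iSup_of_le root (by simp [root]))
  split_ifs
  · exact le_rfl
  · rw [← ENNReal.ofReal_one]
    exact ENNReal.ofReal_le_ofReal ht

/-- Since `(2 - ρ)(2ρ - 1) = ρ (5 - 2(ρ + 1/ρ))`, the equation reads `ρ + 1/ρ = s` with `s = (5 -
1/t) / 2`, and the larger root lies in `[1, 2)`. -/
lemma exists_ratio {t : ℝ} (ht : 1 ≤ t) :
    ∃ ρ : ℝ, 1 ≤ ρ ∧ ρ < 2 ∧ (2 - ρ) * (2 * ρ - 1) * t = ρ := by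
  have ht0 : 0 < t := by linarith
  set s := (5 - t⁻¹) / 2 with hs
  have h1 : t⁻¹ ≤ 1 := inv_le_one_of_one_le₀ ht
  have h0 : 0 < t⁻¹ := by positivity
  have hs2 : 2 ≤ s := by rw [hs]; linarith
  have hs5 : s < 5 / 2 := by rw [hs]; linarith
  set q := √(s ^ 2 - 4) with hq
  have hq0 : 0 ≤ q := Real.sqrt_nonneg _
  have hq2 : q ^ 2 = s ^ 2 - 4 := Real.sq_sqrt (by nlinarith)
  refine ⟨(s + q) / 2, by linarith, ?_, ?_⟩
  · have : q < 4 - s := by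
      refine lt_of_pow_lt_pow_left₀ 2 (by linarith) ?_
      rw [hq2]; nlinarith
    linarith
  · have e : (2 - (s + q) / 2) * (2 * ((s + q) / 2) - 1) = (s + q) / 2 * (5 - 2 * s) := by
      nlinarith
    have e2 : 5 - 2 * s = t⁻¹ := by rw [hs]; ring
    rw [e, e2, mul_assoc, inv_mul_cancel₀ ht0.ne', mul_one]

/-! ### The lower bound -/

lemma IsRegular.ofReal_le_squareFunctionNorm {W : ℝ → Matrix (Fin d) (Fin d) ℂ} (hW : IsRegular W)
    (h : matrixA2 W < ∞) {f : ℝ → EuclideanSpace ℂ (Fin d)}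
    (hf : AEStronglyMeasurable f (volume.restrict J)) {a κ : ℝ} (ha : 0 < a) (hκ : 0 ≤ κ)
    (hnorm : ∫⁻ x in J, ENNReal.ofReal (quadForm (W x) (f x)) = ENNReal.ofReal a)
    (hsum : ENNReal.ofReal (κ ^ 2 * a) ≤
      ∑' I, ENNReal.ofReal (quadForm (matAverage W I) (haarCoeff f I))) :
    ENNReal.ofReal κ ≤ squareFunctionNorm W := by
  have hsq : weightedNorm W f ^ 2 = ENNReal.ofReal a := by rw [weightedNorm_sq hW.posDef, hnorm]
  have hmem : MemWeightedL2 W f := by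
    refine ⟨hf, ?_⟩
    rw [← sq_rpow_half (weightedNorm W f), hsq]
    exact ENNReal.rpow_lt_top_of_nonneg (by norm_num) ENNReal.ofReal_ne_top
  refine le_sInf fun C hC => ?_
  have h1 := hC f hmem
  rw [hW.l2Norm_squareFunction (hW.tsum_haarCoeff_ne_top h hmem)] at h1
  have h2 : ENNReal.ofReal κ ^ 2 * ENNReal.ofReal a ≤ C ^ 2 * ENNReal.ofReal a := by
    rw [← ENNReal.ofReal_pow hκ, ← ENNReal.ofReal_mul (by positivity), ← hsq, ← mul_pow]
    refine hsum.trans ?_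
    have h3 := ENNReal.pow_le_pow_left h1 (n := 2)
    rwa [← ENNReal.rpow_natCast, ← ENNReal.rpow_mul, show (1 / 2 : ℝ) * (2 : ℕ) = 1 by norm_num,
      ENNReal.rpow_one] at h3
  rw [ENNReal.mul_le_mul_iff_left (by simpa using ha) ENNReal.ofReal_ne_top] at h2
  exact (ENNReal.pow_le_pow_left_iff two_ne_zero).1 h2

lemma norm_haarCoeff_smul_sq {g : ℝ → ℝ} (hg : IntegrableOn g J) (e : EuclideanSpace ℂ (Fin d))
    (I : DyadicIndex) :
    ‖haarCoeff (fun x => g x • e) I‖ ^ 2 = I.length *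
      (((⨍ x in I.hi.interval, g x) - ⨍ x in I.lo.interval, g x) ^ 2 / 4) * ‖e‖ ^ 2 := by
  have hav : ∀ K : DyadicIndex,
      ⨍ x in K.interval, g x • e = (⨍ x in K.interval, g x) • e := fun K => by
    rw [K.average_eq, K.average_eq, integral_smul_const, smul_assoc]
  rw [haarCoeff_eq (hg.smul_const e), hav, hav, ← sub_smul, smul_smul, norm_smul, mul_pow,
    Real.norm_eq_abs, sq_abs, mul_pow, mul_pow, Real.sq_sqrt (by positivity)]
  have : (2 : ℝ) ^ I.1 = I.length⁻¹ := by rw [length, inv_inv]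
  have h := I.length_pos
  rw [this]
  field_simp
  ring

lemma haarCoeff_haar_root (e : EuclideanSpace ℂ (Fin d)) :
    haarCoeff (fun x => root.haar x • e) root = e := by
  have h : ∀ x, root.haar x • root.haar x • e = root.interval.indicator (fun _ => e) x := by
    intro x
    rw [smul_smul, ← sq, haar_sq, length_root]
    by_cases hx : x ∈ root.interval <;> simp [hx]
  rw [haarCoeff, restrict_J]
  simp only [h]
  rw [setIntegral_indicator root.measurableSet_interval, Set.inter_self, setIntegral_const,
    volume_real_interval, length_root, one_smul]

/-- Test on the Haar function of the whole interval: its modulus is 1, so its weighted norm already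
equals the contribution of its single root coefficient. This covers small `t`. -/
lemma one_le_squareFunctionNorm_stepWeight (hd : 0 < d) {ρ : ℝ} (hρ1 : 1 ≤ ρ)
    (h : matrixA2 (stepWeight d ρ) < ∞) : 1 ≤ squareFunctionNorm (stepWeight d ρ) := by
  have hW := isRegular_of_matrixA2_lt_top (isMatrixWeight_stepWeight hρ1) h
  have hi2 : ρ⁻¹ < 2 := (inv_le_one_of_one_le₀ hρ1).trans_lt (by norm_num)
  have hi0 : 0 < ρ⁻¹ := by positivity
  set e : EuclideanSpace ℂ (Fin d) := basisVec ⟨0, hd⟩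
  have he : ‖e‖ = 1 := norm_basisVec _
  obtain ⟨hint, hav⟩ := pow_level_corner hi0.le hi2 0
  rw [show corner 0 = root from rfl] at hint hav
  have hpos : 0 < ρ⁻¹ ^ 0 / (2 - ρ⁻¹) := div_pos (by positivity) (by linarith)
  have h1 := hW.ofReal_le_squareFunctionNorm h (f := fun x => root.haar x • e) (κ := 1)
    (a := ρ⁻¹ ^ 0 / (2 - ρ⁻¹)) ?_ hpos zero_le_one ?_ ?_
  · rwa [ENNReal.ofReal_one] at h1
  · exact (root.measurable_haar.smul_const e).aestronglyMeasurable
  · have hc : ∀ x ∈ root.interval, ENNReal.ofReal (quadForm (stepWeight d ρ x) (root.haar x • e)) =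
        ENNReal.ofReal (ρ⁻¹ ^ level x) := by
      intro x hx
      rw [stepWeight, quadForm_scalarMatrix, norm_smul, he, mul_one, Real.norm_eq_abs, sq_abs,
        haar_sq, Set.indicator_of_mem hx, length_root, inv_one, mul_one]
    rw [restrict_J, setLIntegral_congr_fun root.measurableSet_interval hc,
      ← ofReal_integral_eq_lintegral_ofReal hint (ae_of_all _ fun x => by positivity), ← hav,
      DyadicIndex.average_eq, length_root, inv_one, one_smul]
  · refine le_trans (le_of_eq ?_) (ENNReal.le_tsum root)
    rw [haarCoeff_haar_root, show stepWeight d ρ = fun x => scalarMatrix d (ρ⁻¹ ^ level x) from rfl,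
      matAverage_scalarMatrix, quadForm_scalarMatrix, he, ← hav]
    simp

lemma quadForm_haarCoeff_stepWeight {ρ : ℝ} (hρ1 : 1 ≤ ρ) (hρ2 : ρ < 2)
    {e : EuclideanSpace ℂ (Fin d)} (he : ‖e‖ = 1) (n : ℕ) :
    quadForm (matAverage (stepWeight d ρ) (corner n))
        (haarCoeff (fun x => ρ ^ level x • e) (corner n)) =
      (ρ - 1) ^ 2 / ((2 - ρ⁻¹) * (2 - ρ) ^ 2) * (ρ / 2) ^ n := by
  have hρ0 : 0 < ρ := by linarith
  have hi2 : ρ⁻¹ < 2 := (inv_le_one_of_one_le₀ hρ1).trans_lt (by norm_num)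
  rw [show stepWeight d ρ = fun x => scalarMatrix d (ρ⁻¹ ^ level x) from rfl,
    matAverage_scalarMatrix, quadForm_scalarMatrix,
    norm_haarCoeff_smul_sq (integrableOn_pow_level hρ0.le hρ2), he, lo_corner,
    average_pow_level_hi_corner, (pow_level_corner hρ0.le hρ2 _).2,
    (pow_level_corner (by positivity) hi2 n).2, length_corner, inv_pow, div_pow]
  have h1 : 2 - ρ ≠ 0 := by linarith
  have h2 : 2 - ρ⁻¹ ≠ 0 := by linarith
  field_simp
  ring

/-- Test on the inverse weight times a unit vector. Its squared norm is `(2 - ρ)⁻¹`, while the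
coefficients at the origin alone sum to order `(2 - ρ)⁻³`; the quotient is of order `t²`. -/
lemma le_squareFunctionNorm_stepWeight (hd : 0 < d) {ρ t : ℝ} (hρ1 : 3 / 2 ≤ ρ) (hρ2 : ρ < 2)
    (ht : 1 ≤ t) (h : matrixA2 (stepWeight d ρ) < ∞) (hρt : (2 - ρ) * (2 * ρ - 1) * t = ρ) :
    ENNReal.ofReal (t / 2) ≤ squareFunctionNorm (stepWeight d ρ) := by
  have hρ0 : 0 < ρ := by linarith
  have h2ρ : 0 < 2 - ρ := by linarith
  have h3ρ : 0 < 2 * ρ - 1 := by linarith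
  have hW := isRegular_of_matrixA2_lt_top (isMatrixWeight_stepWeight (by linarith)) h
  set e : EuclideanSpace ℂ (Fin d) := basisVec ⟨0, hd⟩
  have he : ‖e‖ = 1 := norm_basisVec _
  have hint := integrableOn_pow_level hρ0.le hρ2
  have e1 : 2 - ρ⁻¹ = (2 * ρ - 1) / ρ := by field_simp
  refine hW.ofReal_le_squareFunctionNorm h (f := fun x => ρ ^ level x • e) (a := (2 - ρ)⁻¹)
    (hint.smul_const e).aestronglyMeasurable (by positivity) (by positivity) ?_ ?_
  · have hc : ∀ x, quadForm (stepWeight d ρ x) (ρ ^ level x • e) = ρ ^ level x := by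
      intro x
      rw [stepWeight, quadForm_scalarMatrix, norm_smul, he, mul_one, Real.norm_eq_abs, sq_abs,
        inv_pow]
      field_simp
    simp only [hc]
    rw [← ofReal_integral_eq_lintegral_ofReal hint (ae_of_all _ fun x => by positivity), restrict_J]
    have hav := (pow_level_corner hρ0.le hρ2 0).2
    rw [DyadicIndex.average_eq, length_corner] at hav
    simp only [pow_zero, inv_one, one_smul, one_div] at hav
    exact congrArg _ hav
  · have hnn : 0 ≤ (ρ - 1) ^ 2 / ((2 - ρ⁻¹) * (2 - ρ) ^ 2) := by rw [e1]; positivity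
    have hgeom := (hasSum_geometric_of_lt_one (r := ρ / 2) (by positivity) (by linarith)).mul_left
      ((ρ - 1) ^ 2 / ((2 - ρ⁻¹) * (2 - ρ) ^ 2))
    refine le_trans ?_ (ENNReal.tsum_comp_le_tsum_of_injective corner_injective _)
    simp only [quadForm_haarCoeff_stepWeight (by linarith : (1 : ℝ) ≤ ρ) hρ2 he]
    rw [← ENNReal.ofReal_tsum_of_nonneg (fun n => by positivity) hgeom.summable, hgeom.tsum_eq]
    refine ENNReal.ofReal_le_ofReal ?_
    have ht' : t = ρ / ((2 - ρ) * (2 * ρ - 1)) := by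
      rw [eq_div_iff (by positivity)]; linarith
    have e2 : 1 - ρ / 2 = (2 - ρ) / 2 := by ring
    rw [ht', e1, e2]
    have e3 : (ρ - 1) ^ 2 / ((2 * ρ - 1) / ρ * (2 - ρ) ^ 2) * ((2 - ρ) / 2)⁻¹ =
        (2 * (ρ - 1) ^ 2 * (2 * ρ - 1) * ρ) / ((2 - ρ) ^ 3 * (2 * ρ - 1) ^ 2) := by field_simp
    have e4 : (ρ / ((2 - ρ) * (2 * ρ - 1)) / 2) ^ 2 * (2 - ρ)⁻¹ =
        (ρ ^ 2 / 4) / ((2 - ρ) ^ 3 * (2 * ρ - 1) ^ 2) := by field_simp; norm_num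
    rw [e3, e4]
    gcongr
    have h5 : 1 / 4 ≤ (ρ - 1) ^ 2 := by nlinarith
    nlinarith [mul_nonneg (mul_nonneg (sub_nonneg.2 h5) h3ρ.le) hρ0.le, mul_nonneg hρ0.le h3ρ.le]

lemma exists_weight_lower_bound (hd : 0 < d) {t : ℝ} (ht : 1 ≤ t) :
    ∃ W : ℝ → Matrix (Fin d) (Fin d) ℂ, IsMatrixWeight W ∧ matrixA2 W = ENNReal.ofReal t ∧
      ENNReal.ofReal (t / 2) ≤ squareFunctionNorm W := by
  obtain ⟨ρ, hρ1, hρ2, hρt⟩ := exists_ratio ht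
  have hA2 := matrixA2_stepWeight hd hρ1 hρ2 ht hρt
  have hfin : matrixA2 (stepWeight d ρ) < ∞ := hA2 ▸ ENNReal.ofReal_lt_top
  refine ⟨stepWeight d ρ, isMatrixWeight_stepWeight hρ1, hA2, ?_⟩
  -- For `1 ≤ ρ ≤ 3/2` one has `(2 - ρ)(2ρ - 1) ≥ 1`, so `t ≤ ρ` and `t / 2` is below the trivial
  -- bound 1.
  rcases le_total (3 / 2) ρ with h | h
  · exact le_squareFunctionNorm_stepWeight hd h hρ2 ht hfin hρt
  · refine le_trans ?_ (one_le_squareFunctionNorm_stepWeight hd hρ1 hfin)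
    rw [← ENNReal.ofReal_one]
    refine ENNReal.ofReal_le_ofReal ?_
    by_contra! hlt
    have h1 : 0 < (2 - ρ) * (2 * ρ - 1) := mul_pos (by linarith) (by linarith)
    nlinarith

end MatrixWeight

end

/-! ### The theorem -/

theorem mainTheorem1 :
    -- the mixed bound and the linear bound, with a constant that depends on the dimension only
    (∀ d : ℕ, ∃ C : ℝ≥0, ∀ W : ℝ → Matrix (Fin d) (Fin d) ℂ,
      MatrixWeight.IsMatrixWeight W → MatrixWeight.matrixA2 W < ∞ →
        MatrixWeight.MapsToL2 W ∧
        MatrixWeight.squareFunctionNorm W ≤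
          C * (MatrixWeight.matrixA2 W ^ (1 / 2 : ℝ) *
            MatrixWeight.matrixAInfty (fun x => (W x)⁻¹) ^ (1 / 2 : ℝ)) ∧
        MatrixWeight.squareFunctionNorm W ≤ C * MatrixWeight.matrixA2 W) ∧
    -- the mixed quantity is dominated by the linear one, with an absolute constant
    (∃ C : ℝ≥0, ∀ (d : ℕ) (W : ℝ → Matrix (Fin d) (Fin d) ℂ),
      MatrixWeight.IsMatrixWeight W → MatrixWeight.matrixA2 W < ∞ →
        MatrixWeight.matrixA2 W ^ (1 / 2 : ℝ) *
            MatrixWeight.matrixAInfty (fun x => (W x)⁻¹) ^ (1 / 2 : ℝ) ≤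
          C * MatrixWeight.matrixA2 W) ∧
    -- in every dimension, `d = 1` included, a bound in terms of `[W]_{A_2}` is at least linear
    (∃ c : ℝ≥0, 0 < c ∧ ∀ (d : ℕ), 1 ≤ d → ∀ φ : ℝ≥0∞ → ℝ≥0∞,
      (∀ W : ℝ → Matrix (Fin d) (Fin d) ℂ,
        MatrixWeight.IsMatrixWeight W → MatrixWeight.matrixA2 W < ∞ →
          MatrixWeight.squareFunctionNorm W ≤ φ (MatrixWeight.matrixA2 W)) →
      ∀ t : ℝ≥0∞, 1 ≤ t → t < ∞ → c * t ≤ φ t) := by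
  -- One constant serves both upper bounds: `203 d` suffices for the mixed bound, and the comparison
  -- with the linear one costs `2 = √4`.
  refine ⟨fun d => ⟨406 * d, fun W hW h => ?_⟩, ⟨2, fun d W hW h =>
    (MatrixWeight.isRegular_of_matrixA2_lt_top hW h).mixed_le_linear h⟩, ⟨2⁻¹, by norm_num, ?_⟩⟩
  · have hr := MatrixWeight.isRegular_of_matrixA2_lt_top hW h
    have h1 := hr.squareFunctionNorm_le h
    refine ⟨hr.mapsToL2 h, h1.trans ?_, h1.trans ?_⟩
    · gcongr
      norm_num
    · refine (mul_le_mul_right (hr.mixed_le_linear h) _).trans (le_of_eq ?_)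
      rw [← mul_assoc, ← ENNReal.coe_mul]
      congr 2
      ring
  · intro d hd φ hφ t ht1 ht
    obtain ⟨W, hW, hA2, hle⟩ := MatrixWeight.exists_weight_lower_bound (d := d) hd
      (t := t.toReal) (by simpa using ENNReal.toReal_mono ht.ne ht1)
    have h1 := hφ W hW (hA2 ▸ ENNReal.ofReal_lt_top)
    rw [hA2, ENNReal.ofReal_toReal ht.ne] at h1
    refine le_trans (le_of_eq ?_) (hle.trans h1)
    rw [div_eq_inv_mul, ENNReal.ofReal_mul (by norm_num), ENNReal.ofReal_toReal ht.ne,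
      ENNReal.ofReal_inv_of_pos (by norm_num)]
    simp
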